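/- **Conventions.** Let $(\mathcal M,\otimes,\mathbf 1)$ be a symmetric monoidal category and $\mathcal O$ an operad in $\mathcal M$: objects $\mathcal O(m)$, $m\ge 0$, with right $\Sigma_m$-actions, a unit $1\colon\mathbf 1\to\mathcal O(1)$ and composition maps $\Gamma\colon\mathcal O(m)\otimes\mathcal O(j_1)\otimes\cdots\otimes\mathcal O(j_m)\to\mathcal O(j_1+\cdots+j_m)$, which are associative, unital and equivariant. An $\mathcal O$-algebra is an object $A$ with $\Sigma_m$-invariant, associative and unital action maps $\xi_m\colon\mathcal O(m)\otimes A^{(m)}\to A$, where $A^{(m)}$ is the $m$-th tensor power; $\mathcal M[\mathcal O]$ is the category of $\mathcal O$-algebras. **(1) Limits.** Let $D\colon\mathcal D\to\mathcal M[\mathcal O]$ be a diagram and let $L$ be a limit in $\mathcal M$ of the underlying diagram. Then $L$ has a unique $\mathcal O$-algebra structure for which all projections $L\to D(d)$ are maps of $\mathcal O$-algebras, and with this structure $L$ is the limit of $D$ in $\mathcal M[\mathcal O]$. From now on assume that $\mathcal M$ has countable colimits and that $\otimes$ commutes with countable colimits in each variable. Put $$\mathbb O X=\coprod_{m\ge 0}\mathcal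 O(m)\otimes_{\Sigma_m}X^{(m)},$$ let $\eta\colon X\to\mathbb OX$ be the map induced by $1$, and for an $\mathcal O$-algebra $A$ let $\xi\colon\mathbb OA\to A$ be the map assembled from the $\xi_m$. There is exactly one $\mathcal O$-algebra structure on $\mathbb OX$ whose action maps are given on summands by $\Gamma\otimes\mathrm{id}$, namely $\mathcal O(m)\otimes\bigotimes_i\bigl(\mathcal O(j_i)\otimes X^{(j_i)}\bigr)\to\mathcal O(j)\otimes X^{(j)}\to\mathbb OX$ with $j=\sum_i j_i$; the corresponding map is $\mu\colon\mathbb O\mathbb OX\to\mathbb OX$. **(2) Colimits.** Let $D\colon\mathcal D\to\mathcal M[\mathcal O]$ be a diagram such that the colimits $\operatorname{colim}D$ and $\operatorname{colim}\mathbb OD$ exist in $\mathcal M$. Consider the two arrows $$\mathbb O(\operatorname{colim}\mathbb OD)\rightrightarrows\mathbb O(\operatorname{colim}D),$$ the first being $\mathbb O$ of the map induced by the action maps $\mathbb OD(d)\to D(d)$ and the second being $\mu\circ\mathbb O(i)$, where $i\colon\operatorname{colim}\mathbb OD\to\mathbb O(\operatorname{colim}D)$ is induced by the maps $\mathbb OD(d)\to\mathbb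 O(\operatorname{colim}D)$. The map $\mathbb O(\operatorname{colim}D)\to\mathbb O(\operatorname{colim}\mathbb OD)$ induced by the maps $\eta\colon D(d)\to\mathbb OD(d)$ is a section of both. Their coequalizer $K$ in $\mathcal M$ exists; it has a unique $\mathcal O$-algebra structure for which $\mathbb O(\operatorname{colim}D)\to K$ is a map of $\mathcal O$-algebras. With this structure $K$ is the coequalizer of the pair in $\mathcal M[\mathcal O]$, and $K$ with the maps $D(d)\to\operatorname{colim}D\xrightarrow{\eta}\mathbb O(\operatorname{colim}D)\to K$ is the colimit of $D$ in $\mathcal M[\mathcal O]$. **(3) The enveloping operad.** Let $A$ be an $\mathcal O$-algebra. For $m\ge0$ let $\mathcal U(m)=\mathcal U^{\mathcal O}_A(m)$ be the coequalizer in $\mathcal M$ $$\coprod_{\ell\ge0}\mathcal O(\ell+m)\otimes_{\Sigma_\ell}(\mathbb OA)^{(\ell)}\rightrightarrows\coprod_{\ell\ge0}\mathcal O(\ell+m)\otimes_{\Sigma_\ell}A^{(\ell)}\to\mathcal U(m)$$ of the map induced by $\Gamma(x;y_1,\dots,y_\ell,1,\dots,1)$ and the map induced by $\xi\colon\mathbb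 OA\to A$; here $\Sigma_\ell$ acts on the first $\ell$ inputs. The objects $\mathcal U(m)$ form an operad whose $\Sigma_m$-actions come from the action on the last $m$ inputs of $\mathcal O(\ell+m)$, whose unit is induced by that of $\mathcal O$ on the summand $\ell=0$, and whose composition is induced by composition in $\mathcal O$ along the last $m$ inputs. The summand $\ell=0$ gives maps $\mathcal O(m)\to\mathcal U(m)$, and $1\otimes\mathrm{id}_A$ with the summand $\ell=1$ gives a map $A\to\mathcal U(0)$. For each object $X$ of $\mathcal M$, restriction along $\mathcal O(m)\to\mathcal U(m)$ together with the composite $A\to\mathcal U(0)\to X$ defines a bijection from the set of $\mathcal U^{\mathcal O}_A$-algebra structures on $X$ to the set of pairs consisting of an $\mathcal O$-algebra structure on $X$ and a map of $\mathcal O$-algebras $f\colon A\to X$. The $\mathcal U^{\mathcal O}_A$-algebra structure that corresponds to such a pair is induced by the maps $\mathcal O(\ell+m)\otimes A^{(\ell)}\otimes X^{(m)}\to\mathcal O(\ell+m)\otimes X^{(\ell+m)}\to X$. A morphism $X\to Y$ of $\mathcal M$ is a map of $\mathcal U^{\mathcal O}_A$-algebras if and only if it is a map of the corresponding $\mathcal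 O$-algebras under $A$. **(4) Coproducts with free algebras.** For $X$ in $\mathcal M$ let $\mathbb U^{\mathcal O}_AX=\coprod_{m\ge0}\mathcal U^{\mathcal O}_A(m)\otimes_{\Sigma_m}X^{(m)}$ be the free $\mathcal U^{\mathcal O}_A$-algebra on $X$, regarded as an $\mathcal O$-algebra under $A$ by (3). The map $A\to\mathbb U^{\mathcal O}_AX$ and the map of $\mathcal O$-algebras $\mathbb OX\to\mathbb U^{\mathcal O}_AX$ induced by $\mathcal O(m)\to\mathcal U^{\mathcal O}_A(m)$ exhibit $\mathbb U^{\mathcal O}_AX$ as the coproduct of $A$ and $\mathbb OX$ in $\mathcal M[\mathcal O]$; in particular $A\amalg^{\mathcal M[\mathcal O]}\mathbb OX\cong\mathbb U^{\mathcal O}_AX$. -/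

import Mathlib

open CategoryTheory CategoryTheory.Limits CategoryTheory.MonoidalCategory

universe v u w w'

noncomputable section

namespace OperadicAlgebra

/-! ### Finite tensor products in a symmetric monoidal category -/

section TensorProducts

variable {C : Type u} [Category.{v} C] [MonoidalCategory C]

/-- `tensorList f [a₁, …, aₙ] = f a₁ ⊗ (f a₂ ⊗ (⋯ ⊗ (f aₙ ⊗ 𝟙)))`. -/
@[reducible] def tensorList {ι : Type} (f : ι → C) : List ι → C
  | [] => 𝟙_ C
  | a :: l => f a ⊗ tensorList f l

/-- The tensor product of a family of morphisms. -/
def tensorListMap {ι : Type} {f g : ι → C} (φ : ∀ a, f a ⟶ g a) :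
    ∀ l : List ι, tensorList f l ⟶ tensorList g l
  | [] => 𝟙 _
  | a :: l => φ a ⊗ₘ tensorListMap φ l

/-- The tensor product of a family of morphisms out of the unit object. -/
def tensorListUnits {ι : Type} {f : ι → C} (φ : ∀ a, 𝟙_ C ⟶ f a) :
    ∀ l : List ι, 𝟙_ C ⟶ tensorList f l
  | [] => 𝟙 _
  | a :: l => (λ_ (𝟙_ C)).inv ≫ (φ a ⊗ₘ tensorListUnits φ l)

/-- Rebracketing of a tensor product over a concatenation of lists. -/
def tensorListAppend {ι : Type} (f : ι → C) :
    ∀ l l' : List ι, tensorList f (l ++ l') ≅ tensorList f l ⊗ tensorList f l'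
  | [], l' => (λ_ (tensorList f l')).symm
  | a :: l, l' => whiskerLeftIso (f a) (tensorListAppend f l l') ≪≫
      (α_ (f a) (tensorList f l) (tensorList f l')).symm

/-- Relabelling of the indices of a tensor product. -/
def tensorListRelabel {ι κ : Type} (f : κ → C) (e : ι → κ) :
    ∀ l : List ι, tensorList f (l.map e) ≅ tensorList (fun i => f (e i)) l
  | [] => Iso.refl _
  | a :: l => whiskerLeftIso (f (e a)) (tensorListRelabel f e l)

/-- Rebracketing of a tensor product into consecutive blocks. -/
def tensorListBlocks {ι κ : Type} (f : κ → C) (b : ι → List κ) :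
    ∀ l : List ι, tensorList f (l.flatMap b) ≅ tensorList (fun i => tensorList f (b i)) l
  | [] => Iso.refl _
  | a :: l => eqToIso (congrArg (tensorList f) (List.flatMap_cons ..)) ≪≫
      tensorListAppend f (b a) (l.flatMap b) ≪≫
      whiskerLeftIso (tensorList f (b a)) (tensorListBlocks f b l)

theorem tensorListMap_id {ι : Type} (f : ι → C) (l : List ι) :
    tensorListMap (fun a => 𝟙 (f a)) l = 𝟙 _ := by
  induction l with
  | nil => rfl
  | cons a l ih => simp only [tensorListMap, ih]; exact id_tensorHom_id _ _

theorem tensorListMap_comp {ι : Type} {f g h : ι → C} (φ : ∀ a, f a ⟶ g a)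
    (ψ : ∀ a, g a ⟶ h a) (l : List ι) :
    tensorListMap (fun a => φ a ≫ ψ a) l = tensorListMap φ l ≫ tensorListMap ψ l := by
  induction l with
  | nil => exact (Category.id_comp _).symm
  | cons a l ih => simp only [tensorListMap, ih]; exact (tensorHom_comp_tensorHom _ _ _ _).symm

/-- The tensor product `f 0 ⊗ (f 1 ⊗ (⋯ ⊗ 𝟙))` of a family indexed by `Fin n`. -/
abbrev tensorFin {n : ℕ} (f : Fin n → C) : C := tensorList f (List.finRange n)

/-- The tensor product of a family of morphisms indexed by `Fin n`. -/
def tensorFinMap {n : ℕ} {f g : Fin n → C} (φ : ∀ i, f i ⟶ g i) : tensorFin f ⟶ tensorFin g :=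
  tensorListMap φ _

/-- The tensor power `X^(m)`. -/
abbrev tensorPow (X : C) (m : ℕ) : C := tensorFin fun _ : Fin m => X

/-- The map of tensor powers induced by a morphism. -/
def tensorPowMap {X Y : C} (f : X ⟶ Y) (m : ℕ) : tensorPow X m ⟶ tensorPow Y m :=
  tensorFinMap fun _ => f

/-- The unit isomorphism `X^(1) ≅ X`. -/
def tensorPowOne (X : C) : tensorPow X 1 ≅ X :=
  eqToIso (congrArg (tensorList fun _ => X) (show List.finRange 1 = [0] from rfl)) ≪≫ ρ_ X

/-- The isomorphism `X^(0) ≅ 𝟙`. -/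
def tensorPowZero (X : C) : tensorPow X 0 ≅ 𝟙_ C :=
  eqToIso (congrArg (tensorList fun _ => X) List.finRange_zero)

theorem tensorPowMap_id (X : C) (m : ℕ) : tensorPowMap (𝟙 X) m = 𝟙 _ :=
  tensorListMap_id _ _

theorem tensorPowMap_comp {X Y Z : C} (f : X ⟶ Y) (g : Y ⟶ Z) (m : ℕ) :
    tensorPowMap (f ≫ g) m = tensorPowMap f m ≫ tensorPowMap g m :=
  tensorListMap_comp _ _ _

theorem tensorListMap_eqToHom {ι : Type} {f g : ι → C} (φ : ∀ a, f a ⟶ g a) {l l' : List ι}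
    (h : l = l') : tensorListMap φ l ≫ eqToHom (congrArg (tensorList g) h) =
      eqToHom (congrArg (tensorList f) h) ≫ tensorListMap φ l' := by
  subst h; simp

theorem tensorListRelabel_inv_naturality {ι κ : Type} {f g : κ → C} (φ : ∀ a, f a ⟶ g a)
    (e : ι → κ) (l : List ι) :
    tensorListMap (fun i => φ (e i)) l ≫ (tensorListRelabel g e l).inv =
      (tensorListRelabel f e l).inv ≫ tensorListMap φ (l.map e) := by
  induction l with
  | nil => exact (Category.comp_id _).trans (Category.id_comp _).symm
  | cons a l ih =>
    change (φ (e a) ⊗ₘ tensorListMap (fun i => φ (e i)) l) ≫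
        (g (e a) ◁ (tensorListRelabel g e l).inv) =
      (f (e a) ◁ (tensorListRelabel f e l).inv) ≫ (φ (e a) ⊗ₘ tensorListMap φ (l.map e))
    rw [tensorHom_comp_whiskerLeft, whiskerLeft_comp_tensorHom, ih]

theorem tensorPowOne_inv_naturality {X Y : C} (f : X ⟶ Y) :
    f ≫ (tensorPowOne Y).inv = (tensorPowOne X).inv ≫ tensorPowMap f 1 := by
  have h := tensorListMap_eqToHom (f := fun _ : Fin 1 => X) (g := fun _ => Y) (fun _ => f)
    (show [0] = List.finRange 1 from rfl)
  simp only [tensorListMap] at h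
  simp only [tensorPowOne, Iso.trans_inv, eqToIso.inv, Category.assoc, tensorPowMap, tensorFinMap]
  rw [← h, tensorHom_id, rightUnitor_inv_naturality_assoc]

variable [BraidedCategory C]

/-- The canonical map `(⨂ f) ⊗ (⨂ g) ⟶ ⨂ (f ⊗ g)`. -/
def tensorListZip {ι : Type} (f g : ι → C) :
    ∀ l : List ι, tensorList f l ⊗ tensorList g l ⟶ tensorList (fun i => f i ⊗ g i) l
  | [] => (λ_ (𝟙_ C)).hom
  | a :: l => tensorμ (f a) (tensorList f l) (g a) (tensorList g l) ≫
      ((f a ⊗ g a) ◁ tensorListZip f g l)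

/-- The map that moves the first factor `f a` to the position of (the first occurrence of)
`a` in `l`, past the factors that precede it, by means of the symmetry isomorphism. -/
def tensorListInsert {ι : Type} [DecidableEq ι] (f : ι → C) (a : ι) :
    ∀ l : List ι, a ∈ l → (f a ⊗ tensorList f (l.erase a) ⟶ tensorList f l)
  | [], h => absurd h List.not_mem_nil
  | b :: l, h =>
    if hb : b = a then
      (f a ◁ eqToHom (congrArg (tensorList f) (show (b :: l).erase a = l by simp [hb]))) ≫
        eqToHom (congrArg (fun c => f c ⊗ tensorList f l) hb.symm)
    else
      (f a ◁ eqToHom (congrArg (tensorList f)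
        (show (b :: l).erase a = b :: l.erase a by simp [hb]))) ≫
        (α_ (f a) (f b) (tensorList f (l.erase a))).inv ≫
        ((β_ (f a) (f b)).hom ▷ tensorList f (l.erase a)) ≫
        (α_ (f b) (f a) (tensorList f (l.erase a))).hom ≫
        (f b ◁ tensorListInsert f a l
          ((List.mem_cons.1 h).resolve_left fun h' => hb h'.symm))

/-- The map `⨂_{a ∈ l} f a ⟶ ⨂_{a ∈ l'} f a` that permutes the factors by means of the symmetry
isomorphism, for two lists that are rearrangements of each other; it is used here only for lists
without repetitions, where the label `a` determines the position of the factor `f a`. -/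
def tensorListPerm {ι : Type} [DecidableEq ι] (f : ι → C) :
    ∀ l l' : List ι, l.Perm l' → (tensorList f l ⟶ tensorList f l')
  | [], _, h => eqToHom (congrArg (tensorList f) (List.nil_perm.1 h).symm)
  | a :: l, l', h =>
    (f a ◁ tensorListPerm f l (l'.erase a) (List.cons_perm_iff_perm_erase.1 h).2) ≫
      tensorListInsert f a l' (List.cons_perm_iff_perm_erase.1 h).1

theorem finRange_map_perm {n m : ℕ} (e : Fin n ≃ Fin m) :
    ((List.finRange n).map e).Perm (List.finRange m) := by
  rw [List.perm_ext_iff_of_nodup ((List.nodup_finRange n).map e.injective) (List.nodup_finRange m)]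
  intro a
  simpa using ⟨e.symm a, e.apply_symm_apply a⟩

theorem finRange_append_perm (a b : ℕ) :
    ((List.finRange a).map (Fin.castAdd b) ++ (List.finRange b).map (Fin.natAdd a)).Perm
      (List.finRange (a + b)) := by
  rw [List.perm_ext_iff_of_nodup _ (List.nodup_finRange _)]
  · intro x
    simp only [List.mem_append, List.mem_map, List.mem_finRange, true_and, iff_true]
    induction x using Fin.addCases with
    | left i => exact Or.inl ⟨i, rfl⟩
    | right i => exact Or.inr ⟨i, rfl⟩
  · refine List.Nodup.append ((List.nodup_finRange a).map (Fin.castAdd_injective a b))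
      ((List.nodup_finRange b).map (Fin.natAdd_injective b a)) ?_
    intro x hx hy
    simp only [List.mem_map, List.mem_finRange, true_and] at hx hy
    obtain ⟨i, rfl⟩ := hx
    obtain ⟨k, hk⟩ := hy
    have := congrArg Fin.val hk
    simp at this
    omega

theorem finRange_blocks_perm {m : ℕ} (j : Fin m → ℕ) :
    (List.finRange (∑ i, j i)).Perm ((List.finRange m).flatMap fun i =>
      (List.finRange (j i)).map fun l => finSigmaFinEquiv ⟨i, l⟩) := by
  rw [List.perm_ext_iff_of_nodup (List.nodup_finRange _)]
  · intro x
    simp only [List.mem_finRange, List.mem_flatMap, List.mem_map, true_and, true_iff]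
    exact ⟨_, _, finSigmaFinEquiv.apply_symm_apply x⟩
  · rw [List.nodup_flatMap]
    refine ⟨fun i _ => (List.nodup_finRange _).map ?_, (List.nodup_finRange m).imp ?_⟩
    · intro l l' h
      simpa using h
    · intro i i' hii x hx hy
      simp only [List.mem_map, List.mem_finRange, true_and] at hx hy
      obtain ⟨l, rfl⟩ := hx
      obtain ⟨l', h⟩ := hy
      exact hii (congrArg Sigma.fst (finSigmaFinEquiv.injective h)).symm

/-- For a bijection `e : Fin n ≃ Fin m`, the map `⨂ᵢ f (e i) ⟶ ⨂ₖ f k` that moves the factor in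
position `i` to position `e i`. -/
def tensorFinPerm {n m : ℕ} (e : Fin n ≃ Fin m) (f : Fin m → C) :
    tensorFin (fun i => f (e i)) ⟶ tensorFin f :=
  (tensorListRelabel f e _).inv ≫ tensorListPerm f _ _ (finRange_map_perm e)

/-- The concatenation `(⨂_{i < a} f i) ⊗ (⨂_{i < b} f (a + i)) ⟶ ⨂_{i < a + b} f i`. -/
def tensorFinConcat {a b : ℕ} (f : Fin (a + b) → C) :
    tensorFin (fun i => f (Fin.castAdd b i)) ⊗ tensorFin (fun i => f (Fin.natAdd a i)) ⟶
      tensorFin f :=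
  ((tensorListRelabel f _ _).inv ⊗ₘ (tensorListRelabel f _ _).inv) ≫
    (tensorListAppend f _ _).inv ≫ tensorListPerm f _ _ (finRange_append_perm a b)

/-- The decomposition of a tensor product of `j₁ + ⋯ + jₘ` factors into `m` consecutive blocks
of `j₁, …, jₘ` factors. -/
def tensorFinBlocks {m : ℕ} (j : Fin m → ℕ) (f : Fin (∑ i, j i) → C) :
    tensorFin f ⟶ tensorFin fun i => tensorFin fun l : Fin (j i) => f (finSigmaFinEquiv ⟨i, l⟩) :=
  tensorListPerm f _ _ (finRange_blocks_perm j) ≫ (tensorListBlocks f _ _).hom ≫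
    tensorListMap (fun _ => (tensorListRelabel f _ _).hom) _

/-- The shuffle `(⨂ᵢ f i) ⊗ (⨂ₜ g t) ⟶ ⨂ᵢ (f i ⊗ ⨂ₗ g (i, l))` that moves the `i`-th block of
`g`'s next to `f i` and keeps the order of the `f`'s and the order of the `g`'s. -/
def tensorFinShuffle {m : ℕ} (j : Fin m → ℕ) (f : Fin m → C) (g : Fin (∑ i, j i) → C) :
    tensorFin f ⊗ tensorFin g ⟶
      tensorFin fun i => f i ⊗ tensorFin fun l : Fin (j i) => g (finSigmaFinEquiv ⟨i, l⟩) :=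
  (tensorFin f ◁ tensorFinBlocks j g) ≫ tensorListZip _ _ _

/-- The left action of the symmetric group on a tensor power. -/
def tensorPowPerm (X : C) {m : ℕ} (σ : Equiv.Perm (Fin m)) : tensorPow X m ⟶ tensorPow X m :=
  tensorFinPerm σ fun _ => X

/-- The concatenation `X^(a) ⊗ X^(b) ⟶ X^(a + b)`. -/
def tensorPowConcat (X : C) (a b : ℕ) : tensorPow X a ⊗ tensorPow X b ⟶ tensorPow X (a + b) :=
  tensorFinConcat fun _ : Fin (a + b) => X

theorem tensorListInsert_naturality {ι : Type} [DecidableEq ι] {f g : ι → C}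
    (φ : ∀ a, f a ⟶ g a) (a : ι) (l : List ι) (h : a ∈ l) :
    (φ a ⊗ₘ tensorListMap φ (l.erase a)) ≫ tensorListInsert g a l h =
      tensorListInsert f a l h ≫ tensorListMap φ l := by
  induction l with
  | nil => exact absurd h List.not_mem_nil
  | cons b l ih =>
    by_cases hb : b = a
    · subst hb
      simp only [tensorListInsert, dif_pos, eqToHom_refl, Category.comp_id]
      rw [tensorHom_comp_whiskerLeft, tensorListMap_eqToHom φ (List.erase_cons_head ..),
        ← whiskerLeft_comp_tensorHom]
      rfl
    · simp only [tensorListInsert, dif_neg hb]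
      rw [← Category.assoc, tensorHom_comp_whiskerLeft,
        tensorListMap_eqToHom φ (show (b :: l).erase a = b :: l.erase a by simp [hb]),
        ← whiskerLeft_comp_tensorHom]
      simp only [Category.assoc]
      congr 1
      rw [tensorListMap, tensorListMap]
      rw [whiskerLeft_comp_tensorHom, ← ih, ← tensorHom_comp_whiskerLeft,
        associator_inv_naturality_assoc, ← associator_naturality_assoc]
      rw [whiskerRight_comp_tensorHom_assoc, ← BraidedCategory.braiding_naturality,
        ← tensorHom_comp_whiskerRight_assoc]

theorem tensorListPerm_naturality {ι : Type} [DecidableEq ι] {f g : ι → C}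
    (φ : ∀ a, f a ⟶ g a) (l l' : List ι) (h : l.Perm l') :
    tensorListMap φ l ≫ tensorListPerm g l l' h =
      tensorListPerm f l l' h ≫ tensorListMap φ l' := by
  induction l generalizing l' with
  | nil => exact tensorListMap_eqToHom φ (List.nil_perm.1 h).symm
  | cons a l ih =>
    simp only [tensorListPerm, tensorListMap, Category.assoc]
    rw [← tensorListInsert_naturality, ← Category.assoc, ← Category.assoc,
      whiskerLeft_comp_tensorHom, tensorHom_comp_whiskerLeft, ih]

theorem tensorPowPerm_naturality {X Y : C} (f : X ⟶ Y) {m : ℕ} (σ : Equiv.Perm (Fin m)) :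
    tensorPowMap f m ≫ tensorPowPerm Y σ = tensorPowPerm X σ ≫ tensorPowMap f m := by
  dsimp only [tensorPowMap, tensorFinMap, tensorPowPerm, tensorFinPerm]
  rw [Category.assoc, ← tensorListPerm_naturality, ← Category.assoc, ← Category.assoc]
  congr 1
  exact tensorListRelabel_inv_naturality (f := fun _ => X) (g := fun _ => Y) (fun _ => f) _ _

end TensorProducts

variable {C : Type u} [Category.{v} C] [MonoidalCategory C]

/-! ### Symmetric sequences and operads -/

variable (C) in
/-- A sequence of objects `obj m` with right actions of the symmetric groups. -/
structure SymmetricSequence where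
  obj : ℕ → C
  act : ∀ {m : ℕ}, Equiv.Perm (Fin m) → (obj m ⟶ obj m)
  act_one : ∀ m : ℕ, act (1 : Equiv.Perm (Fin m)) = 𝟙 (obj m)
  act_mul : ∀ {m : ℕ} (σ τ : Equiv.Perm (Fin m)), act (σ * τ) = act σ ≫ act τ

namespace SymmetricSequence

/-- The right action of a bijection `e : Fin n ≃ Fin m` (where necessarily `n = m`). -/
def actEquiv (P : SymmetricSequence C) {n m : ℕ} (e : Fin n ≃ Fin m) : P.obj m ⟶ P.obj n :=
  eqToHom (congrArg P.obj (Fin.equiv_iff_eq.1 ⟨e⟩).symm) ≫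
    P.act (e.trans (finCongr (Fin.equiv_iff_eq.1 ⟨e⟩).symm))

end SymmetricSequence

/-- The block sum `σ₁ ⊕ ⋯ ⊕ σₘ` of permutations. -/
def blockSum {m : ℕ} {j : Fin m → ℕ} (σ : ∀ i, Equiv.Perm (Fin (j i))) :
    Equiv.Perm (Fin (∑ i, j i)) :=
  finSigmaFinEquiv.permCongr (Equiv.sigmaCongrRight σ)

/-- The block permutation of a permutation `σ` of `m` blocks; block number `i` of the source, of
size `j (σ i)`, is moved to block number `σ i` of the target without changing its order. -/
def blockPerm {m : ℕ} (σ : Equiv.Perm (Fin m)) (j : Fin m → ℕ) :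
    Fin (∑ i, j (σ i)) ≃ Fin (∑ i, j i) :=
  finSigmaFinEquiv.symm.trans
    ((Equiv.sigmaCongrLeft (β := fun i => Fin (j i)) σ).trans finSigmaFinEquiv)

/-- The sum `σ ⊕ τ` of two permutations. -/
def permAdd {a b : ℕ} (σ : Equiv.Perm (Fin a)) (τ : Equiv.Perm (Fin b)) :
    Equiv.Perm (Fin (a + b)) :=
  finSumFinEquiv.permCongr (Equiv.Perm.sumCongr σ τ)

theorem sum_blocks {m : ℕ} (j : Fin m → ℕ) (k : Fin (∑ i, j i) → ℕ) :
    ∑ i, ∑ l : Fin (j i), k (finSigmaFinEquiv ⟨i, l⟩) = ∑ t, k t := by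
  rw [← Fintype.sum_sigma' fun i (l : Fin (j i)) => k (finSigmaFinEquiv ⟨i, l⟩)]
  exact Equiv.sum_comp finSigmaFinEquiv k

variable [SymmetricCategory C]

variable (C) in
/-- Operads in a symmetric monoidal category. -/
structure Operad extends SymmetricSequence C where
  /-- the unit map -/
  one : 𝟙_ C ⟶ obj 1
  /-- the composition rule -/
  comp : ∀ {m : ℕ} (j : Fin m → ℕ), obj m ⊗ tensorFin (fun i => obj (j i)) ⟶ obj (∑ i, j i)
  comp_assoc : ∀ {m : ℕ} (j : Fin m → ℕ) (k : Fin (∑ i, j i) → ℕ),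
    (comp j ▷ tensorFin fun t => obj (k t)) ≫ comp k =
      (α_ (obj m) (tensorFin fun i => obj (j i)) (tensorFin fun t => obj (k t))).hom ≫
        (obj m ◁ (tensorFinShuffle j (fun i => obj (j i)) (fun t => obj (k t)) ≫
          tensorFinMap fun i => comp fun l : Fin (j i) => k (finSigmaFinEquiv ⟨i, l⟩))) ≫
        comp (fun i => ∑ l : Fin (j i), k (finSigmaFinEquiv ⟨i, l⟩)) ≫
        eqToHom (congrArg obj (sum_blocks j k))
  one_comp : ∀ m : ℕ,
    (one ⊗ₘ (tensorPowOne (obj m)).inv) ≫ comp (fun _ : Fin 1 => m) ≫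
      eqToHom (congrArg obj (by simp)) = (λ_ (obj m)).hom
  comp_one : ∀ m : ℕ,
    (obj m ◁ tensorListUnits (fun _ => one) (List.finRange m)) ≫ comp (fun _ : Fin m => 1) ≫
      eqToHom (congrArg obj (by simp)) = (ρ_ (obj m)).hom
  comp_blockSum : ∀ {m : ℕ} (j : Fin m → ℕ) (σ : ∀ i, Equiv.Perm (Fin (j i))),
    (obj m ◁ tensorFinMap fun i => act (σ i)) ≫ comp j = comp j ≫ act (blockSum σ)
  comp_blockPerm : ∀ {m : ℕ} (σ : Equiv.Perm (Fin m)) (j : Fin m → ℕ),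
    (act σ ▷ tensorFin fun i => obj (j (σ i))) ≫ comp (fun i => j (σ i)) =
      (obj m ◁ tensorFinPerm σ fun i => obj (j i)) ≫ comp j ≫
        toSymmetricSequence.actEquiv (blockPerm σ j)

/-! ### Algebras over an operad -/

/-- An `O`-algebra structure on the object `A`. -/
@[ext]
structure AlgebraStructure (O : Operad C) (A : C) where
  /-- the action maps -/
  ξ : ∀ m : ℕ, O.obj m ⊗ tensorPow A m ⟶ A
  equivariant : ∀ (m : ℕ) (σ : Equiv.Perm (Fin m)),
    (O.act σ⁻¹ ⊗ₘ tensorPowPerm A σ) ≫ ξ m = ξ m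
  assoc : ∀ {m : ℕ} (j : Fin m → ℕ),
    (O.comp j ▷ tensorPow A (∑ i, j i)) ≫ ξ (∑ i, j i) =
      (α_ (O.obj m) (tensorFin fun i => O.obj (j i)) (tensorPow A (∑ i, j i))).hom ≫
        (O.obj m ◁ (tensorFinShuffle j (fun i => O.obj (j i)) (fun _ => A) ≫
          tensorFinMap fun i => ξ (j i))) ≫ ξ m
  unit : (O.one ⊗ₘ (tensorPowOne A).inv) ≫ ξ 1 = (λ_ A).hom

/-- `f` commutes with the action maps. -/
def IsAlgebraHom {O : Operad C} {A B : C} (a : AlgebraStructure O A) (b : AlgebraStructure O B)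
    (f : A ⟶ B) : Prop :=
  ∀ m : ℕ, a.ξ m ≫ f = (O.obj m ◁ tensorPowMap f m) ≫ b.ξ m

/-- An `O`-algebra. -/
structure OperadAlgebra (O : Operad C) where
  carrier : C
  str : AlgebraStructure O carrier

namespace OperadAlgebra

/-- A map of `O`-algebras. -/
@[ext]
structure Hom {O : Operad C} (A B : OperadAlgebra O) where
  hom : A.carrier ⟶ B.carrier
  isAlgebraHom : IsAlgebraHom A.str B.str hom

instance instCategory (O : Operad C) : Category (OperadAlgebra O) where
  Hom A B := Hom A B
  id A := ⟨𝟙 _, fun m => by rw [tensorPowMap_id]; simp⟩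
  comp f g := ⟨f.hom ≫ g.hom, fun m => by
    rw [tensorPowMap_comp, ← Category.assoc, f.isAlgebraHom, Category.assoc, g.isAlgebraHom]
    simp⟩

theorem id_hom {O : Operad C} (A : OperadAlgebra O) : Hom.hom (𝟙 A) = 𝟙 A.carrier := rfl

theorem comp_hom {O : Operad C} {A B D : OperadAlgebra O} (f : A ⟶ B) (g : B ⟶ D) :
    Hom.hom (f ≫ g) = f.hom ≫ g.hom := rfl

theorem hom_ext {O : Operad C} {A B : OperadAlgebra O} (f g : A ⟶ B) (h : f.hom = g.hom) : f = g :=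
  Hom.ext h

/-- The underlying object of an `O`-algebra. -/
def forget (O : Operad C) : OperadAlgebra O ⥤ C where
  obj A := A.carrier
  map f := f.hom

/-- A cone on the underlying diagram whose projections are maps of `O`-algebras. -/
def coneOf {O : Operad C} {J : Type w} [Category.{w'} J] (D : J ⥤ OperadAlgebra O)
    (c : Cone (D ⋙ forget O)) (a : AlgebraStructure O c.pt)
    (h : ∀ d, IsAlgebraHom a (D.obj d).str (c.π.app d)) : Cone D where
  pt := ⟨c.pt, a⟩
  π :=
    { app := fun d => ⟨c.π.app d, h d⟩
      naturality := fun _ _ f => hom_ext _ _ (c.π.naturality f) }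

/-- A cocone on the underlying diagram whose coprojections are maps of `O`-algebras. -/
def coconeOf {O : Operad C} {J : Type w} [Category.{w'} J] (D : J ⥤ OperadAlgebra O)
    (c : Cocone (D ⋙ forget O)) (a : AlgebraStructure O c.pt)
    (h : ∀ d, IsAlgebraHom (D.obj d).str a (c.ι.app d)) : Cocone D where
  pt := ⟨c.pt, a⟩
  ι :=
    { app := fun d => ⟨c.ι.app d, h d⟩
      naturality := fun _ _ f => hom_ext _ _ (c.ι.naturality f) }

end OperadAlgebra

/-! ### The functor `∐ₘ P(m) ⊗_{Σₘ} X^(m)` -/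

variable (C) in
/-- The tensor product commutes with countable colimits in each variable. -/
class TensorPreservesCountableColimits : Prop where
  left : ∀ (J : Type) [SmallCategory J] [CountableCategory J] (X : C),
    PreservesColimitsOfShape J (tensorLeft X)
  right : ∀ (J : Type) [SmallCategory J] [CountableCategory J] (X : C),
    PreservesColimitsOfShape J (tensorRight X)

namespace SymmetricSequence

/-- The diagonal left action of `Σₘ` on `P(m) ⊗ X^(m)`. -/
def diagonalAct (P : SymmetricSequence C) (m : ℕ) (X : C) (σ : Equiv.Perm (Fin m)) :
    P.obj m ⊗ tensorPow X m ⟶ P.obj m ⊗ tensorPow X m :=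
  P.act σ⁻¹ ⊗ₘ tensorPowPerm X σ

variable [HasCountableColimits C]

/-- The coinvariants `P(m) ⊗_{Σₘ} X^(m)`: the quotient of `P(m) ⊗ X^(m)` by the diagonal action,
that is, the coequalizer of the action map and the projection
`∐_{σ ∈ Σₘ} P(m) ⊗ X^(m) ⇉ P(m) ⊗ X^(m)`. -/
abbrev coinvariants (P : SymmetricSequence C) (m : ℕ) (X : C) : C :=
  coequalizer (Sigma.desc (P.diagonalAct m X))
    (Sigma.desc fun _ : Equiv.Perm (Fin m) => 𝟙 (P.obj m ⊗ tensorPow X m))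

/-- `∐ₘ P(m) ⊗_{Σₘ} X^(m)`. -/
abbrev schurObj (P : SymmetricSequence C) (X : C) : C := ∐ fun m : ℕ => P.coinvariants m X

/-- The canonical map `P(m) ⊗ X^(m) ⟶ ∐ₘ P(m) ⊗_{Σₘ} X^(m)`. -/
def incl (P : SymmetricSequence C) (m : ℕ) (X : C) :
    P.obj m ⊗ tensorPow X m ⟶ P.schurObj X :=
  coequalizer.π _ _ ≫ Sigma.ι (fun m : ℕ => P.coinvariants m X) m

theorem diagonalAct_incl (P : SymmetricSequence C) (m : ℕ) (X : C) (σ : Equiv.Perm (Fin m)) :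
    P.diagonalAct m X σ ≫ P.incl m X = P.incl m X := by
  have h := Sigma.ι (fun _ : Equiv.Perm (Fin m) => P.obj m ⊗ tensorPow X m) σ ≫=
    coequalizer.condition (Sigma.desc (P.diagonalAct m X))
      (Sigma.desc fun _ : Equiv.Perm (Fin m) => 𝟙 (P.obj m ⊗ tensorPow X m))
  rw [← Category.assoc, ← Category.assoc, Sigma.ι_desc, Sigma.ι_desc, Category.id_comp] at h
  rw [incl, ← Category.assoc, h]

/-- The map out of `∐ₘ P(m) ⊗_{Σₘ} X^(m)` given by a family of invariant maps. -/
def desc (P : SymmetricSequence C) {X Y : C} (φ : ∀ m, P.obj m ⊗ tensorPow X m ⟶ Y)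
    (h : ∀ (m : ℕ) (σ : Equiv.Perm (Fin m)), P.diagonalAct m X σ ≫ φ m = φ m) :
    P.schurObj X ⟶ Y :=
  Sigma.desc fun m => coequalizer.desc (φ m) (Sigma.hom_ext _ _ fun σ => by
    rw [← Category.assoc, ← Category.assoc, Sigma.ι_desc, Sigma.ι_desc, Category.id_comp, h])

theorem incl_desc (P : SymmetricSequence C) {X Y : C} (φ : ∀ m, P.obj m ⊗ tensorPow X m ⟶ Y)
    (h : ∀ (m : ℕ) (σ : Equiv.Perm (Fin m)), P.diagonalAct m X σ ≫ φ m = φ m) (m : ℕ) :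
    P.incl m X ≫ P.desc φ h = φ m := by
  rw [incl, desc, Category.assoc, Sigma.ι_desc, coequalizer.π_desc]

theorem schur_hom_ext (P : SymmetricSequence C) {X Y : C} (f g : P.schurObj X ⟶ Y)
    (h : ∀ m, P.incl m X ≫ f = P.incl m X ≫ g) : f = g :=
  Sigma.hom_ext _ _ fun m => coequalizer.hom_ext (by
    have := h m
    rwa [incl, Category.assoc, Category.assoc] at this)

end SymmetricSequence

namespace SymmetricSequence

theorem diagonalAct_naturality (P : SymmetricSequence C) {X Y : C} (f : X ⟶ Y) (m : ℕ)
    (σ : Equiv.Perm (Fin m)) :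
    P.diagonalAct m X σ ≫ (P.obj m ◁ tensorPowMap f m) =
      (P.obj m ◁ tensorPowMap f m) ≫ P.diagonalAct m Y σ := by
  rw [diagonalAct, diagonalAct, tensorHom_comp_whiskerLeft, whiskerLeft_comp_tensorHom,
    tensorPowPerm_naturality]

variable [HasCountableColimits C]

/-- The functor `X ↦ ∐ₘ P(m) ⊗_{Σₘ} X^(m)`. -/
def schur (P : SymmetricSequence C) : C ⥤ C where
  obj X := P.schurObj X
  map {X Y} f := P.desc (fun m => (P.obj m ◁ tensorPowMap f m) ≫ P.incl m Y) fun m σ => by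
    rw [← Category.assoc, diagonalAct_naturality, Category.assoc, diagonalAct_incl]
  map_id X := P.schur_hom_ext _ _ fun m => by
    rw [incl_desc, tensorPowMap_id, whiskerLeft_id, Category.id_comp, Category.comp_id]
  map_comp {X Y Z} f g := P.schur_hom_ext _ _ fun m => by
    rw [incl_desc, ← Category.assoc, incl_desc, Category.assoc, incl_desc, tensorPowMap_comp,
      whiskerLeft_comp, Category.assoc]

/-- The canonical map `P(m) ⊗ X^(m) ⟶ ∐ₘ P(m) ⊗_{Σₘ} X^(m)`. -/
def ι (P : SymmetricSequence C) (m : ℕ) (X : C) : P.obj m ⊗ tensorPow X m ⟶ P.schur.obj X :=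
  P.incl m X

theorem ι_map (P : SymmetricSequence C) {X Y : C} (f : X ⟶ Y) (m : ℕ) :
    P.ι m X ≫ P.schur.map f = (P.obj m ◁ tensorPowMap f m) ≫ P.ι m Y :=
  P.incl_desc (fun m => (P.obj m ◁ tensorPowMap f m) ≫ P.incl m Y) (fun m σ => by
    rw [← Category.assoc, diagonalAct_naturality, Category.assoc, diagonalAct_incl]) m

theorem hom_ext (P : SymmetricSequence C) {X Y : C} (f g : P.schur.obj X ⟶ Y)
    (h : ∀ m, P.ι m X ≫ f = P.ι m X ≫ g) : f = g :=
  P.schur_hom_ext f g h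

end SymmetricSequence

section FreeAlgebras

variable [HasCountableColimits C]

/-- The underlying functor `𝕆 X = ∐ₘ O(m) ⊗_{Σₘ} X^(m)` of the monad of the operad `O`. -/
abbrev Operad.free (O : Operad C) : C ⥤ C := O.toSymmetricSequence.schur

/-- The unit `X ⟶ 𝕆 X` of the monad, induced by the unit of the operad. -/
def Operad.unit (O : Operad C) : 𝟭 C ⟶ O.free where
  app X := (λ_ X).inv ≫ (O.one ⊗ₘ (tensorPowOne X).inv) ≫ O.ι 1 X
  naturality X Y f := by
    simp only [Functor.id_map, Functor.id_obj, Category.assoc]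
    rw [SymmetricSequence.ι_map, leftUnitor_inv_naturality_assoc, ← Category.assoc (_ ⊗ₘ _),
      tensorHom_comp_whiskerLeft, ← tensorPowOne_inv_naturality, whiskerLeft_comp_tensorHom_assoc]

/-- The map `𝕆 A ⟶ A` assembled from the action maps of an `O`-algebra structure on `A`. -/
def AlgebraStructure.action {O : Operad C} {A : C} (a : AlgebraStructure O A) :
    O.free.obj A ⟶ A :=
  O.desc a.ξ a.equivariant

theorem AlgebraStructure.ι_action {O : Operad C} {A : C} (a : AlgebraStructure O A) (m : ℕ) :
    O.ι m A ≫ a.action = a.ξ m :=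
  O.incl_desc _ _ m

/-- The natural transformation `𝕆 A ⟶ A` of functors of the `O`-algebra `A`. -/
def OperadAlgebra.action (O : Operad C) : OperadAlgebra.forget O ⋙ O.free ⟶ OperadAlgebra.forget O where
  app A := A.str.action
  naturality A B f := SymmetricSequence.hom_ext _ _ _ fun m => by
    have h := f.isAlgebraHom m
    rw [← AlgebraStructure.ι_action, ← AlgebraStructure.ι_action, Category.assoc,
      ← Category.assoc (_ ◁ _), ← SymmetricSequence.ι_map, Category.assoc] at h
    exact h.symm

/-- The canonical `O`-algebra structure on `𝕆 X`: its action maps `O(m) ⊗ (𝕆 X)^(m) ⟶ 𝕆 X` are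
induced by the composition rule, that is, on the summands
`O(m) ⊗ O(j₁) ⊗ ⋯ ⊗ O(jₘ) ⊗ X^(j₁ + ⋯ + jₘ)` they are given by `Γ ⊗ id`. -/
def IsFreeStructure (O : Operad C) (X : C) (a : AlgebraStructure O (O.free.obj X)) : Prop :=
  ∀ {m : ℕ} (j : Fin m → ℕ),
    (α_ (O.obj m) (tensorFin fun i => O.obj (j i)) (tensorPow X (∑ i, j i))).hom ≫
        (O.obj m ◁ (tensorFinShuffle j (fun i => O.obj (j i)) (fun _ => X) ≫
          tensorFinMap fun i => O.ι (j i) X)) ≫ a.ξ m =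
      (O.comp j ▷ tensorPow X (∑ i, j i)) ≫ O.ι (∑ i, j i) X

/-! ### The reflexive pair of a diagram of algebras -/

variable {O : Operad C} {J : Type w} [Category.{w'} J] (D : J ⥤ OperadAlgebra O)

/-- The arrow `𝕆 (colim 𝕆 D) ⟶ 𝕆 (colim D)` induced by the action maps `𝕆 D(d) ⟶ D(d)`. -/
def colimFst {cO : Cocone ((D ⋙ OperadAlgebra.forget O) ⋙ O.free)} (hO : IsColimit cO)
    (cD : Cocone (D ⋙ OperadAlgebra.forget O)) : O.free.obj cO.pt ⟶ O.free.obj cD.pt :=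
  O.free.map (hO.map cD (Functor.whiskerLeft D (OperadAlgebra.action O)))

/-- The arrow `𝕆 (colim 𝕆 D) ⟶ 𝕆 𝕆 (colim D) ⟶ 𝕆 (colim D)`, where the first map is `𝕆 i` for the
map `i` assembled from the maps `𝕆 D(d) ⟶ 𝕆 (colim D)` and the second is the action map `μ` of
the canonical algebra structure on `𝕆 (colim D)`. -/
def colimSnd {cO : Cocone ((D ⋙ OperadAlgebra.forget O) ⋙ O.free)} (hO : IsColimit cO)
    (cD : Cocone (D ⋙ OperadAlgebra.forget O)) (a : AlgebraStructure O (O.free.obj cD.pt)) :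
    O.free.obj cO.pt ⟶ O.free.obj cD.pt :=
  O.free.map (hO.desc (O.free.mapCocone cD)) ≫ a.action

/-- The map `𝕆 (colim D) ⟶ 𝕆 (colim 𝕆 D)` induced by the unit maps `D(d) ⟶ 𝕆 D(d)`. -/
def colimReflexion (cO : Cocone ((D ⋙ OperadAlgebra.forget O) ⋙ O.free))
    {cD : Cocone (D ⋙ OperadAlgebra.forget O)} (hD : IsColimit cD) :
    O.free.obj cD.pt ⟶ O.free.obj cO.pt :=
  O.free.map (hD.map cO (Functor.whiskerLeft (D ⋙ OperadAlgebra.forget O) O.unit))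

end FreeAlgebras

/-! ### The enveloping operad -/

theorem sum_append_right {l : ℕ} (m : ℕ) (j : Fin l → ℕ) :
    ∑ t, Fin.append j (fun _ : Fin m => 1) t = (∑ i, j i) + m := by
  simp [Fin.sum_univ_add]

theorem sum_append_left {m : ℕ} (l : ℕ) (j : Fin m → ℕ) :
    ∑ t, Fin.append (fun _ : Fin l => 1) j t = l + ∑ i, j i := by
  simp [Fin.sum_univ_add]

namespace Operad

/-- The symmetric sequence `ℓ ↦ O(ℓ + m)`, where `Σ_ℓ` acts on the first `ℓ` inputs. -/
abbrev shift (O : Operad C) (m : ℕ) : SymmetricSequence C where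
  obj l := O.obj (l + m)
  act σ := O.act (permAdd σ 1)
  act_one l := by
    rw [← O.act_one]
    congr 1
    ext x
    induction x using Fin.addCases <;> simp [permAdd]
  act_mul σ τ := by
    rw [← O.act_mul]
    congr 1
    ext x
    induction x using Fin.addCases <;> simp [permAdd]

/-- `Γ(x; y₁, …, y_ℓ, 1, …, 1) : O(ℓ + m) ⊗ O(j₁) ⊗ ⋯ ⊗ O(j_ℓ) ⟶ O(j₁ + ⋯ + j_ℓ + m)`. -/
def compFirst (O : Operad C) {l : ℕ} (m : ℕ) (j : Fin l → ℕ) :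
    O.obj (l + m) ⊗ tensorFin (fun i => O.obj (j i)) ⟶ O.obj ((∑ i, j i) + m) :=
  (O.obj (l + m) ◁ ((ρ_ _).inv ≫
    (tensorFinMap (fun i => eqToHom (congrArg O.obj (Fin.append_left j (fun _ => 1) i).symm)) ⊗ₘ
      tensorListUnits (fun k : Fin m => O.one ≫
        eqToHom (congrArg O.obj (Fin.append_right j (fun _ => 1) k).symm)) _) ≫
    tensorFinConcat fun t => O.obj (Fin.append j (fun _ : Fin m => 1) t))) ≫
  O.comp (Fin.append j fun _ : Fin m => 1) ≫ eqToHom (congrArg O.obj (sum_append_right m j))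

/-- `Γ(x; 1, …, 1, y₁, …, yₘ) : O(ℓ + m) ⊗ O(j₁) ⊗ ⋯ ⊗ O(jₘ) ⟶ O(ℓ + j₁ + ⋯ + jₘ)`. -/
def compLast (O : Operad C) {m : ℕ} (l : ℕ) (j : Fin m → ℕ) :
    O.obj (l + m) ⊗ tensorFin (fun i => O.obj (j i)) ⟶ O.obj (l + ∑ i, j i) :=
  (O.obj (l + m) ◁ ((λ_ _).inv ≫
    (tensorListUnits (fun k : Fin l => O.one ≫
        eqToHom (congrArg O.obj (Fin.append_left (fun _ => 1) j k).symm)) _ ⊗ₘ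
      tensorFinMap (fun i => eqToHom (congrArg O.obj (Fin.append_right (fun _ => 1) j i).symm))) ≫
    tensorFinConcat fun t => O.obj (Fin.append (fun _ : Fin l => 1) j t))) ≫
  O.comp (Fin.append (fun _ : Fin l => 1) j) ≫ eqToHom (congrArg O.obj (sum_append_left l j))

end Operad

/-- The bijection that collects the inputs `a₁, …, aₘ` of `m` blocks of sizes `a₁ + j₁, …, aₘ + jₘ`
next to the first `ℓ` inputs and leaves the inputs `j₁, …, jₘ` at the end. -/
def collectEquiv {m : ℕ} (l : ℕ) (a j : Fin m → ℕ) :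
    Fin (l + ∑ i, (a i + j i)) ≃ Fin ((l + ∑ i, a i) + ∑ i, j i) :=
  finSumFinEquiv.symm.trans <|
    (Equiv.sumCongr (Equiv.refl (Fin l)) <| finSigmaFinEquiv.symm.trans <|
      (Equiv.sigmaCongrRight fun _ => finSumFinEquiv.symm).trans <|
      (Equiv.sigmaSumDistrib (fun i => Fin (a i)) (fun i => Fin (j i))).trans <|
      Equiv.sumCongr finSigmaFinEquiv finSigmaFinEquiv).trans <|
    (Equiv.sumAssoc _ _ _).symm.trans <|
    (Equiv.sumCongr finSumFinEquiv (Equiv.refl _)).trans finSumFinEquiv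

variable [HasCountableColimits C]

/-- The enveloping operad of an `O`-algebra `A`: the operad whose `m`-th object is the coequalizer
`∐_ℓ O(ℓ + m) ⊗_{Σ_ℓ} (𝕆 A)^(ℓ) ⇉ ∐_ℓ O(ℓ + m) ⊗_{Σ_ℓ} A^(ℓ) ⟶ U(m)`
of the arrow induced by the operadic multiplication and the arrow induced by `𝕆 A ⟶ A`, with the
symmetric group actions, the unit and the composition rule induced by those of `O`. -/
structure EnvelopingOperad (O : Operad C) (A : OperadAlgebra O) where
  /-- the enveloping operad -/
  operad : Operad C
  /-- the arrow `∐_ℓ O(ℓ + m) ⊗_{Σ_ℓ} (𝕆 A)^(ℓ) ⟶ ∐_ℓ O(ℓ + m) ⊗_{Σ_ℓ} A^(ℓ)` induced by the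
  operadic multiplication -/
  mult : ∀ m : ℕ, (O.shift m).schur.obj (O.free.obj A.carrier) ⟶ (O.shift m).schur.obj A.carrier
  mult_spec : ∀ (m : ℕ) {l : ℕ} (j : Fin l → ℕ),
    (α_ (O.obj (l + m)) (tensorFin fun i => O.obj (j i)) (tensorPow A.carrier (∑ i, j i))).hom ≫
        (O.obj (l + m) ◁ (tensorFinShuffle j (fun i => O.obj (j i)) (fun _ => A.carrier) ≫
          tensorFinMap fun i => O.ι (j i) A.carrier)) ≫
        (O.shift m).ι l (O.free.obj A.carrier) ≫ mult m =
      (O.compFirst m j ▷ tensorPow A.carrier (∑ i, j i)) ≫ (O.shift m).ι (∑ i, j i) A.carrier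
  /-- the coequalizer map -/
  proj : ∀ m : ℕ, (O.shift m).schur.obj A.carrier ⟶ operad.obj m
  condition : ∀ m : ℕ, mult m ≫ proj m = (O.shift m).schur.map A.str.action ≫ proj m
  isCoequalizer : ∀ m : ℕ, Nonempty (IsColimit (Cofork.ofπ (proj m) (condition m)))
  act_spec : ∀ (m l : ℕ) (σ : Equiv.Perm (Fin m)),
    (O.shift m).ι l A.carrier ≫ proj m ≫ operad.act σ =
      (O.act (permAdd (1 : Equiv.Perm (Fin l)) σ) ▷ tensorPow A.carrier l) ≫
        (O.shift m).ι l A.carrier ≫ proj m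
  one_spec : operad.one =
    O.one ≫ eqToHom (congrArg O.obj (Nat.zero_add 1).symm) ≫ (ρ_ (O.obj (0 + 1))).inv ≫
      (O.obj (0 + 1) ◁ (tensorPowZero A.carrier).inv) ≫ (O.shift 1).ι 0 A.carrier ≫ proj 1
  /-- Here the source is `(O(ℓ + m) ⊗ ⨂ᵢ O(aᵢ + jᵢ)) ⊗ (A^(ℓ) ⊗ A^(a₁ + ⋯ + aₘ))`; the left hand
  side moves the factors `A^(ℓ)` and `A^(aᵢ)` next to `O(ℓ + m)` and `O(aᵢ + jᵢ)` and composes in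
  the enveloping operad, the right hand side composes in `O` using the last `m` inputs of
  `O(ℓ + m)`. -/
  comp_spec : ∀ {m : ℕ} (l : ℕ) (a j : Fin m → ℕ),
    tensorμ (O.obj (l + m)) (tensorFin fun i => O.obj (a i + j i))
          (tensorPow A.carrier l) (tensorPow A.carrier (∑ i, a i)) ≫
        (((O.shift m).ι l A.carrier ≫ proj m) ⊗ₘ
          (tensorFinShuffle a (fun i => O.obj (a i + j i)) (fun _ => A.carrier) ≫
            tensorFinMap fun i => (O.shift (j i)).ι (a i) A.carrier ≫ proj (j i))) ≫
        operad.comp j =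
      ((O.compLast l (fun i => a i + j i) ≫ O.actEquiv (collectEquiv l a j).symm) ⊗ₘ
          tensorPowConcat A.carrier l (∑ i, a i)) ≫
        (O.shift (∑ i, j i)).ι (l + ∑ i, a i) A.carrier ≫ proj (∑ i, j i)

namespace EnvelopingOperad

variable {O : Operad C} {A : OperadAlgebra O} (U : EnvelopingOperad O A)

/-- The map `O(m) ⟶ U(m)` given by the summand `ℓ = 0`. -/
def ofOperad (m : ℕ) : O.obj m ⟶ U.operad.obj m :=
  eqToHom (congrArg O.obj (Nat.zero_add m).symm) ≫ (ρ_ (O.obj (0 + m))).inv ≫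
    (O.obj (0 + m) ◁ (tensorPowZero A.carrier).inv) ≫ (O.shift m).ι 0 A.carrier ≫ U.proj m

/-- The map `A ⟶ U(0)` given by the unit of `O` and the summand `ℓ = 1`. -/
def ofAlgebra : A.carrier ⟶ U.operad.obj 0 :=
  (λ_ A.carrier).inv ≫ ((O.one ≫ eqToHom (congrArg O.obj (Nat.add_zero 1).symm)) ⊗ₘ
    (tensorPowOne A.carrier).inv) ≫ (O.shift 0).ι 1 A.carrier ≫ U.proj 0

end EnvelopingOperad

/-- An `O`-algebra structure on `X` together with a map of `O`-algebras `A ⟶ X`. -/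
structure UnderStructure {O : Operad C} (A : OperadAlgebra O) (X : C) where
  str : AlgebraStructure O X
  map : A ⟶ (⟨X, str⟩ : OperadAlgebra O)

end OperadicAlgebra

end

open OperadicAlgebra

/-! All computations are carried out with elements. For a family `g` of objects, an element of `P`
assigns to every list of labels a set of maps from the corresponding tensor product to `P`. The
product `x ⊠ y` runs over all ways of splitting a list into two shuffled blocks. Because the values
are sets of maps rather than single maps, braidings, associators and permutations act on products of
elements just by rearranging the factors, and no coherence is left to check. Conversely, in a
product of variables with distinct labels the labels allow only one shuffle, so that at a suitable
list the product is a single isomorphism. Hence two morphisms out of an iterated tensor product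
agree as soon as they agree on products of elements (`Shape.hom_ext`), and one may argue in `C` as
one does with sets.

Over a fixed `g`, formal operations with inputs in a type, modulo permutation of the inputs, form a
monad `Term O g`; its monad laws are the operad axioms. An `O`-algebra structure on `A` makes `Elem
g A` an algebra over this monad through `eval`, maps of `O`-algebras are the maps that commute with
`eval`, and evaluation in `𝕆 X` is the multiplication of the monad.

The objects `𝕆 X`, the coequalizers of algebras and the objects `U(m)` are quotients of tensor
products, recorded as presentations (`Pres`). As `⊗` preserves countable colimits, presentations can
be tensored (`Pres.IsValid.tens`, `Pres.IsValid.fin`), with trivial relations adjoined so that one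
factor may change while the others rest. A map out of a tensor product of quotients is therefore a
map on generators that respects simultaneous replacement by related elements
(`Pres.IsValid.exists_hom_tens_fin`).

For limits, the action is forced by the jointly monic projections. For colimits, the relation
defined by a reflexive pair of algebra maps is reflexive and compatible with operations, so the
coequalizer in `C` inherits the structure (`exists_coequalizer_structure`). The pair in question
imposes on `𝕆 (colim D)` exactly that the maps from the `D(d)` commute with the actions.

An element of `U(m)` is a formal operation of `O` with inputs in `A ⊔ {1, …, m}`, modulo evaluation
of suboperations in `A` (`Term.EvalRel`). This relation is a congruence for substitution into the
second kind of inputs, so `U` is an operad by the monad laws. More generally, formal operations of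
`U` with inputs in `V` are formal operations of `O` with inputs in `A ⊔ V`, modulo evaluation
(`EnvelopingOperad.Rep`). To evaluate them in `X` one needs an `O`-algebra structure on `X` and a
map of algebras `A ⟶ X`. Finally, a map under `A` from the free `U`-algebra on `X` to `T` is a
morphism `X ⟶ T`, that is, a map of `O`-algebras `𝕆 X ⟶ T`; this is the universal property of the
coproduct. -/

noncomputable section

set_option linter.unusedSectionVars false

namespace OperadicAlgebra

/-! ### A calculus of elements -/

section Elements

variable {C : Type u} [Category.{v} C] [MonoidalCategory C] [SymmetricCategory C]

/-- `Unsh g l l₁ l₂ s`: the list `l` is a shuffle of `l₁` and `l₂`, and `s` is the map that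
distributes the tensor factors accordingly. -/
inductive Unsh {Λ : Type} (g : Λ → C) : ∀ l l₁ l₂ : List Λ,
    (tensorList g l ⟶ tensorList g l₁ ⊗ tensorList g l₂) → Prop
  | nil : Unsh g [] [] [] (λ_ (𝟙_ C)).inv
  | left {l l₁ l₂ s} (a : Λ) (h : Unsh g l l₁ l₂ s) :
      Unsh g (a :: l) (a :: l₁) l₂
        ((g a ◁ s) ≫ (α_ (g a) (tensorList g l₁) (tensorList g l₂)).inv)
  | right {l l₁ l₂ s} (a : Λ) (h : Unsh g l l₁ l₂ s) :
      Unsh g (a :: l) l₁ (a :: l₂)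
        ((g a ◁ s) ≫ (α_ (g a) (tensorList g l₁) (tensorList g l₂)).inv ≫
          ((β_ (g a) (tensorList g l₁)).hom ▷ tensorList g l₂) ≫
          (α_ (tensorList g l₁) (g a) (tensorList g l₂)).hom)

/-- Induction step of `Unsh.assoc` for a letter that ends in the middle block. The letter passes
only `L₁` in both readings, so `b` may be any map and only interchange is used. -/
theorem unsh_left_right_aux {G L L₁₂ L₁ L₂ L₃ L₂₃ : C} (s : L ⟶ L₁₂ ⊗ L₃) (t : L₁₂ ⟶ L₁ ⊗ L₂)
    (s' : L ⟶ L₁ ⊗ L₂₃) (t' : L₂₃ ⟶ L₂ ⊗ L₃) (b : G ⊗ L₁ ⟶ L₁ ⊗ G)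
    (h : G ◁ s ≫ G ◁ t ▷ L₃ ≫ G ◁ (α_ L₁ L₂ L₃).hom = G ◁ s' ≫ G ◁ L₁ ◁ t') :
    G ◁ s ≫ (α_ G L₁₂ L₃).inv ≫ (G ◁ t) ▷ L₃ ≫ (α_ G L₁ L₂).inv ▷ L₃ ≫ b ▷ L₂ ▷ L₃ ≫
        (α_ L₁ G L₂).hom ▷ L₃ ≫ (α_ L₁ (G ⊗ L₂) L₃).hom =
      G ◁ s' ≫ (α_ G L₁ L₂₃).inv ≫ b ▷ L₂₃ ≫ (α_ L₁ G L₂₃).hom ≫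
        L₁ ◁ G ◁ t' ≫ L₁ ◁ (α_ G L₂ L₃).inv := by
  calc _ = (G ◁ s ≫ G ◁ t ▷ L₃ ≫ G ◁ (α_ L₁ L₂ L₃).hom) ≫ (α_ G L₁ (L₂ ⊗ L₃)).inv ≫
        b ▷ (L₂ ⊗ L₃) ≫ (α_ L₁ G (L₂ ⊗ L₃)).hom ≫ L₁ ◁ (α_ G L₂ L₃).inv := by monoidal
    _ = _ := by
      rw [h]
      simp only [Category.assoc]
      rw [associator_inv_naturality_right_assoc, whisker_exchange_assoc,
        associator_naturality_right_assoc]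

/-- Induction step of `Unsh.assoc` for a letter that ends in the last block. One reading passes
`L₁₂` at once, the other passes `L₁` and then `L₂`; naturality of the braiding in `t` and a hexagon
compare them. -/
theorem unsh_right_aux {G L L₁₂ L₁ L₂ L₃ L₂₃ : C} (s : L ⟶ L₁₂ ⊗ L₃) (t : L₁₂ ⟶ L₁ ⊗ L₂)
    (s' : L ⟶ L₁ ⊗ L₂₃) (t' : L₂₃ ⟶ L₂ ⊗ L₃)
    (h : G ◁ s ≫ G ◁ t ▷ L₃ ≫ G ◁ (α_ L₁ L₂ L₃).hom = G ◁ s' ≫ G ◁ L₁ ◁ t') :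
    G ◁ s ≫ (α_ G L₁₂ L₃).inv ≫ (β_ G L₁₂).hom ▷ L₃ ≫ (α_ L₁₂ G L₃).hom ≫
        t ▷ (G ⊗ L₃) ≫ (α_ L₁ L₂ (G ⊗ L₃)).hom =
      G ◁ s' ≫ (α_ G L₁ L₂₃).inv ≫ (β_ G L₁).hom ▷ L₂₃ ≫ (α_ L₁ G L₂₃).hom ≫
        L₁ ◁ G ◁ t' ≫ L₁ ◁ (α_ G L₂ L₃).inv ≫ L₁ ◁ (β_ G L₂).hom ▷ L₃ ≫
        L₁ ◁ (α_ L₂ G L₃).hom := by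
  calc _ = G ◁ s ≫ (α_ G L₁₂ L₃).inv ≫ ((β_ G L₁₂).hom ≫ t ▷ G) ▷ L₃ ≫
        (α_ (L₁ ⊗ L₂) G L₃).hom ≫ (α_ L₁ L₂ (G ⊗ L₃)).hom := by monoidal
    _ = (G ◁ s ≫ G ◁ t ▷ L₃ ≫ G ◁ (α_ L₁ L₂ L₃).hom) ≫ (α_ G L₁ (L₂ ⊗ L₃)).inv ≫
        (β_ G L₁).hom ▷ (L₂ ⊗ L₃) ≫ (α_ L₁ G (L₂ ⊗ L₃)).hom ≫ L₁ ◁ (α_ G L₂ L₃).inv ≫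
        L₁ ◁ (β_ G L₂).hom ▷ L₃ ≫ L₁ ◁ (α_ L₂ G L₃).hom := by
      rw [← BraidedCategory.braiding_naturality_right, BraidedCategory.braiding_tensor_right_hom]
      monoidal
    _ = _ := by
      rw [h]
      simp only [Category.assoc]
      rw [associator_inv_naturality_right_assoc, whisker_exchange_assoc,
        associator_naturality_right_assoc]

namespace Unsh

variable {Λ : Type} {g : Λ → C}

/-- Exchanging the blocks exchanges the constructors `left` and `right`. That the braiding is its
own inverse is needed in the `right` case. -/
theorem symm {l l₁ l₂ : List Λ} {s} (h : Unsh g l l₁ l₂ s) :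
    Unsh g l l₂ l₁ (s ≫ (β_ (tensorList g l₁) (tensorList g l₂)).hom) := by
  induction h with
  | nil =>
    have : (λ_ (𝟙_ C)).inv ≫ (β_ (𝟙_ C) (𝟙_ C)).hom = (λ_ (𝟙_ C)).inv := by simp [unitors_inv_equal]
    change Unsh g [] [] [] ((λ_ (𝟙_ C)).inv ≫ (β_ (𝟙_ C) (𝟙_ C)).hom)
    rw [this]; exact nil
  | @left l l₁ l₂ s a h ih =>
    convert right a ih using 1
    simp [BraidedCategory.braiding_tensor_left_hom]
  | @right l l₁ l₂ s a h ih =>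
    convert left a ih using 1
    simp only [BraidedCategory.braiding_tensor_right_hom, Category.assoc,
      MonoidalCategory.whiskerLeft_comp, Iso.hom_inv_id_assoc]
    rw [← comp_whiskerRight_assoc, SymmetricCategory.symmetry, id_whiskerRight, Category.id_comp,
      Iso.inv_hom_id_assoc]

/-- Each letter of `l` goes to one of three blocks, and this routing can be read with the first two
or with the last two blocks bracketed. The induction sends the letters one at a time. -/
theorem assoc {l l₁₂ l₃ : List Λ} {s} (h : Unsh g l l₁₂ l₃ s) :
    ∀ {l₁ l₂ : List Λ} {t}, Unsh g l₁₂ l₁ l₂ t →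
      ∃ l₂₃ s' t', Unsh g l l₁ l₂₃ s' ∧ Unsh g l₂₃ l₂ l₃ t' ∧
        s ≫ (t ▷ tensorList g l₃) ≫ (α_ _ _ _).hom = s' ≫ (tensorList g l₁ ◁ t') := by
  induction h with
  | nil =>
    intro l₁ l₂ t ht
    cases ht
    refine ⟨_, _, _, nil, nil, ?_⟩
    simp
    monoidal
  | left a h ih =>
    intro l₁ l₂ t ht
    cases ht with
    | left _ h' =>
      obtain ⟨l₂₃, s', t', hs, ht, e⟩ := ih h'
      refine ⟨_, _, _, left a hs, ht, ?_⟩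
      have := congrArg (fun f => g a ◁ f) e
      simp only [MonoidalCategory.whiskerLeft_comp] at this
      simp only [Category.assoc]
      rw [← associator_inv_naturality_right, ← reassoc_of% this]
      monoidal
    | right _ h' =>
      obtain ⟨l₂₃, s', t', hs, ht, e⟩ := ih h'
      refine ⟨_, _, _, right a hs, left a ht, ?_⟩
      have := congrArg (fun f => g a ◁ f) e
      simp only [MonoidalCategory.whiskerLeft_comp] at this
      simp only [Category.assoc, MonoidalCategory.whiskerLeft_comp, comp_whiskerRight]
      exact unsh_left_right_aux _ _ _ _ _ this
  | right a h ih =>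
    intro l₁ l₂ t ht
    obtain ⟨l₂₃, s', t', hs, ht, e⟩ := ih ht
    refine ⟨_, _, _, right a hs, right a ht, ?_⟩
    have := congrArg (fun f => g a ◁ f) e
    simp only [MonoidalCategory.whiskerLeft_comp] at this
    simp only [Category.assoc, MonoidalCategory.whiskerLeft_comp]
    exact unsh_right_aux _ _ _ _ this

theorem nil_left_aux {l l₁ l₂ : List Λ} {s} (h : Unsh g l l₁ l₂ s) :
    l₁ = [] → l₂ = l := by
  induction h with
  | nil => intro; rfl
  | left a h ih => intro h; cases h
  | right a h ih => intro h; rw [ih h]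

theorem nil_left_aux' {l : List Λ} :
    ∀ {s : tensorList g l ⟶ tensorList g [] ⊗ tensorList g l}, Unsh g l [] l s →
      s = (λ_ (tensorList g l)).inv := by
  induction l with
  | nil => intro s h; cases h; rfl
  | cons a l ih =>
    intro s h
    cases h with
    | right _ h =>
      rw [ih h]
      simp [braiding_tensorUnit_right]

theorem nil_left (l : List Λ) : Unsh g l [] l (λ_ (tensorList g l)).inv := by
  induction l with
  | nil => exact nil
  | cons a l ih =>
    convert right a ih using 1
    simp [braiding_tensorUnit_right]

theorem append (l₁ l₂ : List Λ) : Unsh g (l₁ ++ l₂) l₁ l₂ (tensorListAppend g l₁ l₂).hom := by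
  induction l₁ with
  | nil => exact nil_left l₂
  | cons a l ih => exact left a ih

/-- The label of a letter decides its block when the blocks draw on disjoint label sets, so
concatenation is the only possible shuffle. This is what makes a product of generic elements a
singleton. -/
theorem append_unique {S₁ S₂ : Set Λ} (hS : Disjoint S₁ S₂) {l₁ l₂ : List Λ}
    (h₁ : ∀ a ∈ l₁, a ∈ S₁) (h₂ : ∀ a ∈ l₂, a ∈ S₂) :
    ∀ {l₁' l₂' : List Λ} (_ : ∀ a ∈ l₁', a ∈ S₁) (_ : ∀ a ∈ l₂', a ∈ S₂) {s},
      Unsh g (l₁ ++ l₂) l₁' l₂' s → l₁' = l₁ ∧ l₂' = l₂ := by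
  induction l₁ with
  | nil =>
    intro l₁' l₂' h₁' h₂' s h
    change Unsh g l₂ l₁' l₂' s at h
    have : l₁' = [] := by
      -- Letters of a block occur in the shuffled list, so a letter of `l₁'` would have a label in
      -- both `S₁` and `S₂`.
      have key : ∀ {l l₁ l₂ : List Λ} {s}, Unsh g l l₁ l₂ s → ∀ a ∈ l₁, a ∈ l := by
        intro l l₁ l₂ s h
        induction h with
        | nil => simp
        | left a h ih => intro b hb; simp only [List.mem_cons] at hb ⊢; exact hb.imp_right (ih b)
        | right a h ih => intro b hb; exact List.mem_cons_of_mem _ (ih b hb)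
      refine List.eq_nil_iff_forall_not_mem.2 fun a ha => ?_
      exact Set.disjoint_left.1 hS (h₁' a ha) (h₂ a (key h a ha))
    exact ⟨this, nil_left_aux h this⟩
  | cons a l ih =>
    intro l₁' l₂' h₁' h₂' s h
    have h₁a := List.forall_mem_cons.1 h₁
    cases h with
    | left _ h =>
      obtain ⟨e, e'⟩ := ih h₁a.2 (List.forall_mem_cons.1 h₁').2 h₂' h
      exact ⟨by rw [e], e'⟩
    | right _ h => exact absurd (List.forall_mem_cons.1 h₂').1 (Set.disjoint_left.1 hS h₁a.1)

theorem append_eq {S₁ S₂ : Set Λ} (hS : Disjoint S₁ S₂) {l₁ l₂ : List Λ}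
    (h₁ : ∀ a ∈ l₁, a ∈ S₁) (h₂ : ∀ a ∈ l₂, a ∈ S₂) :
    ∀ {s}, Unsh g (l₁ ++ l₂) l₁ l₂ s → s = (tensorListAppend g l₁ l₂).hom := by
  induction l₁ with
  | nil => intro s h; exact nil_left_aux' h
  | cons a l ih =>
    intro s h
    have h₁a := List.forall_mem_cons.1 h₁
    change Unsh g (a :: (l ++ l₂)) (a :: l) l₂ s at h
    cases h with
    | left _ h => rw [ih h₁a.2 h]; rfl
    | right _ h => exact absurd (List.forall_mem_cons.1 h₂).1 (Set.disjoint_left.1 hS h₁a.1)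

theorem mem {l l₁ l₂ : List Λ} {s} (h : Unsh g l l₁ l₂ s) : ∀ a ∈ l, a ∈ l₁ ∨ a ∈ l₂ := by
  induction h with
  | nil => simp
  | left a h ih =>
    intro b hb
    rcases List.mem_cons.1 hb with rfl | hb
    · simp
    · exact (ih b hb).imp_left (List.mem_cons_of_mem _)
  | right a h ih =>
    intro b hb
    rcases List.mem_cons.1 hb with rfl | hb
    · simp
    · exact (ih b hb).imp_right (List.mem_cons_of_mem _)

end Unsh

/-- The elements of an object `P` with respect to a family `g` of objects: sets of maps to `P` out
of the tensor products of lists of members of the family. -/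
def Elem {Λ : Type} (g : Λ → C) (P : C) : Type v := ∀ l : List Λ, Set (tensorList g l ⟶ P)

namespace Elem

variable {Λ : Type} {g : Λ → C}

/-- The image of an element under a morphism. -/
def app {P Q : C} (f : P ⟶ Q) (x : Elem g P) : Elem g Q := fun l => (fun φ => φ ≫ f) '' x l

/-- The tensor product of two elements. -/
def tmul {P Q : C} (x : Elem g P) (y : Elem g Q) : Elem g (P ⊗ Q) := fun l =>
  {χ | ∃ l₁ l₂ s φ ψ, Unsh g l l₁ l₂ s ∧ φ ∈ x l₁ ∧ ψ ∈ y l₂ ∧ χ = s ≫ (φ ⊗ₘ ψ)}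

/-- Membership in the unit element. -/
inductive IsOne (g : Λ → C) : ∀ l : List Λ, (tensorList g l ⟶ 𝟙_ C) → Prop
  | nil : IsOne g [] (𝟙 (𝟙_ C))

/-- The unit element. -/
def one : Elem g (𝟙_ C) := fun l => {χ | IsOne g l χ}

infixr:73 " ∙ " => app
infixr:76 " ⊠ " => tmul

theorem id_app {P : C} (x : Elem g P) : (𝟙 P) ∙ x = x := by
  funext l; simp [app]

theorem comp_app {P Q R : C} (f : P ⟶ Q) (h : Q ⟶ R) (x : Elem g P) :
    (f ≫ h) ∙ x = h ∙ f ∙ x := by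
  funext l; simp [app, Set.image_image]

theorem hom_app {P P' Q Q' : C} (f : P ⟶ P') (h : Q ⟶ Q') (x : Elem g P) (y : Elem g Q) :
    (f ⊗ₘ h) ∙ (x ⊠ y) = (f ∙ x) ⊠ (h ∙ y) := by
  funext l
  ext χ
  constructor
  · rintro ⟨_, ⟨l₁, l₂, s, φ, ψ, hs, hφ, hψ, rfl⟩, rfl⟩
    exact ⟨l₁, l₂, s, _, _, hs, ⟨φ, hφ, rfl⟩, ⟨ψ, hψ, rfl⟩, by simp⟩
  · rintro ⟨l₁, l₂, s, _, _, hs, ⟨φ, hφ, rfl⟩, ⟨ψ, hψ, rfl⟩, rfl⟩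
    exact ⟨_, ⟨l₁, l₂, s, φ, ψ, hs, hφ, hψ, rfl⟩, by simp⟩

theorem whiskerLeft_app {P Q Q' : C} (h : Q ⟶ Q') (x : Elem g P) (y : Elem g Q) :
    (P ◁ h) ∙ (x ⊠ y) = x ⊠ (h ∙ y) := by
  rw [← id_tensorHom, hom_app, id_app]

theorem whiskerRight_app {P P' Q : C} (f : P ⟶ P') (x : Elem g P) (y : Elem g Q) :
    (f ▷ Q) ∙ (x ⊠ y) = (f ∙ x) ⊠ y := by
  rw [← tensorHom_id, hom_app, id_app]

theorem braiding_subset {P Q : C} (x : Elem g P) (y : Elem g Q) (l : List Λ) :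
    ((β_ P Q).hom ∙ (x ⊠ y)) l ⊆ (y ⊠ x) l := by
  rintro _ ⟨_, ⟨l₁, l₂, s, φ, ψ, hs, hφ, hψ, rfl⟩, rfl⟩
  exact ⟨l₂, l₁, _, ψ, φ, hs.symm, hψ, hφ, by simp⟩

theorem app_mono {P Q : C} (f : P ⟶ Q) {x y : Elem g P} (h : ∀ l, x l ⊆ y l) (l : List Λ) :
    (f ∙ x) l ⊆ (f ∙ y) l :=
  Set.image_mono (h l)

/-- The missing inclusion is `braiding_subset` for the factors in the other order, transported along
the braiding, which is an involution. -/
theorem braiding_app {P Q : C} (x : Elem g P) (y : Elem g Q) :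
    (β_ P Q).hom ∙ (x ⊠ y) = y ⊠ x := by
  funext l
  refine (braiding_subset x y l).antisymm ?_
  have := app_mono (β_ P Q).hom (braiding_subset y x) l
  rwa [← comp_app, SymmetricCategory.symmetry, id_app] at this

theorem associator_subset {P Q R : C} (x : Elem g P) (y : Elem g Q) (z : Elem g R) (l : List Λ) :
    ((α_ P Q R).hom ∙ ((x ⊠ y) ⊠ z)) l ⊆ (x ⊠ (y ⊠ z)) l := by
  rintro _ ⟨_, ⟨l₁₂, l₃, s, _, χ, hs, ⟨l₁, l₂, t, φ, ψ, ht, hφ, hψ, rfl⟩, hχ, rfl⟩, rfl⟩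
  obtain ⟨l₂₃, s', t', hs', ht', e⟩ := hs.assoc ht
  refine ⟨l₁, l₂₃, s', φ, t' ≫ (ψ ⊗ₘ χ), hs', hφ, ⟨l₂, l₃, t', ψ, χ, ht', hψ, hχ, rfl⟩, ?_⟩
  have e' := congrArg (fun f => f ≫ (φ ⊗ₘ (ψ ⊗ₘ χ))) e
  simp only [Category.assoc, whiskerLeft_comp_tensorHom] at e'
  change (s ≫ (t ≫ (φ ⊗ₘ ψ) ⊗ₘ χ)) ≫ (α_ P Q R).hom = s' ≫ (φ ⊗ₘ t' ≫ (ψ ⊗ₘ χ))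
  rw [← e', ← associator_naturality, whiskerRight_comp_tensorHom_assoc, Category.assoc]

/-- Splitting off blocks from the left gives one inclusion only. For the other, reverse the order of
the three factors by braidings: this conjugates the associator into its inverse, and the first
inclusion applies to `z`, `y`, `x`. -/
theorem associator_app {P Q R : C} (x : Elem g P) (y : Elem g Q) (z : Elem g R) :
    (α_ P Q R).hom ∙ ((x ⊠ y) ⊠ z) = x ⊠ (y ⊠ z) := by
  funext l
  refine (associator_subset x y z l).antisymm ?_
  have e : (α_ R Q P).hom ≫ ((β_ R (Q ⊗ P)).hom ≫ (β_ Q P).hom ▷ R) ≫ (α_ P Q R).hom =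
      (β_ (R ⊗ Q) P).hom ≫ P ◁ (β_ R Q).hom := by
    rw [← BraidedCategory.braiding_naturality_left, BraidedCategory.braiding_tensor_right_hom,
      BraidedCategory.braiding_tensor_left_hom]
    simp
  have h := app_mono (((β_ R (Q ⊗ P)).hom ≫ (β_ Q P).hom ▷ R) ≫ (α_ P Q R).hom)
    (associator_subset z y x) l
  rw [← comp_app, e] at h
  simpa only [comp_app, braiding_app, whiskerLeft_app, whiskerRight_app] using h

theorem associator_inv_app {P Q R : C} (x : Elem g P) (y : Elem g Q) (z : Elem g R) :
    (α_ P Q R).inv ∙ (x ⊠ (y ⊠ z)) = (x ⊠ y) ⊠ z := by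
  rw [← associator_app, ← comp_app, Iso.hom_inv_id, id_app]

theorem leftUnitor_app {P : C} (x : Elem g P) : (λ_ P).hom ∙ (one ⊠ x) = x := by
  funext l
  ext χ
  constructor
  · rintro ⟨_, ⟨l₁, l₂, s, φ, ψ, hs, hφ, hψ, rfl⟩, rfl⟩
    cases hφ
    obtain rfl := hs.nil_left_aux rfl
    cases hs.nil_left_aux'
    simpa [leftUnitor_naturality] using hψ
  · intro h
    exact ⟨_, ⟨[], l, _, _, χ, Unsh.nil_left l, .nil, h, rfl⟩, by simp⟩

theorem leftUnitor_inv_app {P : C} (x : Elem g P) : (λ_ P).inv ∙ x = one ⊠ x := by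
  conv_lhs => rw [← leftUnitor_app x]
  rw [← comp_app, Iso.hom_inv_id, id_app]

theorem rightUnitor_app {P : C} (x : Elem g P) : (ρ_ P).hom ∙ (x ⊠ one) = x := by
  rw [← braiding_leftUnitor, comp_app, braiding_app, leftUnitor_app]

theorem rightUnitor_inv_app {P : C} (x : Elem g P) : (ρ_ P).inv ∙ x = x ⊠ one := by
  conv_lhs => rw [← rightUnitor_app x]
  rw [← comp_app, Iso.hom_inv_id, id_app]

theorem tensorμ_app {P Q R S : C} (x : Elem g P) (y : Elem g Q) (z : Elem g R) (w : Elem g S) :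
    tensorμ P Q R S ∙ ((x ⊠ y) ⊠ (z ⊠ w)) = (x ⊠ z) ⊠ (y ⊠ w) := by
  simp only [tensorμ, comp_app, associator_app, associator_inv_app, whiskerLeft_app,
    whiskerRight_app, braiding_app]

/-- Membership in the element given by a morphism out of a member of the family. -/
inductive IsVar {P : C} (a : Λ) (θ : g a ⟶ P) : ∀ l : List Λ, (tensorList g l ⟶ P) → Prop
  | mk : IsVar a θ [a] ((ρ_ (g a)).hom ≫ θ)

/-- The element given by a morphism out of a member of the family. -/
def var {P : C} (a : Λ) (θ : g a ⟶ P) : Elem g P := fun l => {χ | IsVar a θ l χ}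

/-- An element supported on lists of labels in `S` that detects the equality of morphisms. -/
def IsGeneric {P : C} (S : Set Λ) (x : Elem g P) : Prop :=
  (∃ l : List Λ, (∀ a ∈ l, a ∈ S) ∧ ∃ θ : tensorList g l ⟶ P, IsIso θ ∧ x l = {θ}) ∧
    ∀ l, (x l).Nonempty → ∀ a ∈ l, a ∈ S

/-- At the distinguished list both sides are singletons, so equality of sets says that the
composites with the isomorphism `θ` agree. -/
theorem IsGeneric.hom_ext {P Z : C} {S : Set Λ} {x : Elem g P} (hx : IsGeneric S x)
    {F G : P ⟶ Z} (h : F ∙ x = G ∙ x) : F = G := by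
  obtain ⟨⟨l, -, θ, hθ, e⟩, -⟩ := hx
  have := congrFun h l
  simp only [app, e, Set.image_singleton, Set.singleton_eq_singleton_iff] at this
  exact (cancel_epi θ).1 this

theorem isGeneric_var {P : C} (a : Λ) (θ : g a ⟶ P) [IsIso θ] : IsGeneric {a} (var a θ) := by
  refine ⟨⟨[a], by simp, _, inferInstance, Set.eq_singleton_iff_unique_mem.2 ⟨.mk, ?_⟩⟩, ?_⟩
  · intro χ h
    cases h
    rfl
  · rintro l ⟨χ, h⟩
    cases h
    simp

theorem isGeneric_one : IsGeneric ∅ (one : Elem g (𝟙_ C)) := by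
  refine ⟨⟨[], by simp, 𝟙 (𝟙_ C), inferInstance,
    Set.eq_singleton_iff_unique_mem.2 ⟨.nil, ?_⟩⟩, ?_⟩
  · intro χ h
    cases h
    rfl
  · rintro l ⟨χ, h⟩
    cases h
    simp

/-- Disjoint supports leave the concatenation as the only shuffle that contributes at the list `l₁
++ l₂`, and its map is a rebracketing, hence invertible. -/
theorem IsGeneric.tmul {P Q : C} {S T : Set Λ} {x : Elem g P} {y : Elem g Q}
    (hx : IsGeneric S x) (hy : IsGeneric T y) (h : Disjoint S T) :
    IsGeneric (S ∪ T) (x ⊠ y) := by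
  obtain ⟨⟨l₁, hl₁, θ₁, hθ₁, e₁⟩, h₁⟩ := hx
  obtain ⟨⟨l₂, hl₂, θ₂, hθ₂, e₂⟩, h₂⟩ := hy
  refine ⟨⟨l₁ ++ l₂, ?_, (tensorListAppend g l₁ l₂).hom ≫ (θ₁ ⊗ₘ θ₂), inferInstance,
    Set.eq_singleton_iff_unique_mem.2 ⟨?_, ?_⟩⟩, ?_⟩
  · intro a ha
    exact (List.mem_append.1 ha).imp (hl₁ a) (hl₂ a)
  · exact ⟨l₁, l₂, _, θ₁, θ₂, Unsh.append l₁ l₂, by simp [e₁], by simp [e₂], rfl⟩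
  · rintro χ ⟨l₁', l₂', s, φ, ψ, hs, hφ, hψ, rfl⟩
    obtain ⟨rfl, rfl⟩ := Unsh.append_unique h hl₁ hl₂ (h₁ _ ⟨_, hφ⟩) (h₂ _ ⟨_, hψ⟩) hs
    rw [e₁, Set.mem_singleton_iff] at hφ
    rw [e₂, Set.mem_singleton_iff] at hψ
    rw [hφ, hψ, Unsh.append_eq h hl₁ hl₂ hs]
  · rintro l ⟨χ, l₁', l₂', s, φ, ψ, hs, hφ, hψ, rfl⟩ a ha
    exact (hs.mem a ha).imp (h₁ _ ⟨_, hφ⟩ a) (h₂ _ ⟨_, hψ⟩ a)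

/-- The tensor product of a family of elements. -/
def tl {ι : Type} {f : ι → C} (x : ∀ a, Elem g (f a)) : ∀ l : List ι, Elem g (tensorList f l)
  | [] => one
  | a :: l => x a ⊠ tl x l

theorem IsGeneric.tl {ι : Type} {f : ι → C} {x : ∀ a, Elem g (f a)} {S : ι → Set Λ}
    (hx : ∀ a, IsGeneric (S a) (x a)) (hS : ∀ a b, a ≠ b → Disjoint (S a) (S b)) (l : List ι)
    (hl : l.Nodup) : IsGeneric (⋃ a ∈ l, S a) (Elem.tl x l) := by
  induction l with
  | nil =>
    have : (⋃ a ∈ ([] : List ι), S a) = ∅ := by simp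
    rw [this]
    exact isGeneric_one
  | cons a l ih =>
    rw [List.nodup_cons] at hl
    have : (⋃ b ∈ a :: l, S b) = S a ∪ ⋃ b ∈ l, S b := by simp [Set.iUnion_or, Set.iUnion_union_distrib]
    rw [this]
    refine (hx a).tmul (ih hl.2) ?_
    rw [Set.disjoint_iUnion₂_right]
    intro b hb
    exact hS a b (by rintro rfl; exact hl.1 hb)

/-! ### Structure maps of finite tensor products, evaluated on pure elements. -/

section TensorList

variable {ι : Type}

theorem tensorListMap_app {f f' : ι → C} (φ : ∀ a, f a ⟶ f' a) (x : ∀ a, Elem g (f a))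
    (l : List ι) : tensorListMap φ l ∙ tl x l = tl (fun a => φ a ∙ x a) l := by
  induction l with
  | nil => exact id_app _
  | cons a l ih => simp only [tensorListMap, tl, hom_app, ih]

theorem tensorListUnits_app {f : ι → C} (φ : ∀ a, 𝟙_ C ⟶ f a) (l : List ι) :
    tensorListUnits φ l ∙ (one : Elem g _) = tl (fun a => φ a ∙ one) l := by
  induction l with
  | nil => exact id_app _
  | cons a l ih => simp only [tensorListUnits, tl, comp_app, leftUnitor_inv_app, hom_app, ih]

theorem tensorListAppend_app {f : ι → C} (x : ∀ a, Elem g (f a)) (l l' : List ι) :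
    (tensorListAppend f l l').hom ∙ tl x (l ++ l') = tl x l ⊠ tl x l' := by
  induction l with
  | nil => exact leftUnitor_inv_app _
  | cons a l ih =>
    change ((f a ◁ (tensorListAppend f l l').hom) ≫ (α_ _ _ _).inv) ∙ (x a ⊠ tl x (l ++ l')) = _
    rw [comp_app, whiskerLeft_app, ih, associator_inv_app, tl]

theorem iso_inv_app {P Q : C} (e : P ≅ Q) {x : Elem g P} {y : Elem g Q} (h : e.hom ∙ x = y) :
    e.inv ∙ y = x := by
  rw [← h, ← comp_app, Iso.hom_inv_id, id_app]

theorem tensorListRelabel_app {κ : Type} {f : κ → C} (e : ι → κ) (x : ∀ a, Elem g (f a))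
    (l : List ι) : (tensorListRelabel f e l).hom ∙ tl x (l.map e) = tl (fun i => x (e i)) l := by
  induction l with
  | nil => exact id_app _
  | cons a l ih =>
    change (f (e a) ◁ (tensorListRelabel f e l).hom) ∙ (x (e a) ⊠ tl x (l.map e)) = _
    rw [whiskerLeft_app, ih, tl]

theorem eqToHom_tl {f : ι → C} (x : ∀ a, Elem g (f a)) {l l' : List ι} (h : l = l')
    (h' : tensorList f l = tensorList f l') : eqToHom h' ∙ tl x l = tl x l' := by
  subst h; exact id_app _

theorem tensorListBlocks_app {κ : Type} {f : κ → C} (b : ι → List κ) (x : ∀ a, Elem g (f a))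
    (l : List ι) :
    (tensorListBlocks f b l).hom ∙ tl x (l.flatMap b) = tl (fun i => tl x (b i)) l := by
  induction l with
  | nil => exact id_app _
  | cons a l ih =>
    change (eqToHom (congrArg (tensorList f) List.flatMap_cons) ≫ (tensorListAppend f (b a) (l.flatMap b)).hom ≫
      (tensorList f (b a) ◁ (tensorListBlocks f b l).hom)) ∙ tl x ((a :: l).flatMap b) = _
    rw [comp_app, eqToHom_tl x List.flatMap_cons, comp_app, tensorListAppend_app, whiskerLeft_app,
      ih, tl]

theorem tensorListZip_app {f f' : ι → C} (x : ∀ a, Elem g (f a)) (y : ∀ a, Elem g (f' a))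
    (l : List ι) : tensorListZip f f' l ∙ (tl x l ⊠ tl y l) = tl (fun a => x a ⊠ y a) l := by
  induction l with
  | nil => exact leftUnitor_app _
  | cons a l ih => simp only [tensorListZip, tl, comp_app, tensorμ_app, whiskerLeft_app, ih]

theorem tensorListInsert_app [DecidableEq ι] {f : ι → C} (x : ∀ a, Elem g (f a)) (a : ι)
    (l : List ι) (h : a ∈ l) :
    tensorListInsert f a l h ∙ (x a ⊠ tl x (l.erase a)) = tl x l := by
  induction l with
  | nil => exact absurd h List.not_mem_nil
  | cons b l ih =>
    by_cases hb : b = a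
    · subst hb
      rw [tensorListInsert, dif_pos rfl, comp_app, whiskerLeft_app, eqToHom_tl x (by simp),
        eqToHom_refl, id_app, tl]
    · rw [tensorListInsert, dif_neg hb]
      simp only [comp_app, whiskerLeft_app]
      rw [eqToHom_tl x (show (b :: l).erase a = b :: l.erase a by simp [hb])]
      simp only [tl, associator_inv_app, whiskerRight_app, braiding_app, associator_app,
        whiskerLeft_app, ih]

/-- Factors are named by labels rather than by positions, so after the permutation only the order of
the list has changed. -/
theorem tensorListPerm_app [DecidableEq ι] {f : ι → C} (x : ∀ a, Elem g (f a)) (l l' : List ι)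
    (h : l.Perm l') : tensorListPerm f l l' h ∙ tl x l = tl x l' := by
  induction l generalizing l' with
  | nil => exact eqToHom_tl x (List.nil_perm.1 h).symm _
  | cons a l ih => rw [tensorListPerm, comp_app, tl, whiskerLeft_app, ih, tensorListInsert_app]

/-- The tensor product of a family of elements indexed by `Fin n`. -/
def tf {n : ℕ} {f : Fin n → C} (x : ∀ i, Elem g (f i)) : Elem g (tensorFin f) :=
  tl x (List.finRange n)

theorem tensorFinMap_app {n : ℕ} {f f' : Fin n → C} (φ : ∀ i, f i ⟶ f' i)
    (x : ∀ i, Elem g (f i)) : tensorFinMap φ ∙ tf x = tf fun i => φ i ∙ x i :=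
  tensorListMap_app _ _ _

theorem tensorPowMap_app {X Y : C} (φ : X ⟶ Y) {n : ℕ} (x : Fin n → Elem g X) :
    tensorPowMap φ n ∙ tf x = tf fun i => φ ∙ x i :=
  tensorListMap_app _ _ _

theorem tensorFinPerm_app {n m : ℕ} (e : Fin n ≃ Fin m) {f : Fin m → C}
    (x : ∀ i, Elem g (f i)) : tensorFinPerm e f ∙ tf (fun i => x (e i)) = tf x := by
  rw [tensorFinPerm, comp_app, tf, iso_inv_app _ (tensorListRelabel_app e x _),
    tensorListPerm_app, tf]

/-- With a constant family of objects the tuple is indexed by source positions; position `i` of the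
target receives the factor from position `σ⁻¹ i`. -/
theorem tensorPowPerm_app {X : C} {n : ℕ} (σ : Equiv.Perm (Fin n)) (x : Fin n → Elem g X) :
    tensorPowPerm X σ ∙ tf x = tf fun i => x (σ⁻¹ i) := by
  have h : (fun i => x (σ⁻¹ (σ i))) = x := funext fun i => congrArg x (σ.symm_apply_apply i)
  have := tensorFinPerm_app σ (f := fun _ => X) fun i => x (σ⁻¹ i)
  rw [h] at this
  exact this

theorem tensorFinConcat_app {a b : ℕ} {f : Fin (a + b) → C} (x : ∀ i, Elem g (f i)) :
    tensorFinConcat f ∙ (tf (fun i => x (Fin.castAdd b i)) ⊠ tf fun i => x (Fin.natAdd a i)) =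
      tf x := by
  rw [tensorFinConcat, comp_app, hom_app, tf, tf, iso_inv_app _ (tensorListRelabel_app _ x _),
    iso_inv_app _ (tensorListRelabel_app _ x _), comp_app,
    iso_inv_app _ (tensorListAppend_app x _ _), tensorListPerm_app, tf]

theorem tensorFinBlocks_app {m : ℕ} (j : Fin m → ℕ) {f : Fin (∑ i, j i) → C}
    (x : ∀ t, Elem g (f t)) :
    tensorFinBlocks j f ∙ tf x =
      tf (f := fun i => tensorFin fun l : Fin (j i) => f (finSigmaFinEquiv ⟨i, l⟩)) fun i =>
        tf fun l : Fin (j i) => x (finSigmaFinEquiv ⟨i, l⟩) := by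
  rw [tensorFinBlocks, comp_app, tf, tensorListPerm_app, comp_app, tensorListBlocks_app]
  refine (tensorListMap_app _ _ _).trans ?_
  simp only [tensorListRelabel_app]
  rfl

theorem tensorFinShuffle_app {m : ℕ} (j : Fin m → ℕ) {f : Fin m → C} {f' : Fin (∑ i, j i) → C}
    (x : ∀ i, Elem g (f i)) (y : ∀ t, Elem g (f' t)) :
    tensorFinShuffle j f f' ∙ (tf x ⊠ tf y) =
      tf (f := fun i => f i ⊗ tensorFin fun l : Fin (j i) => f' (finSigmaFinEquiv ⟨i, l⟩))
        fun i => x i ⊠ tf fun l : Fin (j i) => y (finSigmaFinEquiv ⟨i, l⟩) := by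
  rw [tensorFinShuffle, comp_app, whiskerLeft_app, tensorFinBlocks_app]
  exact tensorListZip_app _ _ _

theorem tensorPowOne_inv_app {X : C} (x : Elem g X) :
    (tensorPowOne X).inv ∙ x = tf fun _ : Fin 1 => x := by
  simp only [tensorPowOne, Iso.trans_inv, eqToIso.inv, comp_app, rightUnitor_inv_app]
  exact eqToHom_tl (fun _ : Fin 1 => x) (l := [0]) rfl _

theorem tensorPowZero_inv_app {X : C} (x : Fin 0 → Elem g X) :
    (tensorPowZero X).inv ∙ one = tf x := by
  simp only [tensorPowZero, eqToIso.inv]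
  exact eqToHom_tl x (l := []) List.finRange_zero.symm _

/-- The inverse of `tensorListZip`. -/
def tensorListUnzip (f f' : ι → C) :
    ∀ l : List ι, tensorList (fun i => f i ⊗ f' i) l ⟶ tensorList f l ⊗ tensorList f' l
  | [] => (λ_ (𝟙_ C)).inv
  | a :: l => ((f a ⊗ f' a) ◁ tensorListUnzip f f' l) ≫
      tensorμ (f a) (f' a) (tensorList f l) (tensorList f' l)

theorem tensorListUnzip_app {f f' : ι → C} (x : ∀ a, Elem g (f a)) (y : ∀ a, Elem g (f' a))
    (l : List ι) : tensorListUnzip f f' l ∙ tl (fun a => x a ⊠ y a) l = tl x l ⊠ tl y l := by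
  induction l with
  | nil => exact leftUnitor_inv_app _
  | cons a l ih => simp only [tensorListUnzip, tl, comp_app, tensorμ_app, whiskerLeft_app, ih]

/-- The inverse of `tensorFinBlocks`. -/
def tensorFinUnblocks {m : ℕ} (j : Fin m → ℕ) (f : Fin (∑ i, j i) → C) :
    (tensorFin fun i => tensorFin fun l : Fin (j i) => f (finSigmaFinEquiv ⟨i, l⟩)) ⟶
      tensorFin f :=
  tensorListMap (fun _ => (tensorListRelabel f _ _).inv) _ ≫ (tensorListBlocks f _ _).inv ≫
    tensorListPerm f _ _ (finRange_blocks_perm j).symm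

theorem tensorFinUnblocks_app {m : ℕ} (j : Fin m → ℕ) {f : Fin (∑ i, j i) → C}
    (x : ∀ t, Elem g (f t)) :
    tensorFinUnblocks j f ∙
      tf (f := fun i => tensorFin fun l : Fin (j i) => f (finSigmaFinEquiv ⟨i, l⟩)) (fun i =>
        tf fun l : Fin (j i) => x (finSigmaFinEquiv ⟨i, l⟩)) = tf x := by
  rw [tensorFinUnblocks, comp_app]
  conv_lhs => enter [2]; exact tensorListMap_app _ _ _
  simp only [tf, comp_app]
  simp only [fun i => iso_inv_app _ (tensorListRelabel_app
    (fun l : Fin (j i) => finSigmaFinEquiv ⟨i, l⟩) x (List.finRange (j i)))]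
  rw [iso_inv_app _ (tensorListBlocks_app _ x _), tensorListPerm_app]

/-- The inverse of `tensorFinShuffle`. -/
def tensorFinUnshuffle {m : ℕ} (j : Fin m → ℕ) (f : Fin m → C) (f' : Fin (∑ i, j i) → C) :
    (tensorFin fun i => f i ⊗ tensorFin fun l : Fin (j i) => f' (finSigmaFinEquiv ⟨i, l⟩)) ⟶
      tensorFin f ⊗ tensorFin f' :=
  tensorListUnzip _ _ _ ≫ (tensorFin f ◁ tensorFinUnblocks j f')

theorem tensorFinUnshuffle_app {m : ℕ} (j : Fin m → ℕ) {f : Fin m → C} {f' : Fin (∑ i, j i) → C}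
    (x : ∀ i, Elem g (f i)) (y : ∀ t, Elem g (f' t)) :
    tensorFinUnshuffle j f f' ∙
      tf (f := fun i => f i ⊗ tensorFin fun l : Fin (j i) => f' (finSigmaFinEquiv ⟨i, l⟩))
        (fun i => x i ⊠ tf fun l : Fin (j i) => y (finSigmaFinEquiv ⟨i, l⟩)) = tf x ⊠ tf y := by
  rw [tensorFinUnshuffle, comp_app]
  conv_lhs => enter [2]; exact tensorListUnzip_app _ _ _
  rw [whiskerLeft_app]
  exact congrArg _ (tensorFinUnblocks_app j y)

/-- Flattening of a family of tuples. -/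
def flat {α : Type*} {m : ℕ} {j : Fin m → ℕ} (y : ∀ i, Fin (j i) → α) (t : Fin (∑ i, j i)) : α :=
  y (finSigmaFinEquiv.symm t).1 (finSigmaFinEquiv.symm t).2

theorem flat_apply {α : Type*} {m : ℕ} {j : Fin m → ℕ} (y : ∀ i, Fin (j i) → α) (i : Fin m)
    (l : Fin (j i)) : flat y (finSigmaFinEquiv ⟨i, l⟩) = y i l := by
  rw [flat, Equiv.symm_apply_apply]

theorem flat_eq {α : Type*} {m : ℕ} {j : Fin m → ℕ} (y : Fin (∑ i, j i) → α) :
    flat (fun i l => y (finSigmaFinEquiv ⟨i, l⟩)) = y := by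
  funext t
  obtain ⟨⟨i, l⟩, rfl⟩ := finSigmaFinEquiv.surjective t
  rw [flat_apply]

theorem tensorFinUnshuffle_pow_app {m : ℕ} (j : Fin m → ℕ) {f : Fin m → C} {X : C}
    (x : ∀ i, Elem g (f i)) (y : ∀ i, Fin (j i) → Elem g X) :
    tensorFinUnshuffle j f (fun _ => X) ∙
      tf (f := fun i => f i ⊗ tensorPow X (j i)) (fun i => x i ⊠ tf (y i)) =
        tf x ⊠ tf (flat y) := by
  rw [← tensorFinUnshuffle_app]
  simp only [flat_apply]

theorem tensorFinShuffle_pow_app {m : ℕ} (j : Fin m → ℕ) {f : Fin m → C} {X : C}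
    (x : ∀ i, Elem g (f i)) (y : Fin (∑ i, j i) → Elem g X) :
    tensorFinShuffle j f (fun _ => X) ∙ (tf x ⊠ tf y) =
      tf (f := fun i => f i ⊗ tensorPow X (j i))
        fun i => x i ⊠ tf fun l : Fin (j i) => y (finSigmaFinEquiv ⟨i, l⟩) :=
  tensorFinShuffle_app j x y

theorem tensorPowConcat_app {a b : ℕ} {X : C} (x : Fin a → Elem g X) (y : Fin b → Elem g X) :
    tensorPowConcat X a b ∙ (tf x ⊠ tf y) = tf (Fin.append x y) := by
  rw [tensorPowConcat, ← tensorFinConcat_app]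
  simp only [Fin.append_left, Fin.append_right]

end TensorList

end Elem

/-! ### Shapes of iterated tensor products -/

variable (C) in
/-- Formal iterated tensor products. -/
inductive Shape : Type u
  | leaf (X : C) : Shape
  | unit : Shape
  | tens (s t : Shape) : Shape
  | fin (n : ℕ) (s : Fin n → Shape) : Shape

namespace Shape

/-- The object of a shape. -/
@[reducible] def obj : Shape C → C
  | leaf X => X
  | unit => 𝟙_ C
  | tens s t => s.obj ⊗ t.obj
  | fin n s => tensorFin fun i : Fin n => (s i).obj

/-- The positions of the leaves of a shape. -/
def Leaves : Shape C → Type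
  | leaf _ => PUnit
  | unit => Empty
  | tens s t => s.Leaves ⊕ t.Leaves
  | fin _ s => Σ i, (s i).Leaves

/-- The objects at the leaves of a shape. -/
def leafObj : ∀ s : Shape C, s.Leaves → C
  | leaf X => fun _ => X
  | unit => Empty.elim
  | tens s t => Sum.elim s.leafObj t.leafObj
  | fin _ s => fun x => (s x.1).leafObj x.2

section

variable {Λ : Type} (g : Λ → C)

/-- The pure elements of a shape. -/
@[reducible] def El : Shape C → Type v
  | leaf X => Elem g X
  | unit => PUnit
  | tens s t => s.El × t.El
  | fin _ s => ∀ i, (s i).El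

variable {g}

/-- The element given by a pure element. -/
@[reducible] def ev : ∀ s : Shape C, s.El g → Elem g s.obj
  | leaf _ => fun x => x
  | unit => fun _ => Elem.one
  | tens s t => fun x => Elem.tmul (s.ev x.1) (t.ev x.2)
  | fin n s => fun x => Elem.tf (f := fun i : Fin n => (s i).obj) fun i => (s i).ev (x i)

variable (g) in
/-- A generic pure element. -/
def gen : ∀ (s : Shape C) (φ : s.Leaves → Λ), (∀ x, g (φ x) ⟶ s.leafObj x) → s.El g
  | leaf _ => fun φ θ => Elem.var (φ PUnit.unit) (θ PUnit.unit)
  | unit => fun _ _ => PUnit.unit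
  | tens s t => fun φ θ => (s.gen (fun x => φ (Sum.inl x)) fun x => θ (Sum.inl x),
      t.gen (fun x => φ (Sum.inr x)) fun x => θ (Sum.inr x))
  | fin _ s => fun φ θ i => (s i).gen (fun x => φ ⟨i, x⟩) fun x => θ ⟨i, x⟩

/-- Injectivity of the labelling gives disjoint supports to the different parts of a shape, which is
the hypothesis of `Elem.IsGeneric.tmul` and `Elem.IsGeneric.tl`. -/
theorem isGeneric_gen : ∀ (s : Shape C) (φ : s.Leaves → Λ) (θ : ∀ x, g (φ x) ⟶ s.leafObj x)
    (_ : Function.Injective φ) (_ : ∀ x, IsIso (θ x)),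
    Elem.IsGeneric (Set.range φ) (s.ev (s.gen g φ θ))
  | leaf X, φ, θ, _, hθ => by
    have : Set.range φ = {φ PUnit.unit} := by
      ext a
      exact ⟨fun ⟨x, hx⟩ => hx.symm, fun h => ⟨_, h.symm⟩⟩
    rw [this]
    exact @Elem.isGeneric_var _ _ _ _ _ _ X _ _ (hθ PUnit.unit)
  | unit, φ, θ, _, hθ => by
    have : Set.range φ = ∅ := Set.range_eq_empty_iff.2 (inferInstanceAs (IsEmpty Empty))
    rw [this]
    exact Elem.isGeneric_one
  | tens s t, φ, θ, hφ, hθ => by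
    have : Set.range φ = Set.range (fun x => φ (Sum.inl x)) ∪ Set.range (fun x => φ (Sum.inr x)) := by
      ext a
      constructor
      · rintro ⟨x | x, rfl⟩
        · exact Or.inl ⟨x, rfl⟩
        · exact Or.inr ⟨x, rfl⟩
      · rintro (⟨x, rfl⟩ | ⟨x, rfl⟩)
        exacts [⟨_, rfl⟩, ⟨_, rfl⟩]
    rw [this]
    refine (s.isGeneric_gen _ _ (fun x y h => Sum.inl_injective (hφ h)) fun x => hθ _).tmul
      (t.isGeneric_gen _ _ (fun x y h => Sum.inr_injective (hφ h)) fun x => hθ _) ?_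
    rw [Set.disjoint_left]
    rintro _ ⟨x, rfl⟩ ⟨y, h⟩
    exact Sum.inr_ne_inl (hφ h)
  | fin n s, φ, θ, hφ, hθ => by
    have : Set.range φ = ⋃ i ∈ List.finRange n, Set.range (fun x => φ ⟨i, x⟩) := by
      ext a
      simp only [List.mem_finRange, Set.iUnion_true, Set.mem_iUnion, Set.mem_range]
      constructor
      · rintro ⟨⟨i, x⟩, rfl⟩
        exact ⟨i, x, rfl⟩
      · rintro ⟨i, x, rfl⟩
        exact ⟨_, rfl⟩
    rw [this]
    refine Elem.IsGeneric.tl (fun i => (s i).isGeneric_gen _ _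
      (fun x y h => eq_of_heq (Sigma.mk.inj (hφ h)).2) fun x => hθ _) ?_ _ (List.nodup_finRange n)
    intro i i' hi
    rw [Set.disjoint_left]
    rintro _ ⟨x, rfl⟩ ⟨y, h⟩
    exact hi (congrArg Sigma.fst (hφ h)).symm

end

/-- Morphisms out of an iterated tensor product are determined by their values on pure elements. -/
theorem hom_ext (s : Shape C) {Z : C} {F G : s.obj ⟶ Z}
    (h : ∀ {Λ : Type} (g : Λ → C) (x : s.El g), F ∙ s.ev x = G ∙ s.ev x) : F = G :=
  -- Every leaf serves as its own label, with the identity as its variable.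
  (s.isGeneric_gen (g := s.leafObj) id (fun _ => 𝟙 _) Function.injective_id
    fun _ => inferInstanceAs (IsIso (𝟙 _))).hom_ext (h _ _)

end Shape

end Elements

/-! ### Presentations of objects -/

section Presentations

variable {C : Type u} [Category.{v} C] [MonoidalCategory C] [SymmetricCategory C]

open Elem

/-- A family of generators of an object `Q` and a family of relations between them, where
generators and relations are iterated tensor products. -/
structure Pres (Q : C) where
  I : Type
  J : Type
  P : I → Shape C
  R : J → Shape C
  src : J → I
  tgt : J → I
  r : ∀ j, (R j).obj ⟶ (P (src j)).obj
  s : ∀ j, (R j).obj ⟶ (P (tgt j)).obj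
  q : ∀ i, (P i).obj ⟶ Q

namespace Pres

variable {Q Q' : C}

/-- `Q` is the universal quotient of the generators by the relations, and this is preserved by
tensor products. -/
structure IsValid (p : Pres Q) : Prop where
  w : ∀ j, p.r j ≫ p.q (p.src j) = p.s j ≫ p.q (p.tgt j)
  -- The spectator `W` is what lets the property pass to tensor products; `W = 𝟙_ C` gives the plain
  -- universal property.
  exists_desc : ∀ (W : C) {Z : C} (φ : ∀ i, W ⊗ (p.P i).obj ⟶ Z),
    (∀ j, (W ◁ p.r j) ≫ φ (p.src j) = (W ◁ p.s j) ≫ φ (p.tgt j)) →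
      ∃ ψ : W ⊗ Q ⟶ Z, ∀ i, (W ◁ p.q i) ≫ ψ = φ i
  ext : ∀ (W : C) {Z : C} (ψ ψ' : W ⊗ Q ⟶ Z),
    (∀ i, (W ◁ p.q i) ≫ ψ = (W ◁ p.q i) ≫ ψ') → ψ = ψ'

/-- A spectator `B` next to the quotient is absorbed into `W` by the associator; one on the other
side is first brought here by the braiding. -/
theorem IsValid.exists_desc_right {p : Pres Q} (hp : p.IsValid) (W B : C) {Z : C}
    (φ : ∀ i, W ⊗ (B ⊗ (p.P i).obj) ⟶ Z)
    (h : ∀ j, (W ◁ B ◁ p.r j) ≫ φ (p.src j) = (W ◁ B ◁ p.s j) ≫ φ (p.tgt j)) :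
    ∃ ψ : W ⊗ (B ⊗ Q) ⟶ Z, ∀ i, (W ◁ B ◁ p.q i) ≫ ψ = φ i := by
  obtain ⟨ψ, hψ⟩ := hp.exists_desc (W ⊗ B) (fun i => (α_ _ _ _).hom ≫ φ i) fun j => by
    rw [associator_naturality_right_assoc, h, associator_naturality_right_assoc]
  exact ⟨(α_ _ _ _).inv ≫ ψ, fun i => by
    rw [associator_inv_naturality_right_assoc, hψ, Iso.inv_hom_id_assoc]⟩

theorem IsValid.ext_right {p : Pres Q} (hp : p.IsValid) (W B : C) {Z : C}
    (ψ ψ' : W ⊗ (B ⊗ Q) ⟶ Z)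
    (h : ∀ i, (W ◁ B ◁ p.q i) ≫ ψ = (W ◁ B ◁ p.q i) ≫ ψ') : ψ = ψ' := by
  rw [← cancel_epi (α_ _ _ _).hom]
  refine hp.ext _ _ _ fun i => ?_
  rw [associator_naturality_right_assoc, h, associator_naturality_right_assoc]

theorem IsValid.exists_desc_left {p : Pres Q} (hp : p.IsValid) (W B : C) {Z : C}
    (φ : ∀ i, W ⊗ ((p.P i).obj ⊗ B) ⟶ Z)
    (h : ∀ j, (W ◁ (p.r j ▷ B)) ≫ φ (p.src j) = (W ◁ (p.s j ▷ B)) ≫ φ (p.tgt j)) :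
    ∃ ψ : W ⊗ (Q ⊗ B) ⟶ Z, ∀ i, (W ◁ (p.q i ▷ B)) ≫ ψ = φ i := by
  obtain ⟨ψ, hψ⟩ := hp.exists_desc_right W B (fun i => (W ◁ (β_ _ _).hom) ≫ φ i) fun j => by
    rw [← whiskerLeft_comp_assoc, ← whiskerLeft_comp_assoc,
      BraidedCategory.braiding_naturality_right, BraidedCategory.braiding_naturality_right,
      whiskerLeft_comp_assoc, h, whiskerLeft_comp_assoc]
  refine ⟨(W ◁ (β_ _ _).hom) ≫ ψ, fun i => ?_⟩
  rw [← whiskerLeft_comp_assoc, BraidedCategory.braiding_naturality_left, whiskerLeft_comp_assoc,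
    hψ, ← whiskerLeft_comp_assoc, SymmetricCategory.symmetry, whiskerLeft_id, Category.id_comp]

theorem IsValid.ext_left {p : Pres Q} (hp : p.IsValid) (W B : C) {Z : C}
    (ψ ψ' : W ⊗ (Q ⊗ B) ⟶ Z)
    (h : ∀ i, (W ◁ (p.q i ▷ B)) ≫ ψ = (W ◁ (p.q i ▷ B)) ≫ ψ') : ψ = ψ' := by
  rw [← cancel_epi (W ◁ (β_ _ _).hom)]
  refine hp.ext_right _ _ _ _ fun i => ?_
  simp only [← whiskerLeft_comp_assoc, BraidedCategory.braiding_naturality_right]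
  rw [whiskerLeft_comp_assoc, h, whiskerLeft_comp_assoc]

/-- The presentation with one generator and no relation. -/
def ofShape (s : Shape C) : Pres s.obj where
  I := Unit
  J := Empty
  P _ := s
  R := Empty.elim
  src := Empty.elim
  tgt := Empty.elim
  r j := j.elim
  s j := j.elim
  q _ := 𝟙 _

theorem isValid_ofShape (s : Shape C) : (ofShape s).IsValid where
  w j := j.elim
  exists_desc W Z φ _ := ⟨φ (), fun i => by
    change (W ◁ 𝟙 _) ≫ φ () = φ ()
    rw [whiskerLeft_id, Category.id_comp]⟩
  ext W Z ψ ψ' h := by simpa [ofShape] using h ()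

/-- The relations of a presentation together with the trivial relations. -/
def K (p : Pres Q) : Type := p.I ⊕ p.J

/-- The objects of relations, including the trivial ones. -/
def V (p : Pres Q) : p.K → Shape C := Sum.elim p.P p.R

/-- The index of the source. -/
def ks (p : Pres Q) : p.K → p.I := Sum.elim id p.src

/-- The index of the target. -/
def kt (p : Pres Q) : p.K → p.I := Sum.elim id p.tgt

/-- The source map of relations, including the trivial ones. -/
def kr (p : Pres Q) : ∀ k : p.K, (p.V k).obj ⟶ (p.P (p.ks k)).obj
  | Sum.inl _ => 𝟙 _
  | Sum.inr j => p.r j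

/-- The target map of relations, including the trivial ones. -/
def kl (p : Pres Q) : ∀ k : p.K, (p.V k).obj ⟶ (p.P (p.kt k)).obj
  | Sum.inl _ => 𝟙 _
  | Sum.inr j => p.s j

theorem IsValid.kw {p : Pres Q} (hp : p.IsValid) (k : p.K) :
    p.kr k ≫ p.q (p.ks k) = p.kl k ≫ p.q (p.kt k) := by
  cases k with
  | inl i => rfl
  | inr j => exact hp.w j

/-- The tensor product of two presentations. -/
def tens (p : Pres Q) (p' : Pres Q') : Pres (Q ⊗ Q') where
  I := p.I × p'.I
  J := p.K × p'.K
  P i := .tens (p.P i.1) (p'.P i.2)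
  R k := .tens (p.V k.1) (p'.V k.2)
  src k := (p.ks k.1, p'.ks k.2)
  tgt k := (p.kt k.1, p'.kt k.2)
  r k := p.kr k.1 ⊗ₘ p'.kr k.2
  s k := p.kl k.1 ⊗ₘ p'.kl k.2
  q i := p.q i.1 ⊗ₘ p'.q i.2

/-- Descend in the second factor with the first generator fixed, then in the first factor. The two
descents use the relations that are trivial in one factor, which is why trivial relations are
adjoined in `K`. -/
theorem IsValid.tens {p : Pres Q} {p' : Pres Q'} (hp : p.IsValid) (hp' : p'.IsValid) :
    (p.tens p').IsValid where
  w k := by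
    change (p.kr k.1 ⊗ₘ p'.kr k.2) ≫ (p.q _ ⊗ₘ p'.q _) = (p.kl k.1 ⊗ₘ p'.kl k.2) ≫ (p.q _ ⊗ₘ p'.q _)
    rw [tensorHom_comp_tensorHom, hp.kw, hp'.kw, tensorHom_comp_tensorHom]
  exists_desc W Z φ h := by
    have h₁ : ∀ i, ∃ ψ : W ⊗ ((p.P i).obj ⊗ Q') ⟶ Z, ∀ i', (W ◁ _ ◁ p'.q i') ≫ ψ = φ (i, i') :=
      fun i => hp'.exists_desc_right W (p.P i).obj (fun i' => φ (i, i')) fun j => by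
        have := h (Sum.inl i, Sum.inr j)
        change (W ◁ (𝟙 _ ⊗ₘ p'.r j)) ≫ φ (i, _) = (W ◁ (𝟙 _ ⊗ₘ p'.s j)) ≫ φ (i, _) at this
        rwa [id_tensorHom, id_tensorHom] at this
    choose ψ hψ using h₁
    obtain ⟨χ, hχ⟩ := hp.exists_desc_left W Q' ψ fun j => by
      refine hp'.ext_right _ _ _ _ fun i' => ?_
      have := h (Sum.inr j, Sum.inl i')
      change (W ◁ (p.r j ⊗ₘ 𝟙 _)) ≫ φ (_, i') = (W ◁ (p.s j ⊗ₘ 𝟙 _)) ≫ φ (_, i') at this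
      rw [tensorHom_id, tensorHom_id] at this
      rw [← whiskerLeft_comp_assoc, ← whiskerLeft_comp_assoc, whisker_exchange, whisker_exchange,
        whiskerLeft_comp_assoc, hψ, whiskerLeft_comp_assoc, hψ, this]
    refine ⟨χ, fun i => ?_⟩
    change (W ◁ (p.q i.1 ⊗ₘ p'.q i.2)) ≫ χ = _
    rw [tensorHom_def', whiskerLeft_comp_assoc, hχ]
    exact hψ i.1 i.2
  ext W Z ψ ψ' h := by
    refine hp.ext_left _ _ _ _ fun i => hp'.ext_right _ _ _ _ fun i' => ?_
    have := h (i, i')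
    change (W ◁ (p.q i ⊗ₘ p'.q i')) ≫ ψ = (W ◁ (p.q i ⊗ₘ p'.q i')) ≫ ψ' at this
    rwa [tensorHom_def', whiskerLeft_comp_assoc, whiskerLeft_comp_assoc] at this

/-- The first factor of a tensor product. -/
def _root_.OperadicAlgebra.tensorFinCons {n : ℕ} (f : Fin (n + 1) → C) :
    tensorFin f ≅ f 0 ⊗ tensorFin fun i => f i.succ :=
  eqToIso (congrArg (tensorList f) (List.finRange_succ)) ≪≫
    whiskerLeftIso (f 0) (tensorListRelabel f Fin.succ _)

theorem _root_.OperadicAlgebra.Elem.tensorFinCons_app {Λ : Type} {g : Λ → C} {n : ℕ}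
    {f : Fin (n + 1) → C} (x : ∀ i, Elem g (f i)) :
    (tensorFinCons f).hom ∙ tf x = x 0 ⊠ tf fun i => x i.succ := by
  simp only [tensorFinCons, Iso.trans_hom, eqToIso.hom, comp_app, tf]
  rw [eqToHom_tl x List.finRange_succ, tl]
  change (f 0 ◁ _) ∙ _ = _
  rw [whiskerLeft_app, tensorListRelabel_app]

theorem _root_.OperadicAlgebra.tensorFinCons_naturality {n : ℕ} {f f' : Fin (n + 1) → C}
    (φ : ∀ i, f i ⟶ f' i) :
    tensorFinMap φ ≫ (tensorFinCons f').hom =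
      (tensorFinCons f).hom ≫ (φ 0 ⊗ₘ tensorFinMap fun i => φ i.succ) := by
  refine Shape.hom_ext (.fin _ fun i => .leaf (f i)) fun g x => ?_
  change _ ∙ tf x = _ ∙ tf x
  simp only [comp_app, tensorFinMap_app, tensorFinCons_app, hom_app]

theorem _root_.OperadicAlgebra.tensorFinCons_inv_naturality {n : ℕ} {f f' : Fin (n + 1) → C}
    (φ : ∀ i, f i ⟶ f' i) :
    (tensorFinCons f).inv ≫ tensorFinMap φ =
      (φ 0 ⊗ₘ tensorFinMap fun i => φ i.succ) ≫ (tensorFinCons f').inv := by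
  rw [Iso.inv_comp_eq, ← Category.assoc, ← tensorFinCons_naturality, Category.assoc,
    Iso.hom_inv_id, Category.comp_id]

theorem _root_.OperadicAlgebra.tensorFinMap_comp {n : ℕ} {f f' f'' : Fin n → C}
    (φ : ∀ i, f i ⟶ f' i) (ψ : ∀ i, f' i ⟶ f'' i) :
    tensorFinMap φ ≫ tensorFinMap ψ = tensorFinMap fun i => φ i ≫ ψ i :=
  (tensorListMap_comp _ _ _).symm

theorem _root_.OperadicAlgebra.tensorFinMap_id {n : ℕ} (f : Fin n → C) :
    tensorFinMap (fun i => 𝟙 (f i)) = 𝟙 _ :=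
  tensorListMap_id _ _

/-- The tensor product of a family of presentations. -/
def fin {n : ℕ} {Q : Fin n → C} (p : ∀ i, Pres (Q i)) : Pres (tensorFin Q) where
  I := ∀ i, (p i).I
  J := ∀ i, (p i).K
  P α := .fin n fun i => (p i).P (α i)
  R k := .fin n fun i => (p i).V (k i)
  src k i := (p i).ks (k i)
  tgt k i := (p i).kt (k i)
  r k := tensorFinMap fun i => (p i).kr (k i)
  s k := tensorFinMap fun i => (p i).kl (k i)
  q α := tensorFinMap fun i => (p i).q (α i)

theorem fin_zero_exists_desc {Q : Fin 0 → C} (p : ∀ i, Pres (Q i)) (W : C) {Z : C}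
    (φ : ∀ α : (∀ i, (p i).I), W ⊗ tensorFin (fun i => ((p i).P (α i)).obj) ⟶ Z) :
    ∃ ψ : W ⊗ tensorFin Q ⟶ Z,
      ∀ α : (∀ i, (p i).I), (W ◁ tensorFinMap fun i => (p i).q (α i)) ≫ ψ = φ α := by
  refine ⟨(W ◁ tensorFinMap fun i => i.elim0) ≫ φ (fun i => i.elim0), fun α => ?_⟩
  obtain rfl : α = fun i => i.elim0 := funext fun i => i.elim0
  rw [← whiskerLeft_comp_assoc, tensorFinMap_comp]
  convert Category.id_comp _
  rw [← whiskerLeft_id, ← tensorFinMap_id]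
  congr 2
  funext i
  exact i.elim0

theorem fin_zero_ext {Q : Fin 0 → C} (p : ∀ i, Pres (Q i)) (W : C) {Z : C}
    (ψ ψ' : W ⊗ tensorFin Q ⟶ Z)
    (h : (W ◁ tensorFinMap fun i => (p i).q (i.elim0)) ≫ ψ =
      (W ◁ tensorFinMap fun i => (p i).q (i.elim0)) ≫ ψ') : ψ = ψ' := by
  have e := congrArg (fun f => (W ◁ tensorFinMap fun i : Fin 0 =>
    (i.elim0 : Q i ⟶ ((p i).P i.elim0).obj)) ≫ f) h
  simp only [← whiskerLeft_comp_assoc, tensorFinMap_comp] at e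
  have e' : (tensorFinMap fun i : Fin 0 => (i.elim0 : Q i ⟶ ((p i).P i.elim0).obj) ≫
      (p i).q i.elim0) = 𝟙 (tensorFin Q) := by
    rw [← tensorFinMap_id]
    congr 1
    funext i
    exact i.elim0
  rwa [e', whiskerLeft_id, Category.id_comp, Category.id_comp] at e

theorem fin_succ_exists_desc {n : ℕ} {Q : Fin (n + 1) → C} (p : ∀ i, Pres (Q i))
    (T : ((p 0).tens (fin fun i : Fin n => p i.succ)).IsValid) (W : C) {Z : C}
    (φ : ∀ α : (∀ i, (p i).I), W ⊗ tensorFin (fun i => ((p i).P (α i)).obj) ⟶ Z)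
    (h : ∀ k : (∀ i, (p i).K),
      (W ◁ tensorFinMap fun i => (p i).kr (k i)) ≫ φ (fun i => (p i).ks (k i)) =
        (W ◁ tensorFinMap fun i => (p i).kl (k i)) ≫ φ (fun i => (p i).kt (k i))) :
    ∃ ψ : W ⊗ tensorFin Q ⟶ Z,
      ∀ α : (∀ i, (p i).I), (W ◁ tensorFinMap fun i => (p i).q (α i)) ≫ ψ = φ α := by
  let φ' : ∀ i : (p 0).I × (∀ i : Fin n, (p i.succ).I),
      W ⊗ (((p 0).P i.1).obj ⊗ tensorFin fun t : Fin n => ((p t.succ).P (i.2 t)).obj) ⟶ Z :=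
    fun i => (W ◁ (tensorFinCons fun t => ((p t).P
      (Fin.cons (α := fun i => (p i).I) i.1 i.2 t)).obj).inv) ≫ φ (Fin.cons i.1 i.2)
  have key : ∀ k : (∀ i, (p i).K),
      (W ◁ ((p 0).kr (k 0) ⊗ₘ tensorFinMap fun i : Fin n => (p i.succ).kr (k i.succ))) ≫
        φ' ((p 0).ks (k 0), fun i => (p i.succ).ks (k i.succ)) =
      (W ◁ ((p 0).kl (k 0) ⊗ₘ tensorFinMap fun i : Fin n => (p i.succ).kl (k i.succ))) ≫
        φ' ((p 0).kt (k 0), fun i => (p i.succ).kt (k i.succ)) := by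
    intro k
    -- Every index is of the form `Fin.cons`, so `φ'` can be read at an arbitrary family, in
    -- particular at the sources and targets of `k`.
    have h₁ : ∀ α : (∀ i, (p i).I), φ' (α 0, fun i => α i.succ) =
        (W ◁ (tensorFinCons fun t => ((p t).P (α t)).obj).inv) ≫ φ α := by
      intro α
      obtain ⟨a, β, rfl⟩ : ∃ a β, α = Fin.cons a β := ⟨α 0, Fin.tail α, (Fin.cons_self_tail α).symm⟩
      rfl
    have h₂ := h₁ fun i => (p i).ks (k i)
    have h₃ := h₁ fun i => (p i).kt (k i)
    simp only at h₂ h₃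
    rw [h₂, h₃, ← whiskerLeft_comp_assoc, ← whiskerLeft_comp_assoc,
      ← tensorFinCons_inv_naturality fun i => (p i).kr (k i),
      ← tensorFinCons_inv_naturality fun i => (p i).kl (k i), whiskerLeft_comp_assoc, h,
      whiskerLeft_comp_assoc]
  obtain ⟨ψ, hψ⟩ := T.exists_desc W φ' fun k => by
    obtain ⟨k₀, α | k⟩ := k
    -- A trivial relation of the product presentation of the tail is not literally a family of
    -- trivial relations: the map is an identity instead of a tensor product of identities.
    · have := key (Fin.cons k₀ fun i => Sum.inl (α i))
      have e : (W ◁ ((p 0).kr k₀ ⊗ₘ tensorFinMap fun i : Fin n => 𝟙 ((p i.succ).P (α i)).obj)) ≫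
          φ' ((p 0).ks k₀, α) =
        (W ◁ ((p 0).kl k₀ ⊗ₘ tensorFinMap fun i : Fin n => 𝟙 ((p i.succ).P (α i)).obj)) ≫
          φ' ((p 0).kt k₀, α) := this
      rw [tensorFinMap_id] at e
      exact e
    · exact key (Fin.cons k₀ k)
  refine ⟨(W ◁ (tensorFinCons Q).hom) ≫ ψ, fun α => ?_⟩
  obtain ⟨a, β, rfl⟩ : ∃ a β, α = Fin.cons a β := ⟨α 0, Fin.tail α, (Fin.cons_self_tail α).symm⟩
  rw [← whiskerLeft_comp_assoc, tensorFinCons_naturality, whiskerLeft_comp_assoc]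
  have := hψ (a, β)
  change (W ◁ ((p 0).q a ⊗ₘ tensorFinMap fun i : Fin n => (p i.succ).q (β i))) ≫ ψ = _ at this
  refine (congrArg _ this).trans ?_
  have e : ∀ (f : Fin (n + 1) → C) (χ : W ⊗ tensorFin f ⟶ Z),
      (W ◁ (tensorFinCons f).hom) ≫ (W ◁ (tensorFinCons f).inv) ≫ χ = χ := fun f χ => by
    rw [← whiskerLeft_comp_assoc, Iso.hom_inv_id, whiskerLeft_id, Category.id_comp]
  exact e _ _

theorem fin_succ_ext {n : ℕ} {Q : Fin (n + 1) → C} (p : ∀ i, Pres (Q i))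
    (T : ((p 0).tens (fin fun i : Fin n => p i.succ)).IsValid) (W : C) {Z : C}
    (ψ ψ' : W ⊗ tensorFin Q ⟶ Z)
    (h : ∀ α : (∀ i, (p i).I), (W ◁ tensorFinMap fun i => (p i).q (α i)) ≫ ψ =
      (W ◁ tensorFinMap fun i => (p i).q (α i)) ≫ ψ') : ψ = ψ' := by
  rw [← cancel_epi (W ◁ (tensorFinCons Q).inv)]
  refine T.ext _ _ _ fun i => ?_
  have := congrArg (fun f => (W ◁ (tensorFinCons fun t => ((p t).P
      (Fin.cons (α := fun i => (p i).I) i.1 i.2 t)).obj).inv) ≫ f) (h (Fin.cons i.1 i.2))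
  simp only [← whiskerLeft_comp_assoc, tensorFinCons_inv_naturality] at this
  simp only [whiskerLeft_comp_assoc] at this
  exact this

theorem IsValid.fin {n : ℕ} {Q : Fin n → C} {p : ∀ i, Pres (Q i)} (hp : ∀ i, (p i).IsValid) :
    (fin p).IsValid := by
  induction n with
  | zero =>
    refine ⟨fun k => ?_, fun W Z φ h => ?_, fun W Z ψ ψ' h => ?_⟩
    · simp only [Pres.fin, tensorFinMap_comp, fun i => (hp i).kw]
    · exact fin_zero_exists_desc p W φ
    · exact fin_zero_ext p W ψ ψ' (h fun i => i.elim0)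
  | succ n ih =>
    have T := (hp 0).tens (ih fun i => hp i.succ)
    refine ⟨fun k => ?_, fun W Z φ h => ?_, fun W Z ψ ψ' h => ?_⟩
    · simp only [Pres.fin, tensorFinMap_comp, fun i => (hp i).kw]
    · exact fin_succ_exists_desc p T W φ h
    · exact fin_succ_ext p T W ψ ψ' h

/-- A map out of a presented object, given by a family of maps that respect the relations. -/
theorem IsValid.exists_hom {p : Pres Q} (hp : p.IsValid) {Z : C} (φ : ∀ i, (p.P i).obj ⟶ Z)
    (h : ∀ j {Λ : Type} (g : Λ → C) (x : (p.R j).El g),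
      φ (p.src j) ∙ p.r j ∙ (p.R j).ev x = φ (p.tgt j) ∙ p.s j ∙ (p.R j).ev x) :
    ∃ ψ : Q ⟶ Z, ∀ i, p.q i ≫ ψ = φ i := by
  obtain ⟨ψ, hψ⟩ := hp.exists_desc (𝟙_ C) (fun i => (λ_ _).hom ≫ φ i) fun j => by
    rw [leftUnitor_naturality_assoc, leftUnitor_naturality_assoc]
    congr 1
    exact Shape.hom_ext _ fun g x => by rw [comp_app, comp_app, h]
  exact ⟨(λ_ Q).inv ≫ ψ, fun i => by
    rw [leftUnitor_inv_naturality_assoc, hψ, Iso.inv_hom_id_assoc]⟩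

theorem IsValid.hom_ext {p : Pres Q} (hp : p.IsValid) {Z : C} {F G : Q ⟶ Z}
    (h : ∀ i {Λ : Type} (g : Λ → C) (x : (p.P i).El g),
      F ∙ p.q i ∙ (p.P i).ev x = G ∙ p.q i ∙ (p.P i).ev x) : F = G := by
  rw [← cancel_epi (λ_ Q).hom]
  refine hp.ext _ _ _ fun i => ?_
  rw [leftUnitor_naturality_assoc, leftUnitor_naturality_assoc]
  congr 1
  exact Shape.hom_ext _ fun g x => by rw [comp_app, comp_app, h]

end Pres

end Presentations

/-! ### Presentations of coequalizers and of `∐ₘ P(m) ⊗_{Σₘ} X^(m)`. -/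

section CountableColimits

variable {C : Type u} [Category.{v} C] [MonoidalCategory C] [SymmetricCategory C]

open Elem

section

variable [TensorPreservesCountableColimits C]

instance {J : Type} [SmallCategory J] [CountableCategory J] (X : C) :
    PreservesColimitsOfShape J (tensorLeft X) := TensorPreservesCountableColimits.left J X

/-- Parallel pairs form a countable shape, so tensoring with `W` keeps the coequalizer. -/
theorem whiskerLeft_cofork_exists_desc {X Y : C} {f g : X ⟶ Y} {k : Cofork f g} (hk : IsColimit k)
    (W : C) {Z : C} (φ : W ⊗ Y ⟶ Z) (h : (W ◁ f) ≫ φ = (W ◁ g) ≫ φ) :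
    ∃ ψ : W ⊗ k.pt ⟶ Z, (W ◁ k.π) ≫ ψ = φ := by
  have hk' : IsColimit (Cofork.ofπ k.π k.condition) :=
    hk.ofIsoColimit (Cofork.ext (Iso.refl _) (by simp))
  have l := isColimitCoforkMapOfIsColimit (tensorLeft W) k.condition hk'
  exact ⟨Cofork.IsColimit.desc l φ h, Cofork.IsColimit.π_desc' l φ h⟩

theorem whiskerLeft_cofork_ext {X Y : C} {f g : X ⟶ Y} {k : Cofork f g} (hk : IsColimit k)
    (W : C) {Z : C} (ψ ψ' : W ⊗ k.pt ⟶ Z) (h : (W ◁ k.π) ≫ ψ = (W ◁ k.π) ≫ ψ') : ψ = ψ' := by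
  have hk' : IsColimit (Cofork.ofπ k.π k.condition) :=
    hk.ofIsoColimit (Cofork.ext (Iso.refl _) (by simp))
  have l := isColimitCoforkMapOfIsColimit (tensorLeft W) k.condition hk'
  exact Cofork.IsColimit.hom_ext l h

theorem whiskerLeft_sigma_exists_desc {β : Type} [Countable β] (f : β → C) [HasCoproduct f]
    (W : C) {Z : C} (φ : ∀ b, W ⊗ f b ⟶ Z) :
    ∃ ψ : W ⊗ ∐ f ⟶ Z, ∀ b, (W ◁ Sigma.ι f b) ≫ ψ = φ b := by
  have l := isColimitCofanMkObjOfIsColimit (tensorLeft W) f _ (coproductIsCoproduct f)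
  exact ⟨Cofan.IsColimit.desc l φ, fun b => Cofan.IsColimit.fac l φ b⟩

theorem whiskerLeft_sigma_ext {β : Type} [Countable β] (f : β → C) [HasCoproduct f]
    (W : C) {Z : C} (ψ ψ' : W ⊗ ∐ f ⟶ Z)
    (h : ∀ b, (W ◁ Sigma.ι f b) ≫ ψ = (W ◁ Sigma.ι f b) ≫ ψ') : ψ = ψ' := by
  have l := isColimitCofanMkObjOfIsColimit (tensorLeft W) f _ (coproductIsCoproduct f)
  exact Cofan.IsColimit.hom_ext l _ _ h

end

namespace Pres

/-- The presentation of a coequalizer. -/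
def cofork {X Y : C} {f g : X ⟶ Y} (k : Cofork f g) : Pres k.pt where
  I := Unit
  J := Unit
  P _ := .leaf Y
  R _ := .leaf X
  src _ := ()
  tgt _ := ()
  r _ := f
  s _ := g
  q _ := k.π

theorem isValid_cofork [TensorPreservesCountableColimits C] {X Y : C} {f g : X ⟶ Y}
    {k : Cofork f g} (hk : IsColimit k) : (cofork k).IsValid where
  w _ := k.condition
  exists_desc W Z φ h := by
    obtain ⟨ψ, hψ⟩ := whiskerLeft_cofork_exists_desc hk W (φ ()) (h ())
    exact ⟨ψ, fun _ => hψ⟩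
  ext W Z ψ ψ' h := whiskerLeft_cofork_ext hk W ψ ψ' (h ())

/-- The presentation of a coequalizer of two maps between presented objects. -/
def coequalizer {X Y : C} {f g : X ⟶ Y} (k : Cofork f g) (p : Pres Y) (J : Type)
    (R : J → Shape C) (src tgt : J → p.I) (r : ∀ j, (R j).obj ⟶ (p.P (src j)).obj)
    (s : ∀ j, (R j).obj ⟶ (p.P (tgt j)).obj) : Pres k.pt where
  I := p.I
  J := p.J ⊕ J
  P := p.P
  R := Sum.elim p.R R
  src := Sum.elim p.src src
  tgt := Sum.elim p.tgt tgt
  r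
    | Sum.inl j => p.r j
    | Sum.inr j => r j
  s
    | Sum.inl j => p.s j
    | Sum.inr j => s j
  q i := p.q i ≫ k.π

/-- The maps `e j` cover `X`, also after tensoring with `W`, so equality of two maps out of `X` may
be tested on them. The relations `r j`, `s j` lift `e j ≫ f` and `e j ≫ g` to the generators of `Y`.
-/
theorem isValid_coequalizer [TensorPreservesCountableColimits C] {X Y : C} {f g : X ⟶ Y}
    {k : Cofork f g} (hk : IsColimit k) {p : Pres Y} (hp : p.IsValid) {J : Type} {R : J → Shape C}
    {src tgt : J → p.I} {r : ∀ j, (R j).obj ⟶ (p.P (src j)).obj}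
    {s : ∀ j, (R j).obj ⟶ (p.P (tgt j)).obj} (e : ∀ j, (R j).obj ⟶ X)
    (he : ∀ (W : C) {Z : C} (ψ ψ' : W ⊗ X ⟶ Z),
      (∀ j, (W ◁ e j) ≫ ψ = (W ◁ e j) ≫ ψ') → ψ = ψ')
    (hr : ∀ j, r j ≫ p.q (src j) = e j ≫ f) (hs : ∀ j, s j ≫ p.q (tgt j) = e j ≫ g) :
    (coequalizer k p J R src tgt r s).IsValid where
  w j := by
    cases j with
    | inl j =>
      change p.r j ≫ p.q _ ≫ k.π = p.s j ≫ p.q _ ≫ k.π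
      rw [← Category.assoc, hp.w, Category.assoc]
    | inr j =>
      change r j ≫ p.q _ ≫ k.π = s j ≫ p.q _ ≫ k.π
      rw [← Category.assoc, hr, ← Category.assoc, hs, Category.assoc, k.condition, Category.assoc]
  exists_desc W Z φ h := by
    obtain ⟨ψ, hψ⟩ := hp.exists_desc W φ fun j => h (Sum.inl j)
    obtain ⟨χ, hχ⟩ := whiskerLeft_cofork_exists_desc hk W ψ (he W _ _ fun j => by
      have := h (Sum.inr j)
      change (W ◁ r j) ≫ φ (src j) = (W ◁ s j) ≫ φ (tgt j) at this
      rw [← hψ, ← hψ, ← whiskerLeft_comp_assoc, ← whiskerLeft_comp_assoc, hr, hs] at this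
      rwa [whiskerLeft_comp_assoc, whiskerLeft_comp_assoc] at this)
    refine ⟨χ, fun i => ?_⟩
    change (W ◁ (p.q i ≫ k.π)) ≫ χ = φ i
    rw [whiskerLeft_comp_assoc, hχ]
    exact hψ i
  ext W Z ψ ψ' h := by
    refine whiskerLeft_cofork_ext hk W _ _ (hp.ext W _ _ fun i => ?_)
    have := h i
    change (W ◁ (p.q i ≫ k.π)) ≫ ψ = (W ◁ (p.q i ≫ k.π)) ≫ ψ' at this
    rwa [whiskerLeft_comp_assoc, whiskerLeft_comp_assoc] at this

variable [HasCountableColimits C]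

/-- The presentation of `∐ₘ P(m) ⊗_{Σₘ} X^(m)`. -/
def schur (P : SymmetricSequence C) (X : C) : Pres (P.schur.obj X) where
  I := ℕ
  J := Σ m : ℕ, Equiv.Perm (Fin m)
  P m := .tens (.leaf (P.obj m)) (.fin m fun _ => .leaf X)
  R j := .tens (.leaf (P.obj j.1)) (.fin j.1 fun _ => .leaf X)
  src j := j.1
  tgt j := j.1
  r j := P.diagonalAct j.1 X j.2
  s _ := 𝟙 _
  q m := P.ι m X

theorem _root_.OperadicAlgebra.SymmetricSequence.whiskerLeft_exists_desc
    [TensorPreservesCountableColimits C] (P : SymmetricSequence C) (X W : C) {Z : C}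
    (φ : ∀ m : ℕ, W ⊗ (P.obj m ⊗ tensorPow X m) ⟶ Z)
    (h : ∀ m σ, (W ◁ P.diagonalAct m X σ) ≫ φ m = φ m) :
    ∃ ψ : W ⊗ P.schurObj X ⟶ Z, ∀ m, (W ◁ P.incl m X) ≫ ψ = φ m := by
  have h₁ : ∀ m, ∃ ψ : W ⊗ P.coinvariants m X ⟶ Z,
      (W ◁ coequalizer.π _ _) ≫ ψ = φ m := fun m =>
    whiskerLeft_cofork_exists_desc (coequalizerIsCoequalizer _ _) W (φ m) <|
      whiskerLeft_sigma_ext _ _ _ _ fun σ => by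
        rw [← whiskerLeft_comp_assoc, ← whiskerLeft_comp_assoc, Sigma.ι_desc, Sigma.ι_desc, h,
          whiskerLeft_id, Category.id_comp]
  choose ψ hψ using h₁
  obtain ⟨χ, hχ⟩ := whiskerLeft_sigma_exists_desc (fun m => P.coinvariants m X) W ψ
  refine ⟨χ, fun m => ?_⟩
  rw [SymmetricSequence.incl, whiskerLeft_comp_assoc, hχ, hψ]

theorem _root_.OperadicAlgebra.SymmetricSequence.whiskerLeft_ext
    [TensorPreservesCountableColimits C] (P : SymmetricSequence C) (X W : C) {Z : C}
    (ψ ψ' : W ⊗ P.schurObj X ⟶ Z) (h : ∀ m, (W ◁ P.incl m X) ≫ ψ = (W ◁ P.incl m X) ≫ ψ') :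
    ψ = ψ' := by
  refine whiskerLeft_sigma_ext _ _ _ _ fun m =>
    whiskerLeft_cofork_ext (coequalizerIsCoequalizer _ _) W _ _ ?_
  have := h m
  rw [SymmetricSequence.incl, whiskerLeft_comp_assoc, whiskerLeft_comp_assoc] at this
  exact this

theorem isValid_schur [TensorPreservesCountableColimits C] (P : SymmetricSequence C) (X : C) :
    (schur P X).IsValid where
  w j := (P.diagonalAct_incl j.1 X j.2).trans (Category.id_comp _).symm
  exists_desc W _ φ h := P.whiskerLeft_exists_desc X W φ fun m σ =>
    (h ⟨m, σ⟩).trans (by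
      change (W ◁ 𝟙 _) ≫ φ m = φ m
      rw [whiskerLeft_id, Category.id_comp])
  ext W _ ψ ψ' h := P.whiskerLeft_ext X W ψ ψ' h

end Pres

end CountableColimits

/-! ### The monad on types of an operad -/

section Terms

variable {C : Type u} [Category.{v} C] [MonoidalCategory C] [SymmetricCategory C]

open Elem

namespace SymmetricSequence

variable (P : SymmetricSequence C)

theorem actEquiv_perm {m : ℕ} (σ : Equiv.Perm (Fin m)) : P.actEquiv σ = P.act σ := by
  simp only [actEquiv, eqToHom_refl, Category.id_comp]
  rfl

theorem actEquiv_refl (m : ℕ) : P.actEquiv (Equiv.refl (Fin m)) = 𝟙 _ := by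
  rw [actEquiv_perm]; exact P.act_one m

theorem actEquiv_trans {n m k : ℕ} (e : Fin n ≃ Fin m) (e' : Fin m ≃ Fin k) :
    P.actEquiv (e.trans e') = P.actEquiv e' ≫ P.actEquiv e := by
  obtain rfl := Fin.equiv_iff_eq.1 ⟨e⟩
  obtain rfl := Fin.equiv_iff_eq.1 ⟨e'⟩
  simp only [actEquiv_perm]
  exact P.act_mul e' e

theorem actEquiv_symm_app {Λ : Type} {g : Λ → C} {n m : ℕ} (e : Fin n ≃ Fin m)
    (x : Elem g (P.obj m)) : P.actEquiv e.symm ∙ P.actEquiv e ∙ x = x := by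
  rw [← comp_app, ← actEquiv_trans, Equiv.symm_trans_self, actEquiv_refl, id_app]

end SymmetricSequence

variable (O : Operad C) {Λ : Type} (g : Λ → C)

/-- Formal operations with inputs in `V`. -/
structure PreTerm (V : Type*) where
  arity : ℕ
  op : Elem g (O.obj arity)
  args : Fin arity → V

variable {O g}

/-- Formal operations that differ by a permutation of the inputs. -/
def PreTerm.Rel {V : Type*} (s t : PreTerm O g V) : Prop :=
  ∃ e : Fin s.arity ≃ Fin t.arity, s.op = O.actEquiv e ∙ t.op ∧ s.args = t.args ∘ e

variable (O g) in
/-- Formal operations with inputs in `V`, up to the simultaneous permutation of inputs. -/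
instance PreTerm.setoid (V : Type*) : Setoid (PreTerm O g V) where
  r := PreTerm.Rel
  iseqv := by
    refine ⟨fun s => ⟨Equiv.refl _, ?_, rfl⟩, ?_, ?_⟩
    · rw [O.actEquiv_refl, id_app]
    · rintro ⟨n, x, v⟩ ⟨m, y, w⟩ ⟨(e : Fin n ≃ Fin m), (hx : x = O.actEquiv e ∙ y),
        (hv : v = w ∘ e)⟩
      subst hx hv
      refine ⟨e.symm, (O.actEquiv_symm_app e y).symm, ?_⟩
      funext i
      simp
    · rintro ⟨n, x, v⟩ ⟨m, y, w⟩ ⟨k, z, t⟩ ⟨(e : Fin n ≃ Fin m), (hx : x = O.actEquiv e ∙ y),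
        (hv : v = w ∘ e)⟩ ⟨(e' : Fin m ≃ Fin k), (hy : y = O.actEquiv e' ∙ z), (hw : w = t ∘ e')⟩
      subst hx hv hy hw
      exact ⟨e.trans e', by rw [O.actEquiv_trans, comp_app], rfl⟩

variable (O g) in
/-- Formal operations with inputs in `V`, up to the simultaneous permutation of inputs. -/
def Term (V : Type*) := Quotient (PreTerm.setoid O g V)

namespace Term

variable {V V' V'' : Type*}

/-- The class of a formal operation. -/
def mk {n : ℕ} (x : Elem g (O.obj n)) (v : Fin n → V) : Term O g V :=
  Quotient.mk _ ⟨n, x, v⟩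

theorem exists_rep (t : Term O g V) : ∃ (n : ℕ) (x : Elem g (O.obj n)) (v : Fin n → V),
    t = mk x v := by
  obtain ⟨⟨n, x, v⟩, rfl⟩ := Quotient.exists_rep t
  exact ⟨n, x, v, rfl⟩

theorem mk_eq_mk {n m : ℕ} {x : Elem g (O.obj n)} {v : Fin n → V} {y : Elem g (O.obj m)}
    {w : Fin m → V} :
    mk x v = mk y w ↔ ∃ e : Fin n ≃ Fin m, x = O.actEquiv e ∙ y ∧ v = w ∘ e :=
  ⟨fun h => Quotient.exact h, fun h => Quotient.sound h⟩

theorem mk_actEquiv {n m : ℕ} (e : Fin n ≃ Fin m) (x : Elem g (O.obj m)) (v : Fin n → V) :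
    mk (O.actEquiv e ∙ x) v = mk x (v ∘ e.symm) :=
  mk_eq_mk.2 ⟨e, rfl, by funext i; simp⟩

theorem mk_act {n : ℕ} (σ : Equiv.Perm (Fin n)) (x : Elem g (O.obj n)) (v : Fin n → V) :
    mk (O.act σ ∙ x) v = mk x (v ∘ σ.symm) := by
  rw [← O.actEquiv_perm, mk_actEquiv]

theorem mk_eqToHom {n m : ℕ} (h : n = m) (h' : O.obj n = O.obj m) (x : Elem g (O.obj n))
    (v : Fin m → V) :
    mk (eqToHom h' ∙ x) v = mk x (v ∘ Fin.cast h) := by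
  subst h
  rw [eqToHom_refl, id_app]
  rfl

/-- The composite of formal operations. -/
def comp {n : ℕ} (x : Elem g (O.obj n)) {j : Fin n → ℕ} (y : ∀ i, Elem g (O.obj (j i)))
    (w : ∀ i, Fin (j i) → V) : Term O g V :=
  mk (O.comp j ∙ (x ⊠ tf y)) (flat w)

/-- Equivariance of composition in the inner operations: permutations of their inputs become a block
sum acting on the inputs of the composite, which the relabelling of the inputs undoes. -/
theorem actEquiv_sigma {n : ℕ} {j j' : Fin n → ℕ} (e : ∀ i, Fin (j i) ≃ Fin (j' i))
    (x : Elem g (O.obj n)) (y : ∀ i, Elem g (O.obj (j' i))) (w : ∀ i, Fin (j' i) → V) :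
    comp x (fun i => O.actEquiv (e i) ∙ y i) (fun i => w i ∘ e i) = comp x y w := by
  obtain rfl : j = j' := funext fun i => Fin.equiv_iff_eq.1 ⟨e i⟩
  have := O.comp_blockSum j e
  have h := congrArg (fun f => f ∙ (x ⊠ tf y)) this
  simp only [comp_app, whiskerLeft_app, tensorFinMap_app] at h
  simp only [comp, SymmetricSequence.actEquiv_perm]
  rw [h, mk_act]
  congr 1
  funext t
  obtain ⟨⟨i, l⟩, rfl⟩ := finSigmaFinEquiv.surjective t
  have : (blockSum e).symm (finSigmaFinEquiv ⟨i, l⟩) = finSigmaFinEquiv ⟨i, (e i).symm l⟩ := by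
    rw [Equiv.symm_apply_eq]
    simp [blockSum]
  simp only [Function.comp, this, flat_apply, Equiv.apply_symm_apply]

/-- Equivariance of composition in the outer operation: permuting its inputs permutes whole blocks
of inputs of the composite. -/
theorem actEquiv_blocks {n m : ℕ} (e : Fin n ≃ Fin m) {j : Fin m → ℕ} (x : Elem g (O.obj m))
    (y : ∀ i, Elem g (O.obj (j i))) (w : ∀ i, Fin (j i) → V) :
    comp (O.actEquiv e ∙ x) (fun i => y (e i)) (fun i => w (e i)) = comp x y w := by
  obtain rfl := Fin.equiv_iff_eq.1 ⟨e⟩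
  have := O.comp_blockPerm e j
  have h := congrArg (fun f => f ∙ (x ⊠ tf fun i => y (e i))) this
  simp only [comp_app, whiskerLeft_app, whiskerRight_app, tensorFinPerm_app] at h
  simp only [comp, SymmetricSequence.actEquiv_perm]
  rw [h, mk_actEquiv]
  congr 1
  funext t
  obtain ⟨⟨i, l⟩, rfl⟩ := finSigmaFinEquiv.surjective t
  obtain ⟨i, rfl⟩ := e.surjective i
  have : (blockPerm e j).symm (finSigmaFinEquiv ⟨e i, l⟩) = finSigmaFinEquiv ⟨i, l⟩ := by
    rw [Equiv.symm_apply_eq]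
    simp [blockPerm]
  simp only [Function.comp, this, flat_apply]

/-- Substitution does not depend on representatives. The permutations of the inner operations are
removed by `actEquiv_sigma`, that of the outer one by `actEquiv_blocks`. -/
theorem comp_congr {n m : ℕ} {x : Elem g (O.obj n)} {x' : Elem g (O.obj m)}
    {j : Fin n → ℕ} {j' : Fin m → ℕ} {y : ∀ i, Elem g (O.obj (j i))}
    {y' : ∀ i, Elem g (O.obj (j' i))} {w : ∀ i, Fin (j i) → V} {w' : ∀ i, Fin (j' i) → V}
    (e : Fin n ≃ Fin m) (hx : x = O.actEquiv e ∙ x')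
    (h : ∀ i, mk (y i) (w i) = mk (y' (e i)) (w' (e i))) : comp x y w = comp x' y' w' := by
  simp only [mk_eq_mk] at h
  choose f hy hw using h
  obtain rfl : y = _ := funext hy
  obtain rfl : w = _ := funext hw
  rw [actEquiv_sigma f x (fun i => y' (e i)) fun i => w' (e i), hx, actEquiv_blocks]

/-- Substitution of formal operations into a formal operation. -/
def bind (t : Term O g V) (f : V → Term O g V') : Term O g V' :=
  -- Representatives of the substituted terms are chosen arbitrarily; `comp_congr` makes the choice
  -- irrelevant.
  Quotient.lift (fun s : PreTerm O g V => comp s.op (fun i => (f (s.args i)).out.op)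
    fun i => (f (s.args i)).out.args) (by
      rintro ⟨n, x, v⟩ ⟨m, y, w⟩ ⟨e, hx, hv⟩
      refine comp_congr e hx fun i => ?_
      rw [hv]
      rfl) t

/-- Allows convenient representatives in place of the chosen ones; afterwards the definition of
`bind` is not unfolded again. -/
theorem bind_mk {n : ℕ} (x : Elem g (O.obj n)) (v : Fin n → V) (f : V → Term O g V')
    {j : Fin n → ℕ} (y : ∀ i, Elem g (O.obj (j i))) (w : ∀ i, Fin (j i) → V')
    (h : ∀ i, f (v i) = mk (y i) (w i)) : (mk x v).bind f = comp x y w := by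
  refine comp_congr (Equiv.refl _) (by rw [O.actEquiv_refl, id_app]) fun i => ?_
  refine Eq.trans ?_ (h i)
  exact (f (v i)).out_eq

/-- The formal operation given by the unit of the operad. -/
def pure (a : V) : Term O g V := mk (n := 1) (O.one ∙ one) fun _ => a

/-- The left unit law of the operad, together with the fact that numbering a single block changes
nothing. -/
theorem pure_bind (a : V) (f : V → Term O g V') : (pure a : Term O g V).bind f = f a := by
  obtain ⟨n, x, v, h⟩ := (f a).exists_rep
  rw [h, pure, bind_mk _ _ _ (j := fun _ => n) (fun _ => x) (fun _ => v) fun _ => h, comp]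
  have := congrArg (fun f => f ∙ ((one : Elem g _) ⊠ x)) (O.one_comp n)
  simp only [comp_app, hom_app, leftUnitor_app, tensorPowOne_inv_app] at this
  conv_rhs => rw [← this, mk_eqToHom (by simp)]
  congr 1
  funext t
  obtain ⟨⟨i, l⟩, rfl⟩ := finSigmaFinEquiv.surjective t
  rw [flat_apply]
  obtain rfl := Subsingleton.elim i 0
  refine congrArg v (Fin.ext ?_)
  simp [finSigmaFinEquiv_apply]

/-- Relabelling of the inputs of a formal operation. -/
def map (f : V → V') (t : Term O g V) : Term O g V' := t.bind fun a => pure (f a)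

/-- The right unit law of the operad: substituting units into all inputs only relabels them. With
the identity relabelling it is a monad law. -/
theorem map_mk (f : V → V') {n : ℕ} (x : Elem g (O.obj n)) (v : Fin n → V) :
    map f (mk x v) = mk x (f ∘ v) := by
  rw [map]
  rw [bind_mk x v (fun a => pure (f a)) (j := fun _ => 1) (fun _ => O.one ∙ one) (fun i _ => f (v i)) fun _ => rfl, comp]
  have := congrArg (fun f => f ∙ (x ⊠ (one : Elem g _))) (O.comp_one n)
  simp only [comp_app, whiskerLeft_app, rightUnitor_app, tensorListUnits_app] at this
  conv_rhs => rw [← this, mk_eqToHom (by simp)]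
  congr 1
  funext t
  obtain ⟨⟨i, l⟩, rfl⟩ := finSigmaFinEquiv.surjective t
  rw [flat_apply]
  refine congrArg (fun i => f (v i)) (Fin.ext ?_)
  obtain rfl := Subsingleton.elim l 0
  simp [finSigmaFinEquiv_apply]

/-- The offset of block `i` is written as a sum over all of `Fin m` with a condition, so that sums
can be reindexed and split. -/
theorem _root_.OperadicAlgebra.finSigmaFinEquiv_val {m : ℕ} (j : Fin m → ℕ) (i : Fin m)
    (l : Fin (j i)) :
    (finSigmaFinEquiv ⟨i, l⟩ : ℕ) = (∑ i', if i' < i then j i' else 0) + l := by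
  rw [finSigmaFinEquiv_apply]
  congr 1
  rw [← Finset.sum_filter]
  refine Finset.sum_nbij (fun i' => Fin.castLE i.2.le i') ?_ ?_ ?_ ?_
  · intro a _
    exact Finset.mem_filter.2 ⟨Finset.mem_univ _, Fin.lt_def.2 a.2⟩
  · intro a _ b _ h
    simpa using h
  · intro b hb
    simp only [Finset.coe_filter, Finset.mem_univ, true_and, Set.mem_ofPred_eq] at hb
    exact ⟨⟨b, hb⟩, by simp, rfl⟩
  · intro a _
    rfl

theorem _root_.OperadicAlgebra.finSigmaFinEquiv_lt {m : ℕ} (j : Fin m → ℕ) (i i' : Fin m)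
    (l : Fin (j i)) (l' : Fin (j i')) (h : i' < i) :
    finSigmaFinEquiv ⟨i', l'⟩ < finSigmaFinEquiv ⟨i, l⟩ := by
  rw [Fin.lt_def, finSigmaFinEquiv_val, finSigmaFinEquiv_val]
  -- The block of `i'` ends before the block of `i` begins.
  have h₁ : (∑ a, if a < i' then j a else 0) + j i' ≤ ∑ a, if a < i then j a else 0 := by
    rw [← Finset.sum_filter, ← Finset.sum_filter, add_comm, ← Finset.sum_insert (by simp)]
    refine Finset.sum_le_sum_of_subset fun a ha => ?_
    simp only [Finset.mem_insert, Finset.mem_filter, Finset.mem_univ, true_and] at ha ⊢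
    rcases ha with rfl | ha
    exacts [h, ha.trans h]
  have := l'.2
  omega

theorem _root_.OperadicAlgebra.finSigmaFinEquiv_lt_iff {m : ℕ} (j : Fin m → ℕ) (i i' : Fin m)
    (l : Fin (j i)) (l' : Fin (j i')) :
    finSigmaFinEquiv ⟨i', l'⟩ < finSigmaFinEquiv ⟨i, l⟩ ↔
      i' < i ∨ (i' = i ∧ (l' : ℕ) < l) := by
  rcases lt_trichotomy i' i with h | rfl | h
  · simp [h, finSigmaFinEquiv_lt j i i' l l' h]
  · rw [Fin.lt_def, finSigmaFinEquiv_val, finSigmaFinEquiv_val]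
    simp
  · simp [h.not_gt, h.ne', (finSigmaFinEquiv_lt j i' i l' l h).le]

/-- Both nested numberings count the predecessors of `(i, l, p)` in the lexicographic order. The
values are compared because the two index types are equal only through `sum_blocks`. -/
theorem _root_.OperadicAlgebra.finSigmaFinEquiv_assoc {m : ℕ} (j : Fin m → ℕ)
    (k : Fin (∑ i, j i) → ℕ) (i : Fin m) (l : Fin (j i)) (p : Fin (k (finSigmaFinEquiv ⟨i, l⟩))) :
    (finSigmaFinEquiv (n := fun i => ∑ l : Fin (j i), k (finSigmaFinEquiv ⟨i, l⟩))
      ⟨i, finSigmaFinEquiv (n := fun l : Fin (j i) => k (finSigmaFinEquiv ⟨i, l⟩)) ⟨l, p⟩⟩ : ℕ) =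
      finSigmaFinEquiv (n := k) ⟨finSigmaFinEquiv ⟨i, l⟩, p⟩ := by
  rw [finSigmaFinEquiv_val, finSigmaFinEquiv_val, finSigmaFinEquiv_val k, ← add_assoc]
  congr 1
  rw [← Equiv.sum_comp finSigmaFinEquiv, Fintype.sum_sigma]
  simp only [finSigmaFinEquiv_lt_iff]
  -- Predecessors of `(i, l)` lie in an earlier block, or in block `i` at an earlier place.
  have : ∀ i' : Fin m, (∑ l' : Fin (j i'), if i' < i ∨ (i' = i ∧ (l' : ℕ) < l) then
      k (finSigmaFinEquiv ⟨i', l'⟩) else 0) =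
      (if i' < i then ∑ l' : Fin (j i'), k (finSigmaFinEquiv ⟨i', l'⟩) else 0) +
        if i' = i then ∑ l' : Fin (j i'), (if (l' : ℕ) < l then k (finSigmaFinEquiv ⟨i', l'⟩) else 0)
          else 0 := by
    intro i'
    rcases lt_trichotomy i' i with h | rfl | h
    · simp [h, h.ne]
    · simp
    · simp [h.not_gt, h.ne']
  simp only [this, Finset.sum_add_distrib, Finset.sum_ite_eq', Finset.mem_univ, if_true]
  rfl

/-- Associativity of the operad. On elements the shuffle in that axiom is invisible, and only the
two numberings of the inputs remain to be compared. -/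
theorem bind_assoc (t : Term O g V) (f : V → Term O g V') (h : V' → Term O g V'') :
    (t.bind f).bind h = t.bind fun a => (f a).bind h := by
  obtain ⟨n, x, v, rfl⟩ := t.exists_rep
  have h₁ := fun i => (f (v i)).exists_rep
  choose j y w hf using h₁
  have h₂ := fun t => (h (flat w t)).exists_rep
  choose k z u hh using h₂
  have h₃ : ∀ i, (f (v i)).bind h = mk (O.comp (fun l => k (finSigmaFinEquiv ⟨i, l⟩)) ∙
      (y i ⊠ tf fun l => z (finSigmaFinEquiv ⟨i, l⟩)))
        (flat fun l => u (finSigmaFinEquiv ⟨i, l⟩)) := by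
    intro i
    rw [hf]
    exact bind_mk _ _ _ _ _ fun l => by rw [← hh, flat_apply]
  rw [bind_mk x v f y w hf, comp, bind_mk _ _ h z u hh, bind_mk x v _ _ _ h₃, comp, comp]
  have := congrArg (fun f => f ∙ ((x ⊠ tf y) ⊠ tf z)) (O.comp_assoc j k)
  simp only [comp_app, whiskerRight_app, associator_app, whiskerLeft_app, tensorFinShuffle_app,
    tensorFinMap_app] at this
  rw [this, mk_eqToHom (sum_blocks j k)]
  congr 1
  funext t
  obtain ⟨⟨i, q⟩, rfl⟩ := finSigmaFinEquiv.surjective t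
  obtain ⟨⟨l, p⟩, rfl⟩ := finSigmaFinEquiv.surjective q
  rw [flat_apply, flat_apply, Function.comp]
  have : Fin.cast (sum_blocks j k) (finSigmaFinEquiv
      (n := fun i => ∑ l : Fin (j i), k (finSigmaFinEquiv ⟨i, l⟩))
      ⟨i, finSigmaFinEquiv (n := fun l : Fin (j i) => k (finSigmaFinEquiv ⟨i, l⟩)) ⟨l, p⟩⟩) =
      finSigmaFinEquiv (n := k) ⟨finSigmaFinEquiv ⟨i, l⟩, p⟩ :=
    Fin.ext (finSigmaFinEquiv_assoc j k i l p)
  rw [this, flat_apply]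

theorem bind_pure (t : Term O g V) : t.bind pure = t := by
  obtain ⟨n, x, v, rfl⟩ := t.exists_rep
  exact map_mk id x v

theorem map_bind (t : Term O g V) (f : V → V') (h : V' → Term O g V'') :
    (t.map f).bind h = t.bind fun a => h (f a) := by
  rw [map, bind_assoc]
  simp only [pure_bind]

theorem bind_map (t : Term O g V) (f : V → Term O g V') (h : V' → V'') :
    (t.bind f).map h = t.bind fun a => (f a).map h :=
  bind_assoc _ _ _

theorem map_map (t : Term O g V) (f : V → V') (h : V' → V'') :
    (t.map f).map h = t.map fun a => h (f a) :=
  map_bind _ _ _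

theorem map_pure (f : V → V') (a : V) : (pure a : Term O g V).map f = pure (f a) :=
  pure_bind _ _

end Term

end Terms

/-! ### Algebras in terms of elements -/

section AlgebrasByElements

variable {C : Type u} [Category.{v} C] [MonoidalCategory C] [SymmetricCategory C]

open Elem

theorem SymmetricSequence.diagonalAct_app (P : SymmetricSequence C) {X : C} {Λ : Type} {g : Λ → C}
    {m : ℕ} (σ : Equiv.Perm (Fin m)) (x : Elem g (P.obj m)) (v : Fin m → Elem g X) :
    P.diagonalAct m X σ ∙ (x ⊠ tf v) = (P.act σ⁻¹ ∙ x) ⊠ tf (v ∘ σ.symm) := by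
  rw [SymmetricSequence.diagonalAct, hom_app, tensorPowPerm_app]
  rfl

/-- Invariance under the diagonal action, in the form in which it lets maps out of `P(m) ⊗ X^(m)`
descend to terms. -/
theorem SymmetricSequence.app_actEquiv (P : SymmetricSequence C) {X Y : C}
    {φ : ∀ m, P.obj m ⊗ tensorPow X m ⟶ Y}
    (h : ∀ (m : ℕ) (σ : Equiv.Perm (Fin m)), P.diagonalAct m X σ ≫ φ m = φ m)
    {Λ : Type} {g : Λ → C} {n m : ℕ} (e : Fin n ≃ Fin m) (x : Elem g (P.obj m))
    (v : Fin m → Elem g X) : φ n ∙ ((P.actEquiv e ∙ x) ⊠ tf (v ∘ e)) = φ m ∙ (x ⊠ tf v) := by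
  obtain rfl := Fin.equiv_iff_eq.1 ⟨e⟩
  conv_rhs => rw [← h n e.symm, comp_app, P.diagonalAct_app]
  rw [P.actEquiv_perm]
  rfl

section Eval

variable {O : Operad C} {A : C} (a : AlgebraStructure O A) {Λ : Type} {g : Λ → C}

/-- The evaluation of formal operations in an algebra. -/
def AlgebraStructure.eval (t : Term O g (Elem g A)) : Elem g A :=
  Quotient.lift (fun s : PreTerm O g (Elem g A) => a.ξ s.arity ∙ (s.op ⊠ tf s.args)) (by
    rintro ⟨n, x, v⟩ ⟨m, y, w⟩ ⟨(e : Fin n ≃ Fin m), (hx : x = O.actEquiv e ∙ y),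
      (hv : v = w ∘ e)⟩
    subst hx hv
    exact O.app_actEquiv a.equivariant e y w) t

namespace AlgebraStructure

theorem eval_mk {n : ℕ} (x : Elem g (O.obj n)) (v : Fin n → Elem g A) :
    a.eval (.mk x v) = a.ξ n ∙ (x ⊠ tf v) := rfl

theorem eval_pure (v : Elem g A) : a.eval (.pure v) = v := by
  have := congrArg (fun f => f ∙ ((one : Elem g _) ⊠ v)) a.unit
  simp only [comp_app, hom_app, leftUnitor_app, tensorPowOne_inv_app] at this
  exact this

theorem eval_comp {n : ℕ} (x : Elem g (O.obj n)) {j : Fin n → ℕ} (y : ∀ i, Elem g (O.obj (j i)))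
    (w : ∀ i, Fin (j i) → Elem g A) :
    a.eval (.comp x y w) = a.ξ n ∙ (x ⊠ tf fun i => a.ξ (j i) ∙ (y i ⊠ tf (w i))) := by
  have := congrArg (fun f => f ∙ ((x ⊠ tf y) ⊠ tf (flat w))) (a.assoc j)
  simp only [comp_app, whiskerRight_app, associator_app, whiskerLeft_app, tensorFinShuffle_pow_app,
    tensorFinMap_app, flat_apply] at this
  exact this

/-- Associativity of the action. With `eval_pure` it says that `Elem g A` is an algebra over the
monad `Term O g`. -/
theorem eval_bind {V : Type*} (t : Term O g V) (f : V → Term O g (Elem g A)) :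
    a.eval (t.bind f) = a.eval (t.map fun b => a.eval (f b)) := by
  obtain ⟨n, x, v, rfl⟩ := t.exists_rep
  choose j y w h using fun i => (f (v i)).exists_rep
  rw [Term.bind_mk x v f y w h, eval_comp, Term.map_mk, eval_mk]
  simp only [Function.comp_def, h, eval_mk]

end AlgebraStructure

end Eval

/-- A term is an operation applied to a tuple, and action maps are determined by their values on
such pairs. -/
theorem isAlgebraHom_iff {O : Operad C} {A B : C} {a : AlgebraStructure O A}
    {b : AlgebraStructure O B} {f : A ⟶ B} :
    IsAlgebraHom a b f ↔ ∀ {Λ : Type} (g : Λ → C) (t : Term O g (Elem g A)),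
      f ∙ a.eval t = b.eval (t.map fun x => f ∙ x) := by
  constructor
  · intro h Λ g t
    obtain ⟨n, x, v, rfl⟩ := t.exists_rep
    have := congrArg (fun f => f ∙ (x ⊠ tf v)) (h n)
    simp only [comp_app, whiskerLeft_app, tensorPowMap_app] at this
    rw [a.eval_mk, this, Term.map_mk, b.eval_mk]
    rfl
  · intro h m
    refine Shape.hom_ext (.tens (.leaf _) (.fin m fun _ => .leaf A)) fun g x => ?_
    obtain ⟨x, v⟩ := x
    change _ ∙ (x ⊠ tf v) = _ ∙ (x ⊠ tf v)
    have := h g (.mk x v)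
    rw [a.eval_mk, Term.map_mk, b.eval_mk] at this
    simp only [comp_app, whiskerLeft_app, tensorPowMap_app, this]
    rfl

theorem AlgebraStructure.ext_elem {O : Operad C} {A : C} {a b : AlgebraStructure O A}
    (h : IsAlgebraHom a b (𝟙 A)) : a = b := by
  ext m
  have := h m
  rwa [Category.comp_id, tensorPowMap_id, whiskerLeft_id, Category.id_comp] at this

/-! ### Maps between presented objects, tested on elements of the generators. -/

namespace Pres

variable {Q : C}

/-- The elements that come from a generator. -/
def Reach (p : Pres Q) {Λ : Type} {g : Λ → C} (y : Elem g Q) : Prop :=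
  ∃ (i : p.I) (x : (p.P i).El g), y = p.q i ∙ (p.P i).ev x

/-- Used to verify the algebra axioms on quotients: only inputs that come from generators need to be
considered. -/
theorem IsValid.hom_ext_fin {n : ℕ} {Q : Fin n → C} {p : ∀ i, Pres (Q i)}
    (hp : ∀ i, (p i).IsValid) (s : Shape C) {Z : C} {F G : s.obj ⊗ tensorFin Q ⟶ Z}
    (h : ∀ {Λ : Type} (g : Λ → C) (x : s.El g) (v : ∀ i, Elem g (Q i)),
      (∀ i, (p i).Reach (v i)) → F ∙ (s.ev x ⊠ tf v) = G ∙ (s.ev x ⊠ tf v)) : F = G := by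
  refine ((isValid_ofShape s).tens (IsValid.fin hp)).hom_ext fun i Λ g x => ?_
  obtain ⟨i, α⟩ := i
  obtain ⟨x, y⟩ := x
  change F ∙ (𝟙 _ ⊗ₘ tensorFinMap fun i => (p i).q (α i)) ∙ (s.ev x ⊠
    tf fun i => ((p i).P (α i)).ev (y i)) = G ∙ (𝟙 _ ⊗ₘ tensorFinMap fun i => (p i).q (α i)) ∙
      (s.ev x ⊠ tf fun i => ((p i).P (α i)).ev (y i))
  rw [hom_app, id_app, tensorFinMap_app]
  exact h g x _ fun i => ⟨α i, y i, rfl⟩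

theorem IsValid.hom_ext_tens_fin {Q₀ : C} {p₀ : Pres Q₀} (hp₀ : p₀.IsValid) {n : ℕ}
    {Q : Fin n → C} {p : ∀ i, Pres (Q i)} (hp : ∀ i, (p i).IsValid) {Z : C}
    {F G : Q₀ ⊗ tensorFin Q ⟶ Z}
    (h : ∀ {Λ : Type} (g : Λ → C) (x : Elem g Q₀) (v : ∀ i, Elem g (Q i)), p₀.Reach x →
      (∀ i, (p i).Reach (v i)) → F ∙ (x ⊠ tf v) = G ∙ (x ⊠ tf v)) : F = G := by
  refine (hp₀.tens (IsValid.fin hp)).hom_ext fun i Λ g x => ?_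
  obtain ⟨i, α⟩ := i
  obtain ⟨x, y⟩ := x
  change F ∙ (p₀.q i ⊗ₘ tensorFinMap fun i => (p i).q (α i)) ∙ ((p₀.P i).ev x ⊠
    tf fun i => ((p i).P (α i)).ev (y i)) = G ∙ (p₀.q i ⊗ₘ tensorFinMap fun i => (p i).q (α i)) ∙
      ((p₀.P i).ev x ⊠ tf fun i => ((p i).P (α i)).ev (y i))
  rw [hom_app, tensorFinMap_app]
  exact h g _ _ ⟨i, x, rfl⟩ fun i => ⟨α i, y i, rfl⟩

/-- A reflexive relation between the pure elements of the generators that contains the relations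
of the presentation. -/
structure Respects (p : Pres Q) (S : ∀ {Λ : Type} (g : Λ → C) (i i' : p.I),
    (p.P i).El g → (p.P i').El g → Prop) : Prop where
  refl : ∀ {Λ : Type} (g : Λ → C) (i : p.I) (x : (p.P i).El g), S g i i x x
  rel : ∀ {Λ : Type} (g : Λ → C) (j : p.J) (z : (p.R j).El g), ∃ x x',
    p.r j ∙ (p.R j).ev z = (p.P _).ev x ∧ p.s j ∙ (p.R j).ev z = (p.P _).ev x' ∧ S g _ _ x x'

theorem Respects.rel_K {p : Pres Q} {S} (h : p.Respects S) {Λ : Type} (g : Λ → C) (k : p.K)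
    (z : (p.V k).El g) : ∃ x x', p.kr k ∙ (p.V k).ev z = (p.P _).ev x ∧
      p.kl k ∙ (p.V k).ev z = (p.P _).ev x' ∧ S g _ _ x x' := by
  cases k with
  | inl i => exact ⟨z, z, id_app _, id_app _, h.refl g i z⟩
  | inr j => exact h.rel g j z

theorem respects_ofShape (s : Shape C) : (ofShape s).Respects fun _ _ _ x x' => x = x' where
  refl _ _ _ := rfl
  rel _ j := j.elim

/-- The main tool for defining operations on quotients. It suffices that `φ` is unchanged when all
factors are simultaneously replaced by related ones; since the relations are reflexive, this
includes replacing only some of the factors. -/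
theorem IsValid.exists_hom_tens_fin {Q₀ : C} {p₀ : Pres Q₀} (hp₀ : p₀.IsValid) {n : ℕ}
    {Q : Fin n → C} {p : ∀ i, Pres (Q i)} (hp : ∀ i, (p i).IsValid) {S₀} (h₀ : p₀.Respects S₀)
    {S : ∀ t : Fin n, ∀ {Λ : Type} (g : Λ → C) (i i' : (p t).I),
      ((p t).P i).El g → ((p t).P i').El g → Prop} (hS : ∀ t, (p t).Respects (S t)) {Z : C}
    (φ : ∀ (i : p₀.I) (α : ∀ t, (p t).I),
      (p₀.P i).obj ⊗ tensorFin (fun t => ((p t).P (α t)).obj) ⟶ Z)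
    (h : ∀ {Λ : Type} (g : Λ → C) (i i' : p₀.I) (α α' : ∀ t, (p t).I) (x : (p₀.P i).El g)
      (x' : (p₀.P i').El g) (y : ∀ t, ((p t).P (α t)).El g) (y' : ∀ t, ((p t).P (α' t)).El g),
      S₀ g i i' x x' → (∀ t, S t g _ _ (y t) (y' t)) →
        φ i α ∙ ((p₀.P i).ev x ⊠ tf fun t => ((p t).P (α t)).ev (y t)) =
          φ i' α' ∙ ((p₀.P i').ev x' ⊠ tf fun t => ((p t).P (α' t)).ev (y' t))) :
    ∃ ψ : Q₀ ⊗ tensorFin Q ⟶ Z, ∀ {Λ : Type} (g : Λ → C) (i : p₀.I) (α : ∀ t, (p t).I)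
      (x : (p₀.P i).El g) (y : ∀ t, ((p t).P (α t)).El g),
      ψ ∙ ((p₀.q i ∙ (p₀.P i).ev x) ⊠ tf fun t => (p t).q (α t) ∙ ((p t).P (α t)).ev (y t)) =
        φ i α ∙ ((p₀.P i).ev x ⊠ tf fun t => ((p t).P (α t)).ev (y t)) := by
  have hk : ∀ {Λ : Type} (g : Λ → C) (k₀ : p₀.K) (k : ∀ t, (p t).K) (x : (p₀.V k₀).El g)
      (y : ∀ t, ((p t).V (k t)).El g),
      φ (p₀.ks k₀) (fun t => (p t).ks (k t)) ∙ ((p₀.kr k₀ ∙ (p₀.V k₀).ev x) ⊠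
        tf fun t => (p t).kr (k t) ∙ ((p t).V (k t)).ev (y t)) =
      φ (p₀.kt k₀) (fun t => (p t).kt (k t)) ∙ ((p₀.kl k₀ ∙ (p₀.V k₀).ev x) ⊠
        tf fun t => (p t).kl (k t) ∙ ((p t).V (k t)).ev (y t)) := by
    intro Λ g k₀ k x y
    obtain ⟨x₁, x₂, e₁, e₂, hx⟩ := h₀.rel_K g k₀ x
    choose y₁ y₂ f₁ f₂ hy using fun t => (hS t).rel_K g (k t) (y t)
    rw [e₁, e₂]
    simp only [f₁, f₂]
    exact h g _ _ _ _ x₁ x₂ y₁ y₂ hx hy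
  obtain ⟨ψ, hψ⟩ := (hp₀.tens (IsValid.fin hp)).exists_hom (fun i => φ i.1 i.2) fun j Λ g x => by
    obtain ⟨k₀, α | k⟩ := j
    -- A trivial relation of the whole product is, on elements, the family of trivial relations of
    -- the factors.
    · obtain ⟨x, y⟩ := x
      have := hk g k₀ (fun t => Sum.inl (α t)) x y
      change φ (p₀.ks k₀) α ∙ (p₀.kr k₀ ⊗ₘ 𝟙 _) ∙ ((p₀.V k₀).ev x ⊠
          tf fun t => ((p t).P (α t)).ev (y t)) =
        φ (p₀.kt k₀) α ∙ (p₀.kl k₀ ⊗ₘ 𝟙 _) ∙ ((p₀.V k₀).ev x ⊠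
          tf fun t => ((p t).P (α t)).ev (y t))
      rw [hom_app, hom_app, id_app]
      have e : ∀ t, (p t).kr (Sum.inl (α t)) ∙ ((p t).V (Sum.inl (α t))).ev (y t) =
        ((p t).P (α t)).ev (y t) := fun t => id_app _
      have e' : ∀ t, (p t).kl (Sum.inl (α t)) ∙ ((p t).V (Sum.inl (α t))).ev (y t) =
        ((p t).P (α t)).ev (y t) := fun t => id_app _
      rw [funext e, funext e'] at this
      exact this
    · obtain ⟨x, y⟩ := x
      change φ (p₀.ks k₀) (fun t => (p t).ks (k t)) ∙
          (p₀.kr k₀ ⊗ₘ tensorFinMap fun t => (p t).kr (k t)) ∙ ((p₀.V k₀).ev x ⊠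
            tf fun t => ((p t).V (k t)).ev (y t)) =
        φ (p₀.kt k₀) (fun t => (p t).kt (k t)) ∙
          (p₀.kl k₀ ⊗ₘ tensorFinMap fun t => (p t).kl (k t)) ∙ ((p₀.V k₀).ev x ⊠
            tf fun t => ((p t).V (k t)).ev (y t))
      rw [hom_app, hom_app, tensorFinMap_app, tensorFinMap_app]
      exact hk g k₀ k x y
  refine ⟨ψ, fun g i α x y => ?_⟩
  have hψ' : (p₀.q i ⊗ₘ tensorFinMap fun t => (p t).q (α t)) ≫ ψ = φ i α := hψ (i, α)
  rw [← hψ', comp_app, hom_app, tensorFinMap_app]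

end Pres

/-- An algebra structure on a presented object, given by maps that satisfy the axioms on the
elements that come from generators. -/
def AlgebraStructure.ofElem {O : Operad C} {A : C} {p : Pres A} (hp : p.IsValid)
    (ξ : ∀ m : ℕ, O.obj m ⊗ tensorPow A m ⟶ A)
    (equivariant : ∀ {Λ : Type} (g : Λ → C) (m : ℕ) (σ : Equiv.Perm (Fin m)) (x : Elem g (O.obj m))
      (v : Fin m → Elem g A), (∀ i, p.Reach (v i)) →
        ξ m ∙ ((O.act σ⁻¹ ∙ x) ⊠ tf (v ∘ σ.symm)) = ξ m ∙ (x ⊠ tf v))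
    (assoc : ∀ {Λ : Type} (g : Λ → C) (m : ℕ) (j : Fin m → ℕ) (x : Elem g (O.obj m))
      (y : ∀ i, Elem g (O.obj (j i))) (v : ∀ i, Fin (j i) → Elem g A),
      (∀ i l, p.Reach (v i l)) →
        ξ _ ∙ ((O.comp j ∙ (x ⊠ tf y)) ⊠ tf (flat v)) =
          ξ m ∙ (x ⊠ tf fun i => ξ (j i) ∙ (y i ⊠ tf (v i))))
    (unit : ∀ {Λ : Type} (g : Λ → C) (v : Elem g A), p.Reach v →
      ξ 1 ∙ ((O.one ∙ one) ⊠ tf fun _ => v) = v) : AlgebraStructure O A where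
  ξ := ξ
  equivariant m σ := by
    refine Pres.IsValid.hom_ext_fin (fun _ => hp) (.leaf (O.obj m)) fun g x v hv => ?_
    rw [comp_app]
    exact (congrArg _ (O.diagonalAct_app σ x v)).trans (equivariant g m σ x v hv)
  assoc {m} j := by
    refine Pres.IsValid.hom_ext_fin (fun _ => hp)
      (.tens (.leaf (O.obj m)) (.fin m fun i => .leaf (O.obj (j i)))) fun g x v hv => ?_
    obtain ⟨x, y⟩ := x
    change (_ ≫ _) ∙ ((x ⊠ tf y) ⊠ tf v) = (_ ≫ _) ∙ ((x ⊠ tf y) ⊠ tf v)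
    simp only [comp_app, whiskerRight_app, associator_app, whiskerLeft_app,
      tensorFinShuffle_pow_app, tensorFinMap_app]
    have := assoc g m j x y (fun i l => v (finSigmaFinEquiv ⟨i, l⟩)) fun i l => hv _
    rwa [flat_eq] at this
  unit := by
    rw [← cancel_epi (λ_ A).inv]
    refine hp.hom_ext fun i Λ g x => ?_
    simp only [comp_app, leftUnitor_inv_app, hom_app, tensorPowOne_inv_app, leftUnitor_app]
    exact unit g _ ⟨i, x, rfl⟩

end AlgebrasByElements

/-! ### Limits of algebras -/

section LimitsOfAlgebras

variable {C : Type u} [Category.{v} C] [MonoidalCategory C] [SymmetricCategory C]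

open Elem

/-- An algebra structure on an object with a jointly monic family of maps to algebras that commute
with the action maps. -/
def AlgebraStructure.ofJointlyMono {O : Operad C} {A : C} {J : Type*} {B : J → C}
    (b : ∀ d, AlgebraStructure O (B d)) (π : ∀ d, A ⟶ B d)
    (hπ : ∀ {Z : C} (f g : Z ⟶ A), (∀ d, f ≫ π d = g ≫ π d) → f = g)
    (ξ : ∀ m : ℕ, O.obj m ⊗ tensorPow A m ⟶ A)
    (h : ∀ d m, ξ m ≫ π d = (O.obj m ◁ tensorPowMap (π d) m) ≫ (b d).ξ m) :
    AlgebraStructure O A :=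
  -- After projection to `B d` the action is evaluation there, so each axiom holds because it holds
  -- in every `B d`.
  have key : ∀ (d : J) (m : ℕ) {Λ : Type} {g : Λ → C} (x : Elem g (O.obj m))
      (v : Fin m → Elem g A),
      π d ∙ ξ m ∙ (x ⊠ tf v) = (b d).eval (.mk x fun i => π d ∙ v i) := fun d m Λ g x v => by
    rw [← comp_app, h, comp_app, whiskerLeft_app, tensorPowMap_app]
    rfl
  { ξ := ξ
    equivariant := fun m σ => hπ _ _ fun d => by
      refine Shape.hom_ext (.tens (.leaf _) (.fin m fun _ => .leaf A)) fun g x => ?_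
      obtain ⟨x, v⟩ := x
      change (_ ≫ _) ∙ (x ⊠ tf v) = (_ ≫ _) ∙ (x ⊠ tf v)
      rw [Category.assoc, comp_app, comp_app, comp_app]
      refine (congrArg (fun y => π d ∙ ξ m ∙ y) (O.diagonalAct_app σ x v)).trans ?_
      rw [key, key, Term.mk_act]
      congr 2
      funext i
      exact congrArg (fun i => π d ∙ v i) (σ.symm_apply_apply i)
    assoc := fun {m} j => hπ _ _ fun d => by
      refine Shape.hom_ext (.tens (.tens (.leaf _) (.fin m fun i => .leaf (O.obj (j i))))
        (.fin _ fun _ => .leaf A)) fun g x => ?_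
      obtain ⟨⟨x, y⟩, v⟩ := x
      change (_ ≫ _) ∙ ((x ⊠ tf y) ⊠ tf v) = (_ ≫ _) ∙ ((x ⊠ tf y) ⊠ tf v)
      simp only [comp_app, whiskerRight_app, associator_app, whiskerLeft_app,
        tensorFinShuffle_pow_app, tensorFinMap_app, key]
      refine Eq.trans ?_ ((b d).eval_comp x y fun i l => π d ∙ v (finSigmaFinEquiv ⟨i, l⟩))
      rw [Term.comp, flat_eq fun t => π d ∙ v t]
    unit := hπ _ _ fun d => by
      rw [← cancel_epi (λ_ A).inv]
      refine Shape.hom_ext (.leaf A) fun g x => ?_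
      change _ ∙ x = _ ∙ x
      simp only [comp_app, leftUnitor_inv_app, hom_app, tensorPowOne_inv_app, leftUnitor_app, key]
      exact (b d).eval_pure _ }

theorem isAlgebraHom_of_jointlyMono {O : Operad C} {A S : C} {J : Type*} {B : J → C}
    {a : AlgebraStructure O A} {s : AlgebraStructure O S} {b : ∀ d, AlgebraStructure O (B d)}
    {π : ∀ d, A ⟶ B d} (hπ : ∀ {Z : C} (f g : Z ⟶ A), (∀ d, f ≫ π d = g ≫ π d) → f = g)
    (h : ∀ d, IsAlgebraHom a (b d) (π d)) {f : S ⟶ A}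
    (hf : ∀ d, IsAlgebraHom s (b d) (f ≫ π d)) : IsAlgebraHom s a f := fun m => hπ _ _ fun d => by
  rw [Category.assoc, hf d m, Category.assoc, h d m, tensorPowMap_comp, whiskerLeft_comp,
    Category.assoc]

theorem IsAlgebraHom.whisker_comp {O : Operad C} {A B : C} {a : AlgebraStructure O A}
    {b : AlgebraStructure O B} {f : A ⟶ B} (hf : IsAlgebraHom a b f) {L : C} {p : L ⟶ A}
    {p' : L ⟶ B} (h : p' = p ≫ f) (m : ℕ) :
    (O.obj m ◁ tensorPowMap p' m) ≫ b.ξ m = ((O.obj m ◁ tensorPowMap p m) ≫ a.ξ m) ≫ f := by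
  rw [h, tensorPowMap_comp, whiskerLeft_comp, Category.assoc, Category.assoc, hf m]

theorem OperadAlgebra.Hom.isAlgebraHom_of_eq {O : Operad C} {A B : OperadAlgebra O} (F : A ⟶ B)
    {f : A.carrier ⟶ B.carrier} (h : f = F.hom) : IsAlgebraHom A.str B.str f :=
  h ▸ F.isAlgebraHom

/-- The composites of the tensor powers of the projections with the actions on the `D(d)` form a
cone, which forces the action on the limit. The axioms and all comparisons follow from the joint
monicity of the projections. -/
theorem exists_limit_structure {O : Operad C} {J : Type w} [Category.{w'} J]
    (D : J ⥤ OperadAlgebra O) (c : Cone (D ⋙ OperadAlgebra.forget O)) (hc : IsLimit c) :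
    ∃ (a : AlgebraStructure O c.pt) (h : ∀ d, IsAlgebraHom a (D.obj d).str (c.π.app d)),
      (∀ a' : AlgebraStructure O c.pt,
        (∀ d, IsAlgebraHom a' (D.obj d).str (c.π.app d)) → a' = a) ∧
      Nonempty (IsLimit (OperadAlgebra.coneOf D c a h)) := by
  let K (m : ℕ) : Cone (D ⋙ OperadAlgebra.forget O) :=
    { pt := O.obj m ⊗ tensorPow c.pt m
      π :=
        { app := fun d => (O.obj m ◁ tensorPowMap (c.π.app d) m) ≫ (D.obj d).str.ξ m
          naturality := fun d d' f => (Category.id_comp _).trans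
            ((D.map f).isAlgebraHom.whisker_comp (c.w f).symm m) } }
  let a : AlgebraStructure O c.pt := AlgebraStructure.ofJointlyMono
    (fun d => (D.obj d).str) (fun d => c.π.app d) (fun f g h => hc.hom_ext h)
    (fun m => hc.lift (K m)) fun d m => hc.fac (K m) d
  have h : ∀ d, IsAlgebraHom a (D.obj d).str (c.π.app d) := fun d m => hc.fac (K m) d
  refine ⟨a, h, fun a' h' => ?_, ⟨?_⟩⟩
  · ext m
    exact hc.hom_ext fun d => (h' d m).trans (h d m).symm
  · refine
      { lift := fun s => ⟨hc.lift ((OperadAlgebra.forget O).mapCone s),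
          isAlgebraHom_of_jointlyMono (fun f g h => hc.hom_ext h) h fun d =>
            (s.π.app d).isAlgebraHom_of_eq (hc.fac ((OperadAlgebra.forget O).mapCone s) d)⟩
        fac := fun s d => OperadAlgebra.hom_ext _ _ (hc.fac ((OperadAlgebra.forget O).mapCone s) d)
        uniq := fun s f hf => OperadAlgebra.hom_ext _ _
          (hc.uniq ((OperadAlgebra.forget O).mapCone s) f.hom fun d =>
            congrArg OperadAlgebra.Hom.hom (hf d)) }

end LimitsOfAlgebras

/-! ### Free algebras -/

section FreeAlgebrasByElements

variable {C : Type u} [Category.{v} C] [MonoidalCategory C] [SymmetricCategory C]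
  [HasCountableColimits C]

open Elem

variable {O : Operad C} {X : C} {Λ : Type} {g : Λ → C}

/-- The element of the free algebra given by a formal operation. -/
def Operad.inj (O : Operad C) {X : C} (t : Term O g (Elem g X)) : Elem g (O.free.obj X) :=
  Quotient.lift (fun s : PreTerm O g (Elem g X) => O.ι s.arity X ∙ (s.op ⊠ tf s.args)) (by
    rintro ⟨n, x, v⟩ ⟨m, y, w⟩ ⟨(e : Fin n ≃ Fin m), (hx : x = O.actEquiv e ∙ y),
      (hv : v = w ∘ e)⟩
    subst hx hv
    exact O.app_actEquiv (φ := fun m => O.ι m X) (fun m σ => O.diagonalAct_incl m X σ) e y w) t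

theorem Operad.inj_mk {n : ℕ} (x : Elem g (O.obj n)) (v : Fin n → Elem g X) :
    O.inj (.mk x v) = O.ι n X ∙ (x ⊠ tf v) := rfl

theorem Operad.free_map_inj {Y : C} (f : X ⟶ Y) (t : Term O g (Elem g X)) :
    O.free.map f ∙ O.inj t = O.inj (t.map fun x => f ∙ x) := by
  obtain ⟨n, x, v, rfl⟩ := t.exists_rep
  rw [Term.map_mk, O.inj_mk, O.inj_mk, ← comp_app, SymmetricSequence.ι_map, comp_app,
    whiskerLeft_app, tensorPowMap_app]
  rfl

theorem Operad.unit_app (x : Elem g X) : O.unit.app X ∙ x = O.inj (.pure x) := by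
  have : ((λ_ X).inv ≫ (O.one ⊗ₘ (tensorPowOne X).inv) ≫ O.ι 1 X) ∙ x =
      O.ι 1 X ∙ ((O.one ∙ Elem.one) ⊠ tf fun _ : Fin 1 => x) := by
    rw [comp_app, comp_app, leftUnitor_inv_app, hom_app, tensorPowOne_inv_app]
  exact this

theorem AlgebraStructure.action_inj (a : AlgebraStructure O X) (t : Term O g (Elem g X)) :
    a.action ∙ O.inj t = a.eval t := by
  obtain ⟨n, x, v, rfl⟩ := t.exists_rep
  rw [O.inj_mk, ← comp_app, a.ι_action, a.eval_mk]

theorem Operad.free_ext {Z : C} {F G : O.free.obj X ⟶ Z}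
    (h : ∀ {Λ : Type} (g : Λ → C) (t : Term O g (Elem g X)), F ∙ O.inj t = G ∙ O.inj t) :
    F = G := by
  refine SymmetricSequence.hom_ext _ _ _ fun m =>
    Shape.hom_ext (.tens (.leaf _) (.fin m fun _ => .leaf X)) fun g x => ?_
  rw [comp_app, comp_app]
  exact h g (.mk x.1 x.2)

/-- The relations that define the coinvariants move the permutation between operation and inputs,
hence do not change the term. -/
theorem Pres.respects_schur (O : Operad C) (X : C) :
    (Pres.schur O.toSymmetricSequence X).Respects fun g _ _ x x' =>
      (Term.mk x.1 x.2 : Term O g (Elem g X)) = Term.mk x'.1 x'.2 where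
  refl _ _ _ := rfl
  rel g j z := by
    refine ⟨(O.act j.2⁻¹ ∙ z.1, z.2 ∘ j.2.symm), z, O.diagonalAct_app j.2 z.1 z.2, id_app _, ?_⟩
    refine (Term.mk_act _ _ _).trans ?_
    congr 1
    funext i
    exact congrArg z.2 (j.2.symm_apply_apply i)

theorem Pres.Reach.exists_inj {y : Elem g (O.free.obj X)}
    (h : (Pres.schur O.toSymmetricSequence X).Reach y) : ∃ t, y = O.inj t := by
  obtain ⟨i, x, rfl⟩ := h
  exact ⟨.mk x.1 x.2, rfl⟩

/-- The formula on summands says that evaluation in `𝕆 X` is flattening of terms of terms, the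
multiplication of the monad. -/
theorem isFreeStructure_iff {a : AlgebraStructure O (O.free.obj X)} :
    IsFreeStructure O X a ↔ ∀ {Λ : Type} (g : Λ → C) (t : Term O g (Term O g (Elem g X))),
      a.eval (t.map O.inj) = O.inj (t.bind id) := by
  constructor
  · intro h Λ g t
    obtain ⟨n, x, v, rfl⟩ := t.exists_rep
    choose j y w hv using fun i => (v i).exists_rep
    have := congrArg (fun f => f ∙ ((x ⊠ tf y) ⊠ tf (flat w))) (h j)
    simp only [comp_app, associator_app, whiskerLeft_app, tensorFinShuffle_pow_app,
      tensorFinMap_app, whiskerRight_app, flat_apply] at this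
    rw [Term.map_mk, a.eval_mk, Term.bind_mk x v id y w hv]
    simp only [Function.comp_def, hv]
    exact this
  · intro h m j
    refine Shape.hom_ext (.tens (.tens (.leaf _) (.fin m fun i => .leaf (O.obj (j i))))
        (.fin _ fun _ => .leaf X)) fun g x => ?_
    obtain ⟨⟨x, y⟩, v⟩ := x
    change (_ ≫ _) ∙ ((x ⊠ tf y) ⊠ tf v) = (_ ≫ _) ∙ ((x ⊠ tf y) ⊠ tf v)
    simp only [comp_app, whiskerRight_app, associator_app, whiskerLeft_app,
      tensorFinShuffle_pow_app, tensorFinMap_app]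
    have := h g (.mk x fun i => .mk (y i) fun l => v (finSigmaFinEquiv ⟨i, l⟩))
    have e : (Term.mk x fun i => Term.mk (y i) fun l => v (finSigmaFinEquiv ⟨i, l⟩)).bind id =
        Term.comp x y fun i l => v (finSigmaFinEquiv ⟨i, l⟩) := Term.bind_mk _ _ _ _ _ fun _ => rfl
    rw [Term.map_mk, a.eval_mk, e, Term.comp, O.inj_mk, flat_eq] at this
    exact this

variable [TensorPreservesCountableColimits C]

/-- The composition of operations with the generators of a free algebra. -/
def Operad.compGen (O : Operad C) (X : C) {m : ℕ} (j : Fin m → ℕ) :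
    (O.obj m ⊗ tensorFin fun i => O.obj (j i) ⊗ tensorPow X (j i)) ⟶ O.free.obj X :=
  (O.obj m ◁ tensorFinUnshuffle j (fun i => O.obj (j i)) fun _ => X) ≫
    (α_ _ _ _).inv ≫ (O.comp j ▷ _) ≫ O.ι _ X

theorem Operad.compGen_app {m : ℕ} {j : Fin m → ℕ} (x : Elem g (O.obj m))
    (y : ∀ i, Elem g (O.obj (j i))) (v : ∀ i, Fin (j i) → Elem g X) :
    O.compGen X j ∙ (x ⊠ tf (f := fun i => O.obj (j i) ⊗ tensorPow X (j i))
      fun i => y i ⊠ tf (v i)) = O.inj (.comp x y v) := by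
  simp only [compGen, comp_app, whiskerLeft_app, tensorFinUnshuffle_pow_app, associator_inv_app,
    whiskerRight_app]
  rfl

/-- Flattening is defined on generators by composition in `O` and respects equality of terms by
`Term.comp_congr`. The algebra axioms then become the monad laws of `Term`. -/
theorem exists_freeStructure (O : Operad C) (X : C) :
    ∃ a : AlgebraStructure O (O.free.obj X), IsFreeStructure O X a := by
  have h := fun m => Pres.IsValid.exists_hom_tens_fin (Pres.isValid_ofShape (.leaf (O.obj m)))
    (p := fun _ : Fin m => Pres.schur O.toSymmetricSequence X)
    (fun _ => Pres.isValid_schur _ _) (Pres.respects_ofShape _) (fun _ => Pres.respects_schur O X)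
    (fun _ (j : Fin m → ℕ) => O.compGen X j) (by
      intro Λ g _ _ (j : Fin m → ℕ) (j' : Fin m → ℕ) (x : Elem g (O.obj m))
        (x' : Elem g (O.obj m)) (y : ∀ i, Elem g (O.obj (j i)) × (Fin (j i) → Elem g X))
        (y' : ∀ i, Elem g (O.obj (j' i)) × (Fin (j' i) → Elem g X)) hx hy
      obtain rfl : x = x' := hx
      refine (O.compGen_app x (fun i => (y i).1) fun i => (y i).2).trans
        (Eq.trans ?_ (O.compGen_app x (fun i => (y' i).1) fun i => (y' i).2).symm)
      exact congrArg O.inj (Term.comp_congr (Equiv.refl _) (by rw [O.actEquiv_refl, id_app]) hy))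
  choose ξ hξ using h
  -- The axioms and freeness are all read off from this formula; the chosen decompositions `j`, `y`,
  -- `w` no longer appear in it.
  have key : ∀ {Λ : Type} {g : Λ → C} {m : ℕ} (x : Elem g (O.obj m))
      (t : Fin m → Term O g (Elem g X)),
      ξ m ∙ (x ⊠ tf fun i => O.inj (t i)) = O.inj ((Term.mk x t).bind id) := by
    intro Λ g m x t
    choose j y w ht using fun i => (t i).exists_rep
    have := hξ m g () j x fun i => (y i, w i)
    change ξ m ∙ ((𝟙 _ ∙ x) ⊠ tf fun i => O.ι (j i) X ∙ (y i ⊠ tf (w i))) =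
      O.compGen X j ∙ (x ⊠ tf (f := fun i => O.obj (j i) ⊗ tensorPow X (j i))
        fun t => (y t) ⊠ tf (w t)) at this
    rw [O.compGen_app, id_app] at this
    rw [Term.bind_mk x t id y w ht]
    simp only [ht]
    exact this
  refine ⟨AlgebraStructure.ofElem (Pres.isValid_schur O.toSymmetricSequence X) ξ ?_ ?_ ?_,
    isFreeStructure_iff.2 ?_⟩
  · intro Λ g m σ x v hv
    choose t ht using fun i => (hv i).exists_inj
    obtain rfl : v = _ := funext ht
    refine (key (O.act σ⁻¹ ∙ x) (t ∘ σ.symm)).trans ?_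
    rw [key, Term.mk_act]
    congr 3
    funext i
    exact congrArg t (σ.symm_apply_apply i)
  · intro Λ g m j x y v hv
    choose t ht using fun i l => (hv i l).exists_inj
    obtain rfl : v = _ := funext fun i => funext (ht i)
    have e : (flat fun i l => O.inj (t i l)) = fun s => O.inj (flat t s) := rfl
    simp only [e, key]
    have := Term.bind_assoc (.mk x fun i => .mk (y i) (t i)) id id
    have e : (Term.mk x fun i => Term.mk (y i) (t i)).bind id = Term.comp x y t :=
      Term.bind_mk _ _ _ _ _ fun _ => rfl
    rw [e, Term.comp] at this
    rw [this]
    congr 1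
  · intro Λ g v hv
    obtain ⟨t, rfl⟩ := hv.exists_inj
    rw [key]
    exact congrArg O.inj (Term.pure_bind _ _)
  · intro Λ g t
    obtain ⟨n, x, v, rfl⟩ := t.exists_rep
    rw [Term.map_mk]
    exact key x v

theorem IsFreeStructure.unique {a a' : AlgebraStructure O (O.free.obj X)}
    (h : IsFreeStructure O X a) (h' : IsFreeStructure O X a') : a = a' := by
  rw [isFreeStructure_iff] at h h'
  ext m
  refine Pres.IsValid.hom_ext_fin (fun _ => Pres.isValid_schur O.toSymmetricSequence X)
    (.leaf (O.obj m)) fun g x v hv => ?_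
  choose t ht using fun i => (hv i).exists_inj
  obtain rfl : v = _ := funext ht
  have e := (h g (.mk x t)).trans (h' g (.mk x t)).symm
  rw [Term.map_mk] at e
  exact e

/-- Maps of algebras out of a free algebra in terms of formal operations. -/
theorem IsFreeStructure.isAlgebraHom_iff {a : AlgebraStructure O (O.free.obj X)}
    (h : IsFreeStructure O X a) {B : C} {b : AlgebraStructure O B} {f : O.free.obj X ⟶ B} :
    IsAlgebraHom a b f ↔ ∀ {Λ : Type} (g : Λ → C) (t : Term O g (Term O g (Elem g X))),
      f ∙ O.inj (t.bind id) = b.eval (t.map fun s => f ∙ O.inj s) := by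
  rw [isFreeStructure_iff] at h
  constructor
  · intro hf Λ g t
    rw [← h, OperadicAlgebra.isAlgebraHom_iff.1 hf, Term.map_map]
  · intro hf m
    refine Pres.IsValid.hom_ext_fin (fun _ => Pres.isValid_schur O.toSymmetricSequence X)
      (.leaf (O.obj m)) fun g x v hv => ?_
    choose t ht using fun i => (hv i).exists_inj
    obtain rfl : v = _ := funext ht
    have := hf g (.mk x t)
    rw [← h, Term.map_mk, Term.map_mk] at this
    rw [comp_app, comp_app, whiskerLeft_app, tensorPowMap_app]
    exact this

theorem IsFreeStructure.isAlgebraHom_map {Y : C} {a : AlgebraStructure O (O.free.obj X)}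
    (h : IsFreeStructure O X a) {b : AlgebraStructure O (O.free.obj Y)}
    (h' : IsFreeStructure O Y b) (f : X ⟶ Y) : IsAlgebraHom a b (O.free.map f) := by
  refine h.isAlgebraHom_iff.2 fun g t => ?_
  simp only [O.free_map_inj]
  rw [← Term.map_map t (fun s => s.map fun x => f ∙ x) O.inj, isFreeStructure_iff.1 h',
    Term.bind_map, Term.map_bind]
  rfl

/-- Evaluating a term of terms in one go or in two stages gives the same result, by
`AlgebraStructure.eval_bind`. -/
theorem IsFreeStructure.isAlgebraHom_action {a : AlgebraStructure O (O.free.obj X)}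
    (h : IsFreeStructure O X a) (b : AlgebraStructure O X) : IsAlgebraHom a b b.action := by
  refine h.isAlgebraHom_iff.2 fun g t => ?_
  simp only [b.action_inj]
  exact b.eval_bind t id

theorem IsAlgebraHom.comp {A B D : C} {a : AlgebraStructure O A} {b : AlgebraStructure O B}
    {d : AlgebraStructure O D} {f : A ⟶ B} {f' : B ⟶ D} (h : IsAlgebraHom a b f)
    (h' : IsAlgebraHom b d f') : IsAlgebraHom a d (f ≫ f') := fun m => by
  rw [tensorPowMap_comp, ← Category.assoc, h, Category.assoc, h', whiskerLeft_comp,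
    Category.assoc]

/-- A map of algebras out of a free algebra is determined by its values on generators. -/
theorem IsFreeStructure.hom_inj {a : AlgebraStructure O (O.free.obj X)}
    (h : IsFreeStructure O X a) {B : C} {b : AlgebraStructure O B} {f : O.free.obj X ⟶ B}
    (hf : IsAlgebraHom a b f) (t : Term O g (Elem g X)) :
    f ∙ O.inj t = b.eval (t.map fun x => (O.unit.app X ≫ f) ∙ x) := by
  have := h.isAlgebraHom_iff.1 hf g (t.map .pure)
  rw [Term.map_bind, Term.map_map] at this
  have e : ∀ x : Elem g X, (O.unit.app X ≫ f) ∙ x = f ∙ O.inj (.pure x) := fun x => by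
    rw [← O.unit_app]
    exact comp_app _ _ _
  simp only [e]
  exact (congrArg (fun t => f ∙ O.inj t) (Term.bind_pure t).symm).trans this

theorem IsFreeStructure.hom_ext {a : AlgebraStructure O (O.free.obj X)}
    (h : IsFreeStructure O X a) {B : C} {b : AlgebraStructure O B} {f f' : O.free.obj X ⟶ B}
    (hf : IsAlgebraHom a b f) (hf' : IsAlgebraHom a b f')
    (e : O.unit.app X ≫ f = O.unit.app X ≫ f') : f = f' :=
  O.free_ext fun g t => by rw [h.hom_inj hf, h.hom_inj hf', e]

/-- The existence half of the universal property of `𝕆 X`: every morphism `f` extends along the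
unit. -/
theorem Operad.unit_map_action {B : C} (b : AlgebraStructure O B) (f : X ⟶ B) :
    O.unit.app X ≫ O.free.map f ≫ b.action = f := by
  refine Shape.hom_ext (.leaf X) fun g x => ?_
  change (O.unit.app X ≫ O.free.map f ≫ b.action) ∙ x = f ∙ x
  have : (O.unit.app X ≫ O.free.map f ≫ b.action) ∙ x =
    b.action ∙ O.free.map f ∙ O.unit.app X ∙ x := by
    rw [← comp_app, ← comp_app]
  rw [this, O.unit_app, O.free_map_inj, Term.map_pure, b.action_inj, b.eval_pure]

end FreeAlgebrasByElements

/-! ### Reflexive coequalizers and colimits of algebras -/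

section ReflexiveCoequalizers

variable {C : Type u} [Category.{v} C] [MonoidalCategory C] [SymmetricCategory C]
  [TensorPreservesCountableColimits C]

open Elem

variable {O : Operad C} {X Y : C} {a' : AlgebraStructure O X} {a : AlgebraStructure O Y}
  {p q : X ⟶ Y}

/-- Tuples of related elements are the images under `p` and `q` of a single tuple of `X`, and `p`,
`q` preserve operations, so `k.π` takes equal values on the two results. Hence the action of `Y`
descends to the quotient in all inputs at once. -/
theorem exists_coequalizer_structure (hp : IsAlgebraHom a' a p) (hq : IsAlgebraHom a' a q)
    {r : Y ⟶ X} (hrp : r ≫ p = 𝟙 _) (hrq : r ≫ q = 𝟙 _) {k : Cofork p q} (hk : IsColimit k) :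
    ∃ b : AlgebraStructure O k.pt, IsAlgebraHom a b k.π := by
  rw [isAlgebraHom_iff] at hp hq
  have hk' := Pres.isValid_cofork hk
  -- The common section `r` makes the relation reflexive; without it inputs could not be varied one
  -- at a time.
  have hS : (Pres.cofork k).Respects fun g _ _ (z z' : Elem g Y) =>
      ∃ w : Elem g X, z = p ∙ w ∧ z' = q ∙ w :=
    { refl := fun g _ (z : Elem g Y) => ⟨r ∙ z, by rw [← comp_app, hrp, id_app],
        by rw [← comp_app, hrq, id_app]⟩
      rel := fun g _ (z : Elem g X) => ⟨p ∙ z, q ∙ z, rfl, rfl, z, rfl, rfl⟩ }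
  -- Both sides come from the evaluation of `w` in `X`, sent through `p` or `q` and then to the
  -- quotient.
  have hpq : ∀ {Λ : Type} {g : Λ → C} {m : ℕ} (x : Elem g (O.obj m)) (w : Fin m → Elem g X),
      (a.ξ m ≫ k.π) ∙ (x ⊠ tf fun i => p ∙ w i) = (a.ξ m ≫ k.π) ∙ (x ⊠ tf fun i => q ∙ w i) := by
    intro Λ g m x w
    have e₁ := hp g (.mk x w)
    have e₂ := hq g (.mk x w)
    rw [Term.map_mk] at e₁ e₂
    rw [comp_app, comp_app]
    refine (congrArg (fun z => k.π ∙ z) e₁.symm).trans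
      (Eq.trans ?_ (congrArg (fun z => k.π ∙ z) e₂))
    rw [← comp_app, k.condition, comp_app]
  have h := fun m => Pres.IsValid.exists_hom_tens_fin (Pres.isValid_ofShape (.leaf (O.obj m)))
    (p := fun _ : Fin m => Pres.cofork k) (fun _ => hk') (Pres.respects_ofShape _) (fun _ => hS)
    (fun _ _ => a.ξ m ≫ k.π) (by
      intro Λ g _ _ _ _ (x : Elem g (O.obj m)) (x' : Elem g (O.obj m)) (y : Fin m → Elem g Y)
        (y' : Fin m → Elem g Y) hx hy
      obtain rfl : x = x' := hx
      choose w hw hw' using hy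
      obtain rfl : y = _ := funext hw
      obtain rfl : y' = _ := funext hw'
      exact hpq x w)
  choose ξ hξ using h
  have key : ∀ {Λ : Type} {g : Λ → C} {m : ℕ} (x : Elem g (O.obj m)) (u : Fin m → Elem g Y),
      ξ m ∙ (x ⊠ tf fun i => k.π ∙ u i) = k.π ∙ a.eval (.mk x u) := by
    intro Λ g m x u
    have := hξ m g () (fun _ => ()) x u
    change ξ m ∙ ((𝟙 _ ∙ x) ⊠ tf fun i => k.π ∙ u i) = (a.ξ m ≫ k.π) ∙ (x ⊠ tf u) at this
    rw [id_app, comp_app] at this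
    exact this
  have reach : ∀ {Λ : Type} {g : Λ → C} {v : Elem g k.pt}, (Pres.cofork k).Reach v →
      ∃ u : Elem g Y, v = k.π ∙ u := fun {Λ g v} ⟨_, u, hu⟩ => ⟨u, hu⟩
  refine ⟨AlgebraStructure.ofElem hk' ξ ?_ ?_ ?_, isAlgebraHom_iff.2 fun g t => ?_⟩
  · intro Λ g m σ x v hv
    choose u hu using fun i => reach (hv i)
    obtain rfl : v = _ := funext hu
    refine (key (O.act σ⁻¹ ∙ x) (u ∘ σ.symm)).trans ?_
    rw [key, Term.mk_act]
    congr 3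
    funext i
    exact congrArg u (σ.symm_apply_apply i)
  · intro Λ g m j x y v hv
    choose u hu using fun i l => reach (hv i l)
    obtain rfl : v = _ := funext fun i => funext (hu i)
    have e : (flat fun i l => k.π ∙ u i l) = fun s => k.π ∙ flat u s := rfl
    simp only [e, key]
    exact congrArg (fun z => k.π ∙ z) (a.eval_comp x y u)
  · intro Λ g v hv
    obtain ⟨u, rfl⟩ := reach hv
    rw [key]
    exact congrArg (fun z => k.π ∙ z) (a.eval_pure u)
  · obtain ⟨n, x, v, rfl⟩ := t.exists_rep
    rw [Term.map_mk]
    exact (key x v).symm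

/-- Maps of algebras descend to coequalizers. -/
theorem IsAlgebraHom.of_coequalizer {k : Cofork p q} (hk : IsColimit k)
    {b : AlgebraStructure O k.pt} (h : IsAlgebraHom a b k.π) {B : C} {c : AlgebraStructure O B}
    {f : k.pt ⟶ B} (hf : IsAlgebraHom a c (k.π ≫ f)) : IsAlgebraHom b c f := fun m => by
  rw [isAlgebraHom_iff] at h hf
  refine Pres.IsValid.hom_ext_fin (fun _ => Pres.isValid_cofork hk) (.leaf (O.obj m))
    fun g (x : Elem g (O.obj m)) v hv => ?_
  have hv' : ∀ i, ∃ u : Elem g Y, v i = k.π ∙ u := fun i =>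
    let ⟨_, u, h⟩ := hv i
    ⟨u, h⟩
  choose u hu using hv'
  obtain rfl : v = _ := funext hu
  have e₁ := h g (.mk x u)
  have e₂ := hf g (.mk x u)
  rw [Term.map_mk] at e₁ e₂
  rw [comp_app, comp_app, whiskerLeft_app, tensorPowMap_app]
  refine (congrArg (fun z => f ∙ z) e₁).symm.trans ?_
  rw [← comp_app, e₂, AlgebraStructure.eval_mk]
  refine congrArg (fun w => c.ξ m ∙ (x ⊠ tf w)) ?_
  funext i
  exact comp_app _ _ _

theorem IsAlgebraHom.coequalizer_unique {k : Cofork p q} (hk : IsColimit k)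
    {b b' : AlgebraStructure O k.pt} (h : IsAlgebraHom a b k.π) (h' : IsAlgebraHom a b' k.π) :
    b' = b :=
  AlgebraStructure.ext_elem (h'.of_coequalizer hk (by rwa [Category.comp_id]))

/-- A coequalizer of the underlying maps is a coequalizer of algebras. -/
def OperadAlgebra.isColimitCofork {A B : OperadAlgebra O} {p q : A ⟶ B} {k : Cofork p.hom q.hom}
    (hk : IsColimit k) (b : AlgebraStructure O k.pt) (h : IsAlgebraHom B.str b k.π)
    {r : B ⟶ ⟨k.pt, b⟩} (hr : p ≫ r = q ≫ r) (e : r.hom = k.π) :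
    IsColimit (Cofork.ofπ r hr) :=
  have w : ∀ s : Cofork p q, p.hom ≫ s.π.hom = q.hom ≫ s.π.hom := fun s =>
    congrArg OperadAlgebra.Hom.hom s.condition
  Cofork.IsColimit.mk _
    (fun s => ⟨Cofork.IsColimit.desc hk s.π.hom (w s), h.of_coequalizer hk (by
      rw [Cofork.IsColimit.π_desc' hk]
      exact s.π.isAlgebraHom)⟩)
    (fun s => OperadAlgebra.hom_ext _ _ (by
      change r.hom ≫ Cofork.IsColimit.desc hk s.π.hom (w s) = s.π.hom
      rw [e, Cofork.IsColimit.π_desc' hk]))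
    (fun s f hf => OperadAlgebra.hom_ext _ _ (Cofork.IsColimit.hom_ext hk (by
      change k.π ≫ f.hom = k.π ≫ Cofork.IsColimit.desc hk s.π.hom (w s)
      rw [Cofork.IsColimit.π_desc' hk, ← e]
      exact congrArg OperadAlgebra.Hom.hom hf)))

end ReflexiveCoequalizers

/-! ### Colimits of algebras as reflexive coequalizers of free algebras. -/

section ColimitsOfAlgebras

variable {C : Type u} [Category.{v} C] [MonoidalCategory C] [SymmetricCategory C]
  [HasCountableColimits C] [TensorPreservesCountableColimits C]

open Elem

variable {O : Operad C}

theorem Operad.unit_action {B : C} (b : AlgebraStructure O B) : O.unit.app B ≫ b.action = 𝟙 B := by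
  have := O.unit_map_action b (𝟙 B)
  rwa [CategoryTheory.Functor.map_id, Category.id_comp] at this

/-- A unit law of the monad; it shows that the reflexion is also a section of the second arrow. -/
theorem IsFreeStructure.map_unit_action {X : C} {a : AlgebraStructure O (O.free.obj X)}
    (h : IsFreeStructure O X a) : O.free.map (O.unit.app X) ≫ a.action = 𝟙 _ := by
  refine O.free_ext fun g t => ?_
  rw [comp_app, O.free_map_inj, a.action_inj, id_app]
  have := isFreeStructure_iff.1 h g (t.map .pure)
  rw [Term.map_map, Term.map_bind] at this
  have e : ∀ x : Elem g X, O.unit.app X ∙ x = O.inj (.pure x) := fun x => O.unit_app x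
  simp only [e]
  exact this.trans (congrArg O.inj (Term.bind_pure t))

variable {J : Type w} [Category.{w'} J] (D : J ⥤ OperadAlgebra O)
  {cD : Cocone (D ⋙ OperadAlgebra.forget O)} (hD : IsColimit cD)
  {cO : Cocone ((D ⋙ OperadAlgebra.forget O) ⋙ O.free)} (hO : IsColimit cO)

/-- The map of colimits induced by the action maps. -/
def colimAction (cD : Cocone (D ⋙ OperadAlgebra.forget O)) : cO.pt ⟶ cD.pt :=
  hO.map cD (Functor.whiskerLeft D (OperadAlgebra.action O))

/-- The map `colim 𝕆 D ⟶ 𝕆 (colim D)`. -/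
def colimFree (cD : Cocone (D ⋙ OperadAlgebra.forget O)) : cO.pt ⟶ O.free.obj cD.pt :=
  hO.desc (O.free.mapCocone cD)

/-- The map of colimits induced by the unit maps. -/
def colimUnit (cO : Cocone ((D ⋙ OperadAlgebra.forget O) ⋙ O.free)) : cD.pt ⟶ cO.pt :=
  hD.map cO (Functor.whiskerLeft (D ⋙ OperadAlgebra.forget O) O.unit)

/-- The maps to the colimit of the underlying diagram. -/
def colimι (cD : Cocone (D ⋙ OperadAlgebra.forget O)) (d : J) : (D.obj d).carrier ⟶ cD.pt :=
  cD.ι.app d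

/-- The maps to the colimit of the diagram of free algebras. -/
def colimFreeι (cO : Cocone ((D ⋙ OperadAlgebra.forget O) ⋙ O.free)) (d : J) :
    O.free.obj (D.obj d).carrier ⟶ cO.pt :=
  cO.ι.app d

theorem colimFreeι_action (d : J) : colimFreeι D cO d ≫ colimAction D hO cD =
    (D.obj d).str.action ≫ colimι D cD d :=
  hO.ι_map cD (Functor.whiskerLeft D (OperadAlgebra.action O)) d

theorem colimFreeι_free (d : J) : colimFreeι D cO d ≫ colimFree D hO cD =
    O.free.map (colimι D cD d) :=
  hO.fac (O.free.mapCocone cD) d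

theorem colimι_unit (d : J) : colimι D cD d ≫ colimUnit D hD cO =
    O.unit.app (D.obj d).carrier ≫ colimFreeι D cO d :=
  hD.ι_map cO (Functor.whiskerLeft (D ⋙ OperadAlgebra.forget O) O.unit) d

theorem Operad.unit_naturality {X Y : C} (f : X ⟶ Y) :
    f ≫ O.unit.app Y = O.unit.app X ≫ O.free.map f :=
  O.unit.naturality f

theorem colimUnit_action : colimUnit D hD cO ≫ colimAction D hO cD = 𝟙 _ := by
  refine hD.hom_ext fun d => ?_
  change colimι D cD d ≫ _ = colimι D cD d ≫ _
  rw [← Category.assoc, colimι_unit, Category.assoc, colimFreeι_action, ← Category.assoc,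
    Operad.unit_action, Category.id_comp, Category.comp_id]

theorem colimUnit_free : colimUnit D hD cO ≫ colimFree D hO cD = O.unit.app cD.pt := by
  refine hD.hom_ext fun d => ?_
  change colimι D cD d ≫ _ = colimι D cD d ≫ _
  rw [← Category.assoc, colimι_unit, Category.assoc, colimFreeι_free]
  exact (O.unit_naturality _).symm

theorem colimReflexion_fst : colimReflexion D cO hD ≫ colimFst D hO cD = 𝟙 _ := by
  refine (O.free.map_comp _ _).symm.trans ?_
  exact (congrArg O.free.map (colimUnit_action D hD hO)).trans (O.free.map_id _)

theorem colimReflexion_snd {a : AlgebraStructure O (O.free.obj cD.pt)}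
    (ha : IsFreeStructure O cD.pt a) :
    colimReflexion D cO hD ≫ colimSnd D hO cD a = 𝟙 _ := by
  rw [colimSnd, ← Category.assoc]
  refine Eq.trans ?_ ha.map_unit_action
  congr 1
  refine (O.free.map_comp _ _).symm.trans ?_
  exact congrArg O.free.map (colimUnit_free D hD hO)

theorem unit_colimFst : O.unit.app cO.pt ≫ colimFst D hO cD =
    colimAction D hO cD ≫ O.unit.app cD.pt :=
  (O.unit_naturality _).symm

theorem unit_colimSnd (a : AlgebraStructure O (O.free.obj cD.pt)) :
    O.unit.app cO.pt ≫ colimSnd D hO cD a = colimFree D hO cD :=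
  O.unit_map_action a _

/-- The coequalizer condition, restricted along the unit to `colim 𝕆 D` and then to one `𝕆 D(d)`. It
says precisely that `D(d) ⟶ K` is compatible with the actions. -/
theorem action_colimι {a : AlgebraStructure O (O.free.obj cD.pt)}
    (k : Cofork (colimFst D hO cD) (colimSnd D hO cD a)) (d : J) :
    (D.obj d).str.action ≫ colimι D cD d ≫ O.unit.app cD.pt ≫ k.π =
      O.free.map (colimι D cD d) ≫ k.π := by
  have := (O.unit.app cO.pt) ≫= k.condition
  rw [← Category.assoc, ← Category.assoc, unit_colimFst, unit_colimSnd, Category.assoc] at this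
  rw [← Category.assoc, ← colimFreeι_action D hO, Category.assoc, this, ← Category.assoc,
    colimFreeι_free]

variable {a : AlgebraStructure O (O.free.obj cD.pt)}
  {a' : AlgebraStructure O (O.free.obj cO.pt)}

theorem isAlgebraHom_colimFst (ha : IsFreeStructure O cD.pt a) (ha' : IsFreeStructure O cO.pt a') :
    IsAlgebraHom a' a (colimFst D hO cD) :=
  ha'.isAlgebraHom_map ha _

theorem isAlgebraHom_colimSnd (ha' : IsFreeStructure O cO.pt a') :
    IsAlgebraHom a' a (colimSnd D hO cD a) := by
  -- The second arrow factors through `𝕆 𝕆 (colim D)`, which needs its own free structure so that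
  -- both factors are maps of algebras.
  obtain ⟨a'', h⟩ := exists_freeStructure O (O.free.obj cD.pt)
  exact (ha'.isAlgebraHom_map h _).comp (h.isAlgebraHom_action a)

theorem isAlgebraHom_colimι (ha : IsFreeStructure O cD.pt a)
    {k : Cofork (colimFst D hO cD) (colimSnd D hO cD a)} {b : AlgebraStructure O k.pt}
    (hb : IsAlgebraHom a b k.π) (d : J) :
    IsAlgebraHom (D.obj d).str b (colimι D cD d ≫ O.unit.app cD.pt ≫ k.π) := by
  refine isAlgebraHom_iff.2 fun g t => ?_
  rw [← AlgebraStructure.action_inj, ← comp_app, action_colimι, comp_app, O.free_map_inj,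
    ha.hom_inj hb, Term.map_map]
  simp only [comp_app]

/-- A cocone with vertex `S` gives a morphism `colim D ⟶ S`, hence a map of algebras `𝕆 (colim D) ⟶
S`. It coequalizes the pair because the cocone consists of maps of algebras, and it is unique
because it is determined on `colim D`. -/
theorem exists_colimit_structure (hD : IsColimit cD) (ha : IsFreeStructure O cD.pt a)
    (ha' : IsFreeStructure O cO.pt a')
    (k : Cofork (colimFst D hO cD) (colimSnd D hO cD a)) (hk : IsColimit k) :
    ∃ b : AlgebraStructure O k.pt,
      IsAlgebraHom a b k.π ∧
      (∀ b' : AlgebraStructure O k.pt, IsAlgebraHom a b' k.π → b' = b) ∧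
      (∃ (p q : (⟨O.free.obj cO.pt, a'⟩ : OperadAlgebra O) ⟶ ⟨O.free.obj cD.pt, a⟩)
        (r : (⟨O.free.obj cD.pt, a⟩ : OperadAlgebra O) ⟶ ⟨k.pt, b⟩) (hr : p ≫ r = q ≫ r),
        p.hom = colimFst D hO cD ∧ q.hom = colimSnd D hO cD a ∧ r.hom = k.π ∧
        Nonempty (IsColimit (Cofork.ofπ r hr))) ∧
      ∃ h : ∀ d, IsAlgebraHom (D.obj d).str b
          ((cD.extend (O.unit.app cD.pt ≫ k.π)).ι.app d),
        Nonempty (IsColimit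
          (OperadAlgebra.coconeOf D (cD.extend (O.unit.app cD.pt ≫ k.π)) b h)) := by
  have h₁ := isAlgebraHom_colimFst D hO ha ha'
  have h₂ := isAlgebraHom_colimSnd D hO (a := a) ha'
  obtain ⟨b, hb⟩ := exists_coequalizer_structure h₁ h₂ (colimReflexion_fst D hD hO)
    (colimReflexion_snd D hD hO ha) hk
  refine ⟨b, hb, fun b' hb' => hb.coequalizer_unique hk hb',
    ⟨⟨_, h₁⟩, ⟨_, h₂⟩, ⟨_, hb⟩, OperadAlgebra.hom_ext _ _ k.condition, rfl, rfl, rfl,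
      ⟨OperadAlgebra.isColimitCofork (B := ⟨O.free.obj cD.pt, a⟩)
        (p := (⟨_, h₁⟩ : OperadAlgebra.Hom ⟨O.free.obj cO.pt, a'⟩ ⟨O.free.obj cD.pt, a⟩))
        (q := (⟨_, h₂⟩ : OperadAlgebra.Hom ⟨O.free.obj cO.pt, a'⟩ ⟨O.free.obj cD.pt, a⟩))
        hk b hb _ rfl⟩⟩,
    isAlgebraHom_colimι D hO ha hb, ⟨?_⟩⟩
  have H : ∀ s : Cocone D, ∃ f : k.pt ⟶ s.pt.carrier, IsAlgebraHom b s.pt.str f ∧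
      (∀ d, colimι D cD d ≫ O.unit.app cD.pt ≫ k.π ≫ f = (s.ι.app d).hom) ∧
      ∀ f' : k.pt ⟶ s.pt.carrier, IsAlgebraHom b s.pt.str f' →
        (∀ d, colimι D cD d ≫ O.unit.app cD.pt ≫ k.π ≫ f' = (s.ι.app d).hom) → f' = f := by
    intro s
    obtain ⟨h, hh⟩ : ∃ h : cD.pt ⟶ s.pt.carrier, ∀ d, colimι D cD d ≫ h = (s.ι.app d).hom :=
      ⟨hD.desc ((OperadAlgebra.forget O).mapCocone s), hD.fac _⟩
    have hF : IsAlgebraHom a s.pt.str (O.free.map h ≫ s.pt.str.action) := by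
      obtain ⟨a'', h''⟩ := exists_freeStructure O s.pt.carrier
      exact (ha.isAlgebraHom_map h'' _).comp (h''.isAlgebraHom_action _)
    -- Both sides are maps of algebras out of a free algebra, so it is enough to compare them on
    -- each `𝕆 D(d)`. There the equality is the compatibility of the cocone with the actions.
    have e : colimFst D hO cD ≫ O.free.map h ≫ s.pt.str.action =
        colimSnd D hO cD a ≫ O.free.map h ≫ s.pt.str.action := by
      refine ha'.hom_ext (h₁.comp hF) (h₂.comp hF) ?_
      rw [← Category.assoc, ← Category.assoc (O.unit.app cO.pt), unit_colimFst, unit_colimSnd,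
        Category.assoc, O.unit_map_action]
      refine hO.hom_ext fun d => ?_
      change colimFreeι D cO d ≫ _ = colimFreeι D cO d ≫ _
      rw [← Category.assoc, colimFreeι_action, ← Category.assoc, colimFreeι_free, Category.assoc,
        hh, ← Category.assoc, ← Functor.map_comp, hh]
      exact ((OperadAlgebra.action O).naturality (s.ι.app d)).symm
    have hπ : k.π ≫ Cofork.IsColimit.desc hk _ e = O.free.map h ≫ s.pt.str.action :=
      Cofork.IsColimit.π_desc' hk _ e
    refine ⟨Cofork.IsColimit.desc hk _ e, hb.of_coequalizer hk (by rw [hπ]; exact hF), fun d => ?_,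
      fun f' hf' h' => Cofork.IsColimit.hom_ext hk ?_⟩
    · rw [hπ, O.unit_map_action, hh]
    · rw [hπ]
      refine ha.hom_ext (hb.comp hf') hF ?_
      rw [O.unit_map_action]
      exact hD.hom_ext fun d => (h' d).trans (hh d).symm
  choose f hf hf' huniq using H
  have e : ∀ {Z : C} (φ : k.pt ⟶ Z) (d : J), (colimι D cD d ≫ O.unit.app cD.pt ≫ k.π) ≫ φ =
      colimι D cD d ≫ O.unit.app cD.pt ≫ k.π ≫ φ := fun φ d => by simp only [Category.assoc]
  exact
    { desc := fun s => ⟨f s, hf s⟩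
      fac := fun s d => OperadAlgebra.hom_ext _ _ ((e _ d).trans (hf' s d))
      uniq := fun s f' hh => OperadAlgebra.hom_ext _ _ (huniq s f'.hom f'.isAlgebraHom fun d =>
        (e _ d).symm.trans (congrArg OperadAlgebra.Hom.hom (hh d))) }

end ColimitsOfAlgebras

/-! ### Formal operations with two kinds of inputs -/

section SplitTerms

variable {C : Type u} [Category.{v} C] [MonoidalCategory C] [SymmetricCategory C]

open Elem

variable {O : Operad C} {Λ : Type} {g : Λ → C} {V V' W W' : Type*}

theorem sum_lt_one {m : ℕ} (k : Fin m) : (∑ k', if k' < k then 1 else 0) = (k : ℕ) := by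
  rw [Finset.sum_boole, Finset.filter_gt_eq_Iio, Fin.card_Iio]
  rfl

theorem finSigmaFinEquiv_append_left {l m : ℕ} (j : Fin l → ℕ) (i : Fin l)
    (s : Fin (Fin.append j (fun _ : Fin m => 1) (Fin.castAdd m i))) :
    Fin.cast (sum_append_right m j) (finSigmaFinEquiv ⟨Fin.castAdd m i, s⟩) =
      Fin.castAdd m (finSigmaFinEquiv ⟨i, Fin.cast (Fin.append_left _ _ _) s⟩) := by
  ext
  have h₁ : ∀ i', Fin.castAdd m i' < Fin.castAdd m i ↔ i' < i := fun _ => Iff.rfl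
  have h₂ : ∀ k, ¬ Fin.natAdd l k < Fin.castAdd m i := fun k h => by
    have := Fin.lt_def.1 h
    simp at this
    omega
  simp only [Fin.val_cast, finSigmaFinEquiv_val, Fin.sum_univ_add, Fin.val_castAdd, h₁, h₂,
    Fin.append_left, if_false, Finset.sum_const_zero, add_zero]

theorem finSigmaFinEquiv_append_right {l m : ℕ} (j : Fin l → ℕ) (k : Fin m)
    (s : Fin (Fin.append j (fun _ : Fin m => 1) (Fin.natAdd l k))) :
    Fin.cast (sum_append_right m j) (finSigmaFinEquiv ⟨Fin.natAdd l k, s⟩) =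
      Fin.natAdd (∑ i, j i) k := by
  ext
  have h₁ : ∀ i', Fin.castAdd m i' < Fin.natAdd l k := fun i => Fin.lt_def.2 (by simp; omega)
  have h₂ : ∀ k', Fin.natAdd l k' < Fin.natAdd l k ↔ k' < k := fun k' =>
    Fin.lt_def.trans (by simp)
  simp only [Fin.val_cast, finSigmaFinEquiv_val, Fin.sum_univ_add, Fin.val_natAdd, h₁, h₂,
    Fin.append_left, Fin.append_right, if_true, sum_lt_one]
  have := s.2
  simp only [Fin.append_right] at this
  simp
  omega

theorem Operad.compFirst_app {l m : ℕ} (j : Fin l → ℕ) (x : Elem g (O.obj (l + m)))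
    (y : ∀ i, Elem g (O.obj (j i)))
    (Y : ∀ t, Elem g (O.obj (Fin.append j (fun _ : Fin m => 1) t)))
    (h₁ : ∀ i, Y (Fin.castAdd m i) =
      eqToHom (congrArg O.obj (Fin.append_left j (fun _ => 1) i).symm) ∙ y i)
    (h₂ : ∀ k, Y (Fin.natAdd l k) =
      eqToHom (congrArg O.obj (Fin.append_right j (fun _ => 1) k).symm) ∙ O.one ∙ Elem.one) :
    O.compFirst m j ∙ (x ⊠ tf y) =
      eqToHom (congrArg O.obj (sum_append_right m j)) ∙ O.comp _ ∙ (x ⊠ tf Y) := by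
  have e := tensorFinConcat_app Y
  simp only [h₁, h₂] at e
  simp only [compFirst, comp_app, whiskerLeft_app, rightUnitor_inv_app, hom_app, tensorFinMap_app,
    tensorListUnits_app]
  rw [← e]
  rfl

theorem Term.pure_eq_mk {n : ℕ} (h : 1 = n) (h' : O.obj 1 = O.obj n) (b : V) :
    (Term.pure b : Term O g V) = .mk (eqToHom h' ∙ O.one ∙ Elem.one) fun _ => b := by
  subst h
  rw [eqToHom_refl, id_app]
  rfl

/-- Inserting units into the last inputs is substitution of `Term.pure`, so the partial composition
of the operad is an instance of the monad multiplication. -/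
theorem Term.mk_compFirst {l m : ℕ} (j : Fin l → ℕ) (x : Elem g (O.obj (l + m)))
    (y : ∀ i, Elem g (O.obj (j i))) (w : ∀ i, Fin (j i) → V) (u : Fin m → V) :
    (Term.mk (O.compFirst m j ∙ (x ⊠ tf y)) (Fin.append (flat w) u) : Term O g V) =
      (Term.mk x (Fin.append (fun i => Term.mk (y i) (w i)) fun k => Term.pure (u k))).bind id := by
  -- The arity at `t` reduces to `j i` or to `1` only after a case distinction, so the family is
  -- defined by cases with transports.
  let Y : ∀ t, Elem g (O.obj (Fin.append j (fun _ : Fin m => 1) t)) := Fin.addCases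
    (fun i => eqToHom (congrArg O.obj (Fin.append_left j (fun _ => 1) i).symm) ∙ y i)
    (fun k => eqToHom (congrArg O.obj (Fin.append_right j (fun _ => 1) k).symm) ∙ O.one ∙ Elem.one)
  have hY₁ : ∀ i, Y (Fin.castAdd m i) = _ := fun i => Fin.addCases_left i
  have hY₂ : ∀ k, Y (Fin.natAdd l k) = _ := fun i => Fin.addCases_right i
  let U : ∀ t, Fin (Fin.append j (fun _ : Fin m => 1) t) → V := Fin.addCases
    (fun i s => w i (Fin.cast (Fin.append_left _ _ _) s)) (fun k _ => u k)
  have hU₁ : ∀ i, U (Fin.castAdd m i) = _ := fun i => Fin.addCases_left i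
  have hU₂ : ∀ k, U (Fin.natAdd l k) = _ := fun i => Fin.addCases_right i
  have e : (Term.mk x (Fin.append (fun i => Term.mk (y i) (w i)) fun k => Term.pure (u k))).bind id
      = Term.comp x Y U := by
    refine Term.bind_mk _ _ _ _ _ fun t => ?_
    induction t using Fin.addCases with
    | left i =>
      rw [Fin.append_left, hY₁, hU₁, mk_eqToHom (Fin.append_left _ _ _).symm]
      rfl
    | right k =>
      rw [Fin.append_right, hY₂, hU₂]
      exact Term.pure_eq_mk (Fin.append_right j (fun _ => 1) k).symm _ _
  rw [e, O.compFirst_app j x y Y hY₁ hY₂, mk_eqToHom (sum_append_right m j), Term.comp]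
  congr 1
  funext t
  obtain ⟨⟨i, s⟩, rfl⟩ := finSigmaFinEquiv.surjective t
  rw [flat_apply, Function.comp]
  induction i using Fin.addCases with
  | left i => rw [finSigmaFinEquiv_append_left, Fin.append_left, flat_apply, hU₁]
  | right k => rw [finSigmaFinEquiv_append_right, Fin.append_right, hU₂]

theorem finSigmaFinEquiv_append_left' {l m : ℕ} (j : Fin m → ℕ) (i : Fin l)
    (s : Fin (Fin.append (fun _ : Fin l => 1) j (Fin.castAdd m i))) :
    Fin.cast (sum_append_left l j) (finSigmaFinEquiv ⟨Fin.castAdd m i, s⟩) =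
      Fin.castAdd (∑ i, j i) i := by
  ext
  have h₁ : ∀ i', Fin.castAdd m i' < Fin.castAdd m i ↔ i' < i := fun _ => Iff.rfl
  have h₂ : ∀ k, ¬ Fin.natAdd l k < Fin.castAdd m i := fun k h => by
    have := Fin.lt_def.1 h
    simp at this
    omega
  simp only [Fin.val_cast, finSigmaFinEquiv_val, Fin.sum_univ_add, Fin.val_castAdd, h₁, h₂,
    Fin.append_left, if_false, Finset.sum_const_zero, add_zero, sum_lt_one]
  have := s.2
  simp only [Fin.append_left] at this
  simp
  omega

theorem finSigmaFinEquiv_append_right' {l m : ℕ} (j : Fin m → ℕ) (k : Fin m)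
    (s : Fin (Fin.append (fun _ : Fin l => 1) j (Fin.natAdd l k))) :
    Fin.cast (sum_append_left l j) (finSigmaFinEquiv ⟨Fin.natAdd l k, s⟩) =
      Fin.natAdd l (finSigmaFinEquiv ⟨k, Fin.cast (Fin.append_right _ _ _) s⟩) := by
  ext
  have h₁ : ∀ i', Fin.castAdd m i' < Fin.natAdd l k := fun i => Fin.lt_def.2 (by simp; omega)
  have h₂ : ∀ k', Fin.natAdd l k' < Fin.natAdd l k ↔ k' < k := fun k' =>
    Fin.lt_def.trans (by simp)
  simp only [Fin.val_cast, finSigmaFinEquiv_val, Fin.sum_univ_add, Fin.val_natAdd, h₁, h₂,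
    Fin.append_left, Fin.append_right, if_true]
  simp
  omega

theorem Operad.compLast_app {l m : ℕ} (j : Fin m → ℕ) (x : Elem g (O.obj (l + m)))
    (y : ∀ i, Elem g (O.obj (j i)))
    (Y : ∀ t, Elem g (O.obj (Fin.append (fun _ : Fin l => 1) j t)))
    (h₁ : ∀ k, Y (Fin.castAdd m k) =
      eqToHom (congrArg O.obj (Fin.append_left (fun _ => 1) j k).symm) ∙ O.one ∙ Elem.one)
    (h₂ : ∀ i, Y (Fin.natAdd l i) =
      eqToHom (congrArg O.obj (Fin.append_right (fun _ => 1) j i).symm) ∙ y i) :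
    O.compLast l j ∙ (x ⊠ tf y) =
      eqToHom (congrArg O.obj (sum_append_left l j)) ∙ O.comp _ ∙ (x ⊠ tf Y) := by
  have e := tensorFinConcat_app Y
  simp only [h₁, h₂] at e
  simp only [compLast, comp_app, whiskerLeft_app, leftUnitor_inv_app, hom_app, tensorFinMap_app,
    tensorListUnits_app]
  rw [← e]
  rfl

theorem Term.mk_compLast {l m : ℕ} (j : Fin m → ℕ) (x : Elem g (O.obj (l + m)))
    (y : ∀ i, Elem g (O.obj (j i))) (u : Fin l → V) (w : ∀ i, Fin (j i) → V) :
    (Term.mk (O.compLast l j ∙ (x ⊠ tf y)) (Fin.append u (flat w)) : Term O g V) =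
      (Term.mk x (Fin.append (fun k => Term.pure (u k)) fun i => Term.mk (y i) (w i))).bind id := by
  let Y : ∀ t, Elem g (O.obj (Fin.append (fun _ : Fin l => 1) j t)) := Fin.addCases
    (fun k => eqToHom (congrArg O.obj (Fin.append_left (fun _ => 1) j k).symm) ∙ O.one ∙ Elem.one)
    (fun i => eqToHom (congrArg O.obj (Fin.append_right (fun _ => 1) j i).symm) ∙ y i)
  have hY₁ : ∀ i, Y (Fin.castAdd m i) = _ := fun i => Fin.addCases_left i
  have hY₂ : ∀ k, Y (Fin.natAdd l k) = _ := fun i => Fin.addCases_right i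
  let U : ∀ t, Fin (Fin.append (fun _ : Fin l => 1) j t) → V := Fin.addCases
    (fun k _ => u k) (fun i s => w i (Fin.cast (Fin.append_right _ _ _) s))
  have hU₁ : ∀ i, U (Fin.castAdd m i) = _ := fun i => Fin.addCases_left i
  have hU₂ : ∀ k, U (Fin.natAdd l k) = _ := fun i => Fin.addCases_right i
  have e : (Term.mk x (Fin.append (fun k => Term.pure (u k)) fun i => Term.mk (y i) (w i))).bind id
      = Term.comp x Y U := by
    refine Term.bind_mk _ _ _ _ _ fun t => ?_
    induction t using Fin.addCases with
    | left i =>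
      rw [Fin.append_left, hY₁, hU₁]
      exact Term.pure_eq_mk (Fin.append_left (fun _ => 1) j i).symm _ _
    | right k =>
      rw [Fin.append_right, hY₂, hU₂, mk_eqToHom (Fin.append_right _ _ _).symm]
      rfl
  rw [e, O.compLast_app j x y Y hY₁ hY₂, mk_eqToHom (sum_append_left l j), Term.comp]
  congr 1
  funext t
  obtain ⟨⟨i, s⟩, rfl⟩ := finSigmaFinEquiv.surjective t
  rw [flat_apply, Function.comp]
  induction i using Fin.addCases with
  | left i => rw [finSigmaFinEquiv_append_left', Fin.append_left, hU₁]
  | right k => rw [finSigmaFinEquiv_append_right', Fin.append_right, flat_apply, hU₂]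

/-- The formal operation whose first inputs are `a` and whose last inputs are `z`. -/
def Term.split {l m : ℕ} (x : Elem g (O.obj (l + m))) (a : Fin l → V) (z : Fin m → W) :
    Term O g (V ⊕ W) :=
  .mk x (Fin.append (fun i => .inl (a i)) fun i => .inr (z i))

theorem append_comp {l m : ℕ} (f : V → W) (a : Fin l → V) (b : Fin m → V) :
    f ∘ Fin.append a b = Fin.append (fun i => f (a i)) fun i => f (b i) := by
  funext t
  induction t using Fin.addCases <;> simp

theorem Term.map_split {l m : ℕ} (x : Elem g (O.obj (l + m))) (a : Fin l → V) (z : Fin m → W)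
    (f : V ⊕ W → V') :
    (Term.split x a z).map f =
      .mk x (Fin.append (fun i => f (.inl (a i))) fun i => f (.inr (z i))) := by
  rw [Term.split, Term.map_mk, append_comp]

theorem Term.map_split_map {l m : ℕ} (x : Elem g (O.obj (l + m))) (a : Fin l → V) (z : Fin m → W)
    (f : V → V') (h : W → W') :
    (Term.split x a z).map (Sum.map f h) = Term.split x (fun i => f (a i)) fun i => h (z i) :=
  Term.map_split _ _ _ _

/-- A sum of bijections. -/
def sumEquiv {l m l' m' : ℕ} (e : Fin l ≃ Fin l') (e' : Fin m ≃ Fin m') :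
    Fin (l + m) ≃ Fin (l' + m') :=
  finSumFinEquiv.symm.trans ((Equiv.sumCongr e e').trans finSumFinEquiv)

theorem sumEquiv_castAdd {l m l' m' : ℕ} (e : Fin l ≃ Fin l') (e' : Fin m ≃ Fin m') (i : Fin l) :
    sumEquiv e e' (Fin.castAdd m i) = Fin.castAdd m' (e i) := by
  simp [sumEquiv]

theorem sumEquiv_natAdd {l m l' m' : ℕ} (e : Fin l ≃ Fin l') (e' : Fin m ≃ Fin m') (i : Fin m) :
    sumEquiv e e' (Fin.natAdd l i) = Fin.natAdd l' (e' i) := by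
  simp [sumEquiv]

theorem append_comp_sumEquiv {l m l' m' : ℕ} (e : Fin l ≃ Fin l') (e' : Fin m ≃ Fin m')
    (a : Fin l' → V) (b : Fin m' → V) :
    Fin.append a b ∘ sumEquiv e e' = Fin.append (fun i => a (e i)) fun i => b (e' i) := by
  funext t
  induction t using Fin.addCases <;> simp [sumEquiv_castAdd, sumEquiv_natAdd]

theorem exists_sumEquiv {l m l' m' : ℕ} (e : Fin (l + m) ≃ Fin (l' + m'))
    (h : ∀ t : Fin (l + m), (t : ℕ) < l ↔ (e t : ℕ) < l') :
    ∃ (e₁ : Fin l ≃ Fin l') (e₂ : Fin m ≃ Fin m'), e = sumEquiv e₁ e₂ := by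
  have h₁ : ∀ i : Fin l, ∃ i', e (Fin.castAdd m i) = Fin.castAdd m' i' := fun i =>
    ⟨⟨e (Fin.castAdd m i), (h _).1 i.2⟩, rfl⟩
  have h₂ : ∀ i : Fin m, ∃ i', e (Fin.natAdd l i) = Fin.natAdd l' i' := fun i => by
    have := (h (Fin.natAdd l i)).not.1 (by simp)
    refine ⟨⟨e (Fin.natAdd l i) - l', by have := (e (Fin.natAdd l i)).2; omega⟩, Fin.ext ?_⟩
    simp
    omega
  have h₁' : ∀ i : Fin l', ∃ i', e (Fin.castAdd m i') = Fin.castAdd m' i := fun i => by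
    have := (h (e.symm (Fin.castAdd m' i))).2 (by simp)
    exact ⟨⟨_, this⟩, e.apply_symm_apply _⟩
  have h₂' : ∀ i : Fin m', ∃ i', e (Fin.natAdd l i') = Fin.natAdd l' i := fun i => by
    have := (h (e.symm (Fin.natAdd l' i))).not.2 (by simp)
    refine ⟨⟨e.symm (Fin.natAdd l' i) - l, by
      have := (e.symm (Fin.natAdd l' i)).2; omega⟩, ?_⟩
    rw [← e.eq_symm_apply]
    ext
    simp
    omega
  choose f₁ hf₁ using h₁
  choose f₂ hf₂ using h₂
  have b₁ : Function.Bijective f₁ := by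
    refine ⟨fun i i' hi => ?_, fun i => ?_⟩
    · exact Fin.castAdd_injective _ _ (e.injective ((hf₁ i).trans (by rw [hi, ← hf₁])))
    · obtain ⟨i', hi⟩ := h₁' i
      exact ⟨i', Fin.castAdd_injective _ _ ((hf₁ i').symm.trans hi)⟩
  have b₂ : Function.Bijective f₂ := by
    refine ⟨fun i i' hi => ?_, fun i => ?_⟩
    · exact Fin.natAdd_injective _ _ (e.injective ((hf₂ i).trans (by rw [hi, ← hf₂])))
    · obtain ⟨i', hi⟩ := h₂' i
      exact ⟨i', Fin.natAdd_injective _ _ ((hf₂ i').symm.trans hi)⟩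
  refine ⟨Equiv.ofBijective f₁ b₁, Equiv.ofBijective f₂ b₂, Equiv.ext fun t => ?_⟩
  induction t using Fin.addCases with
  | left i => rw [sumEquiv_castAdd, hf₁]; rfl
  | right i => rw [sumEquiv_natAdd, hf₂]; rfl

/-- The tags `Sum.inl` and `Sum.inr` distinguish the two kinds of inputs. A bijection that matches
the inputs therefore preserves the initial block and is a sum of two bijections. -/
theorem Term.split_eq_split {l m l' m' : ℕ} {x : Elem g (O.obj (l + m))} {a : Fin l → V}
    {z : Fin m → W} {x' : Elem g (O.obj (l' + m'))} {a' : Fin l' → V} {z' : Fin m' → W} :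
    Term.split x a z = Term.split x' a' z' ↔ ∃ (e₁ : Fin l ≃ Fin l') (e₂ : Fin m ≃ Fin m'),
      x = O.actEquiv (sumEquiv e₁ e₂) ∙ x' ∧ a = a' ∘ e₁ ∧ z = z' ∘ e₂ := by
  rw [Term.split, Term.split, Term.mk_eq_mk]
  constructor
  · rintro ⟨e, hx, hv⟩
    have key : ∀ {l m : ℕ} (a : Fin l → V) (z : Fin m → W) (t : Fin (l + m)), (t : ℕ) < l ↔
        (Fin.append (fun i => (Sum.inl (a i) : V ⊕ W)) (fun i => .inr (z i)) t).isLeft := by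
      intro l m a z t
      induction t using Fin.addCases <;> simp
    obtain ⟨e₁, e₂, rfl⟩ := exists_sumEquiv e fun t => by
      rw [key a z, key a' z', hv]
      rfl
    rw [append_comp_sumEquiv] at hv
    refine ⟨e₁, e₂, hx, funext fun i => ?_, funext fun i => ?_⟩
    · simpa using congrFun hv (Fin.castAdd m i)
    · simpa using congrFun hv (Fin.natAdd l i)
  · rintro ⟨e₁, e₂, hx, rfl, rfl⟩
    exact ⟨_, hx, (append_comp_sumEquiv (V := V ⊕ W) e₁ e₂ (fun i => .inl (a' i)) fun i => .inr (z' i)).symm⟩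

/-- Relabelling inputs does not affect the operation, so any presentation of the image with first
inputs split off lifts to `T` itself, with the same `x` and `z`. -/
theorem Term.map_eq_split {l m : ℕ} {x : Elem g (O.obj (l + m))} {a : Fin l → V'} {z : Fin m → W}
    {f : V → V'} {T : Term O g (V ⊕ W)} (h : T.map (Sum.map f id) = Term.split x a z) :
    ∃ τ : Fin l → V, T = Term.split x τ z ∧ a = fun i => f (τ i) := by
  obtain ⟨n, x₀, v, rfl⟩ := T.exists_rep
  rw [Term.map_mk, Term.split, Term.mk_eq_mk] at h
  obtain ⟨e, rfl, hv⟩ := h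
  have hv' : ∀ t, Sum.map f id (v (e.symm t)) =
      Fin.append (fun i => Sum.inl (a i)) (fun i => Sum.inr (z i)) t := fun t => by
    simpa using congrFun hv (e.symm t)
  have h₁ : ∀ i, ∃ τ, v (e.symm (Fin.castAdd m i)) = .inl τ ∧ a i = f τ := fun i => by
    have := hv' (Fin.castAdd m i)
    rw [Fin.append_left] at this
    cases h : v (e.symm (Fin.castAdd m i)) with
    | inl τ =>
      rw [h] at this
      exact ⟨τ, rfl, (Sum.inl_injective this).symm⟩
    | inr k =>
      rw [h] at this
      exact absurd this Sum.inr_ne_inl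
  have h₂ : ∀ i, v (e.symm (Fin.natAdd l i)) = .inr (z i) := fun i => by
    have := hv' (Fin.natAdd l i)
    rw [Fin.append_right] at this
    cases h : v (e.symm (Fin.natAdd l i)) with
    | inl τ =>
      rw [h] at this
      exact absurd this Sum.inl_ne_inr
    | inr k =>
      rw [h] at this
      exact congrArg _ (Sum.inr_injective this)
  choose τ hτ hf using h₁
  refine ⟨τ, ?_, funext hf⟩
  rw [Term.mk_actEquiv, Term.split]
  congr 1
  funext t
  induction t using Fin.addCases with
  | left i => rw [Fin.append_left]; exact hτ i
  | right i => rw [Fin.append_right]; exact h₂ i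

theorem Term.mk_bind {n : ℕ} (x : Elem g (O.obj n)) (v : Fin n → V) (f : V → Term O g W) :
    (Term.mk x v).bind f = (Term.mk x (f ∘ v)).bind id := by
  rw [← Term.map_mk, Term.map_bind]
  rfl

/-- Substitution into the inputs of the first kind. -/
def Term.join (T : Term O g (Term O g V ⊕ W)) : Term O g (V ⊕ W) :=
  T.bind (Sum.elim (fun t => t.map .inl) fun b => .pure (.inr b))

/-- Translates the first arrow of the coequalizer defining `U(m)` into flattening of the inputs of
the first kind. -/
theorem Term.join_split {l m : ℕ} {j : Fin l → ℕ} (x : Elem g (O.obj (l + m)))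
    (y : ∀ i, Elem g (O.obj (j i))) (w : ∀ i, Fin (j i) → V) (z : Fin m → W) :
    (Term.split x (fun i => Term.mk (y i) (w i)) z).join =
      Term.split (O.compFirst m j ∙ (x ⊠ tf y)) (flat w) z := by
  have h := Term.mk_compFirst j x y (fun i k => (.inl (w i k) : V ⊕ W)) fun i => .inr (z i)
  refine Eq.trans ?_ h.symm
  rw [Term.join, Term.split, Term.mk_bind, append_comp]
  simp only [Sum.elim_inl, Sum.elim_inr, Term.map_mk]
  rfl

end SplitTerms

/-! ### The objects of the enveloping operad -/

section EnvelopingObjects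

variable {C : Type u} [Category.{v} C] [MonoidalCategory C] [SymmetricCategory C]
  [HasCountableColimits C]

open Elem

variable {O : Operad C} {X : C} {Λ : Type} {g : Λ → C} {m : ℕ}

/-- The element of `∐_ℓ O(ℓ + m) ⊗_{Σ_ℓ} X^(ℓ)` given by an operation and its first inputs. -/
def Operad.shiftGen (O : Operad C) {X : C} {l m : ℕ} (x : Elem g (O.obj (l + m)))
    (a : Fin l → Elem g X) : Elem g ((O.shift m).schur.obj X) :=
  (O.shift m).ι l X ∙ (x ⊠ tf a)

/-- The formal operation given by an operation and its first inputs. -/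
def Term.partialApp {V : Type*} {l : ℕ} (x : Elem g (O.obj (l + m))) (a : Fin l → V) :
    Term O g (V ⊕ Fin m) :=
  Term.split x a fun i => i

theorem sumEquiv_refl_right {l l' m : ℕ} (e : Fin l ≃ Fin l') (x : Elem g (O.obj (l' + m))) :
    O.actEquiv (sumEquiv e (Equiv.refl (Fin m))) ∙ x = (O.shift m).actEquiv e ∙ x := by
  obtain rfl := Fin.equiv_iff_eq.1 ⟨e⟩
  rw [SymmetricSequence.actEquiv_perm, SymmetricSequence.actEquiv_perm]
  rfl

theorem Operad.shiftGen_congr {l l' : ℕ} {x : Elem g (O.obj (l + m))} {a : Fin l → Elem g X}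
    {x' : Elem g (O.obj (l' + m))} {a' : Fin l' → Elem g X}
    (h : Term.partialApp x a = Term.partialApp x' a') : O.shiftGen x a = O.shiftGen x' a' := by
  obtain ⟨e₁, e₂, rfl, rfl, h'⟩ := Term.split_eq_split.1 h
  -- The last inputs are labelled by their own positions, so only permutations of the first inputs
  -- remain, and these are divided out in the coinvariants.
  obtain rfl : e₂ = Equiv.refl _ := Equiv.ext fun i => (congrFun h' i).symm
  rw [sumEquiv_refl_right]
  exact (O.shift m).app_actEquiv (φ := fun l => (O.shift m).ι l X)
    (fun l σ => (O.shift m).diagonalAct_incl l X σ) e₁ x' a'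

theorem Term.partialApp_act {V : Type*} {l : ℕ} (σ : Equiv.Perm (Fin l))
    (x : Elem g (O.obj (l + m))) (a : Fin l → V) :
    Term.partialApp ((O.shift m).act σ⁻¹ ∙ x) (a ∘ σ.symm) = Term.partialApp x a :=
  Term.split_eq_split.2 ⟨σ.symm, Equiv.refl _, by
    rw [sumEquiv_refl_right, SymmetricSequence.actEquiv_perm]
    rfl, rfl, rfl⟩

variable [TensorPreservesCountableColimits C]

/-- On terms the arrow is `Term.join`, which does not see the representatives of the inputs from `𝕆
X` or permutations of the first inputs. This gives the descent both to `(𝕆 X)^(l)` and to the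
coinvariants. -/
theorem Operad.exists_shift_mult (O : Operad C) (X : C) (m : ℕ) :
    ∃ M : (O.shift m).schur.obj (O.free.obj X) ⟶ (O.shift m).schur.obj X,
      ∀ {Λ : Type} {g : Λ → C} {l : ℕ} (j : Fin l → ℕ) (x : Elem g (O.obj (l + m)))
        (y : ∀ i, Elem g (O.obj (j i))) (w : ∀ i, Fin (j i) → Elem g X),
        M ∙ O.shiftGen x (fun i => O.inj (.mk (y i) (w i))) =
          O.shiftGen (O.compFirst m j ∙ (x ⊠ tf y)) (flat w) := by
  let φ (l : ℕ) (j : Fin l → ℕ) : (O.obj (l + m) ⊗ tensorFin fun i => O.obj (j i) ⊗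
      tensorPow X (j i)) ⟶ (O.shift m).schur.obj X :=
    (O.obj (l + m) ◁ tensorFinUnshuffle j (fun i => O.obj (j i)) fun _ => X) ≫
      (α_ _ _ _).inv ≫ (O.compFirst m j ▷ _) ≫ (O.shift m).ι _ X
  have φ_app : ∀ {Λ : Type} {g : Λ → C} {l : ℕ} (j : Fin l → ℕ) (x : Elem g (O.obj (l + m)))
      (y : ∀ i, Elem g (O.obj (j i))) (w : ∀ i, Fin (j i) → Elem g X),
      φ l j ∙ (x ⊠ tf (f := fun i => O.obj (j i) ⊗ tensorPow X (j i))
        fun i => y i ⊠ tf (w i)) = O.shiftGen (O.compFirst m j ∙ (x ⊠ tf y)) (flat w) := by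
    intro Λ g l j x y w
    simp only [φ, comp_app, whiskerLeft_app, tensorFinUnshuffle_pow_app, associator_inv_app,
      whiskerRight_app]
    rfl
  have h := fun l => Pres.IsValid.exists_hom_tens_fin (Pres.isValid_ofShape (.leaf (O.obj (l + m))))
    (p := fun _ : Fin l => Pres.schur O.toSymmetricSequence X)
    (fun _ => Pres.isValid_schur _ _) (Pres.respects_ofShape _) (fun _ => Pres.respects_schur O X)
    (fun _ (j : Fin l → ℕ) => φ l j) (by
      intro Λ g _ _ (j : Fin l → ℕ) (j' : Fin l → ℕ) (x : Elem g (O.obj (l + m)))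
        (x' : Elem g (O.obj (l + m))) (y : ∀ i, Elem g (O.obj (j i)) × (Fin (j i) → Elem g X))
        (y' : ∀ i, Elem g (O.obj (j' i)) × (Fin (j' i) → Elem g X)) hx hy
      obtain rfl : x = x' := hx
      refine (φ_app j x (fun i => (y i).1) fun i => (y i).2).trans
        (Eq.trans ?_ (φ_app j' x (fun i => (y' i).1) fun i => (y' i).2).symm)
      refine Operad.shiftGen_congr ?_
      rw [Term.partialApp, Term.partialApp, ← Term.join_split, ← Term.join_split]
      exact congrArg (fun τ => (Term.split x τ fun i => i).join) (funext hy))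
  choose ξ hξ using h
  have key : ∀ {Λ : Type} {g : Λ → C} {l : ℕ} (j : Fin l → ℕ) (x : Elem g (O.obj (l + m)))
      (y : ∀ i, Elem g (O.obj (j i))) (w : ∀ i, Fin (j i) → Elem g X),
      ξ l ∙ (x ⊠ tf fun i => O.inj (.mk (y i) (w i))) =
        O.shiftGen (O.compFirst m j ∙ (x ⊠ tf y)) (flat w) := by
    intro Λ g l j x y w
    have := hξ l g () j x fun i => (y i, w i)
    change ξ l ∙ ((𝟙 _ ∙ x) ⊠ tf fun i => O.ι (j i) X ∙ (y i ⊠ tf (w i))) =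
      φ l j ∙ (x ⊠ tf (f := fun i => O.obj (j i) ⊗ tensorPow X (j i))
        fun t => (y t) ⊠ tf (w t)) at this
    rw [φ_app, id_app] at this
    exact this
  have inv : ∀ l σ, (O.shift m).diagonalAct l (O.free.obj X) σ ≫ ξ l = ξ l := fun l σ => by
    refine Pres.IsValid.hom_ext_fin (fun _ => Pres.isValid_schur O.toSymmetricSequence X)
      (.leaf (O.obj (l + m))) fun g (x : Elem g (O.obj (l + m))) v hv => ?_
    choose t ht using fun i => (hv i).exists_inj
    choose j y w hw using fun i => (t i).exists_rep
    obtain rfl : v = fun i => O.inj (.mk (y i) (w i)) := funext fun i => by rw [ht, hw]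
    rw [comp_app]
    refine (congrArg (fun z => ξ l ∙ z) ((O.shift m).diagonalAct_app σ x _)).trans ?_
    refine (key (fun i => j (σ.symm i)) ((O.shift m).act σ⁻¹ ∙ x) (fun i => y (σ.symm i))
      fun i => w (σ.symm i)).trans (Eq.trans ?_ (key j x y w).symm)
    refine Operad.shiftGen_congr ?_
    rw [Term.partialApp, Term.partialApp, ← Term.join_split, ← Term.join_split]
    exact congrArg Term.join (Term.partialApp_act σ x fun i => Term.mk (y i) (w i))
  obtain ⟨M, hM⟩ : ∃ M : (O.shift m).schur.obj (O.free.obj X) ⟶ (O.shift m).schur.obj X,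
      ∀ l, (O.shift m).ι l (O.free.obj X) ≫ M = ξ l :=
    ⟨(O.shift m).desc ξ inv, (O.shift m).incl_desc ξ inv⟩
  refine ⟨M, fun j x y w => ?_⟩
  rw [← key, Operad.shiftGen, ← comp_app]
  exact congrArg (fun f => f ∙ (x ⊠ tf fun i => O.inj (.mk (y i) (w i)))) (hM _)

variable (O) in
/-- The coequalizers that define the objects of the enveloping operad. -/
structure EnvelopingObjects (A : OperadAlgebra O) where
  obj : ℕ → C
  mult : ∀ m : ℕ, (O.shift m).schur.obj (O.free.obj A.carrier) ⟶ (O.shift m).schur.obj A.carrier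
  mult_app : ∀ {m : ℕ} {Λ : Type} {g : Λ → C} {l : ℕ} (j : Fin l → ℕ) (x : Elem g (O.obj (l + m)))
    (y : ∀ i, Elem g (O.obj (j i))) (w : ∀ i, Fin (j i) → Elem g A.carrier),
    mult m ∙ O.shiftGen x (fun i => O.inj (.mk (y i) (w i))) =
      O.shiftGen (O.compFirst m j ∙ (x ⊠ tf y)) (flat w)
  proj : ∀ m : ℕ, (O.shift m).schur.obj A.carrier ⟶ obj m
  condition : ∀ m : ℕ, mult m ≫ proj m = (O.shift m).schur.map A.str.action ≫ proj m
  isColimit : ∀ m : ℕ, IsColimit (Cofork.ofπ (proj m) (condition m))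

theorem exists_envelopingObjects (A : OperadAlgebra O) : Nonempty (EnvelopingObjects O A) := by
  choose M hM using O.exists_shift_mult A.carrier
  exact ⟨{
    obj := fun m => coequalizer (M m) ((O.shift m).schur.map A.str.action)
    mult := M
    mult_app := fun j x y w => hM _ j x y w
    proj := fun m => coequalizer.π _ _
    condition := fun m => coequalizer.condition _ _
    isColimit := fun m => coequalizerIsCoequalizer _ _ }⟩

theorem Operad.shift_map_shiftGen {Y : C} (f : X ⟶ Y) {l : ℕ} (x : Elem g (O.obj (l + m)))
    (a : Fin l → Elem g X) :
    (O.shift m).schur.map f ∙ O.shiftGen x a = O.shiftGen x fun i => f ∙ a i := by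
  rw [Operad.shiftGen, ← comp_app]
  refine (congrArg (fun F => F ∙ (x ⊠ tf a)) ((O.shift m).ι_map f l)).trans ?_
  rw [comp_app, whiskerLeft_app, tensorPowMap_app]
  rfl

namespace EnvelopingObjects

variable {A : OperadAlgebra O} (E : EnvelopingObjects O A)

/-- The element of the enveloping operad given by an operation and its first inputs. -/
def pt {l : ℕ} (x : Elem g (O.obj (l + m))) (a : Fin l → Elem g A.carrier) : Elem g (E.obj m) :=
  E.proj m ∙ O.shiftGen x a

/-- The element `u` of the enveloping operad is represented by the formal operation `t`. -/
def Represents (t : Term O g (Elem g A.carrier ⊕ Fin m)) (u : Elem g (E.obj m)) : Prop :=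
  ∃ (l : ℕ) (x : Elem g (O.obj (l + m))) (a : Fin l → Elem g A.carrier),
    t = Term.partialApp x a ∧ u = E.pt x a

theorem represents_pt {l : ℕ} (x : Elem g (O.obj (l + m))) (a : Fin l → Elem g A.carrier) :
    E.Represents (Term.partialApp x a) (E.pt x a) :=
  ⟨l, x, a, rfl, rfl⟩

/-- The coequalizer condition on generators: composing inputs in `O` agrees in `U(m)` with
evaluating them in `A`. -/
theorem pt_eval {l : ℕ} (j : Fin l → ℕ) (x : Elem g (O.obj (l + m)))
    (y : ∀ i, Elem g (O.obj (j i))) (w : ∀ i, Fin (j i) → Elem g A.carrier) :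
    E.pt (O.compFirst m j ∙ (x ⊠ tf y)) (flat w) =
      E.pt x fun i => A.str.eval (.mk (y i) (w i)) := by
  rw [pt, ← E.mult_app, ← comp_app, E.condition, comp_app, O.shift_map_shiftGen, pt]
  simp only [A.str.action_inj]

end EnvelopingObjects

/-- The relation between formal operations that is generated by the evaluation in `A` of
operations in the inputs of the first kind. -/
def Term.EvalRel (a : AlgebraStructure O X) {W : Type*} (t t' : Term O g (Elem g X ⊕ W)) : Prop :=
  ∃ T : Term O g (Term O g (Elem g X) ⊕ W), t = T.join ∧ t' = T.map (Sum.map a.eval id)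

/-- Wrap every input from `A` into `Term.pure`; both flattening and evaluation remove the wrapping.
-/
theorem Term.EvalRel.refl (a : AlgebraStructure O X) {W : Type*} (t : Term O g (Elem g X ⊕ W)) :
    t.EvalRel a t := by
  refine ⟨t.map (Sum.map .pure id), ?_, ?_⟩
  · rw [Term.join, Term.map_bind]
    conv_lhs => rw [← t.bind_pure]
    congr 1
    funext z
    cases z with
    | inl z => exact (Term.map_pure _ _).symm
    | inr z => rfl
  · rw [Term.map_map]
    conv_lhs => rw [← t.bind_pure]
    change t.bind Term.pure = t.bind _
    congr 1
    funext z
    cases z with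
    | inl z => exact congrArg (fun z => Term.pure (Sum.inl z)) (a.eval_pure z).symm
    | inr z => rfl

/-- A formal operation that evaluates to a given one. -/
theorem Term.exists_join_of_map_eval {a : AlgebraStructure O X} {W : Type*} {l : ℕ}
    {T : Term O g (Term O g (Elem g X) ⊕ W)} {x : Elem g (O.obj (l + m))}
    {b : Fin l → Elem g X} {z : Fin m → W} (h : T.map (Sum.map a.eval id) = Term.split x b z) :
    ∃ (j : Fin l → ℕ) (y : ∀ i, Elem g (O.obj (j i))) (w : ∀ i, Fin (j i) → Elem g X),
      T.join = Term.split (O.compFirst m j ∙ (x ⊠ tf y)) (flat w) z ∧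
      b = fun i => a.eval (.mk (y i) (w i)) := by
  obtain ⟨τ, rfl, rfl⟩ := Term.map_eq_split h
  choose j y w hw using fun i => (τ i).exists_rep
  obtain rfl : τ = _ := funext hw
  exact ⟨j, y, w, Term.join_split x y w z, rfl⟩

namespace EnvelopingObjects

variable {A : OperadAlgebra O} {E : EnvelopingObjects O A}

/-- The witness `T` can be lifted so that its operation is the `x'` representing `u'`; then `u` and
`u'` are the two sides of one instance of `pt_eval`. -/
theorem Represents.eq_of_evalRel {t t' : Term O g (Elem g A.carrier ⊕ Fin m)}
    {u u' : Elem g (E.obj m)} (h : E.Represents t u) (h' : E.Represents t' u')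
    (r : t.EvalRel A.str t') : u = u' := by
  obtain ⟨l, x, a, rfl, rfl⟩ := h
  obtain ⟨l', x', a', rfl, rfl⟩ := h'
  obtain ⟨T, h₁, h₂⟩ := r
  obtain ⟨j, y, w, h₃, rfl⟩ := Term.exists_join_of_map_eval h₂.symm
  rw [← E.pt_eval]
  exact congrArg (fun z => E.proj m ∙ z) (Operad.shiftGen_congr (h₁.trans h₃))

theorem Represents.unique {t : Term O g (Elem g A.carrier ⊕ Fin m)} {u u' : Elem g (E.obj m)}
    (h : E.Represents t u) (h' : E.Represents t u') : u = u' :=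
  h.eq_of_evalRel h' (.refl _ _)

variable (E)

/-- The generators of the relations in the definition of the enveloping operad. -/
def relShape (O : Operad C) (A : C) (m : ℕ) {l : ℕ} (j : Fin l → ℕ) : Shape C :=
  .tens (.leaf (O.obj (l + m)))
    (.fin l fun i => .tens (.leaf (O.obj (j i))) (.fin (j i) fun _ => .leaf A))

/-- The generators of `∐_ℓ O(ℓ + m) ⊗_{Σ_ℓ} (𝕆 A)^(ℓ)`. -/
def relGen (O : Operad C) (A : C) (m : ℕ) {l : ℕ} (j : Fin l → ℕ) :
    (relShape O A m j).obj ⟶ (O.shift m).schur.obj (O.free.obj A) :=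
  (O.obj (l + m) ◁ tensorFinMap fun i => O.ι (j i) A) ≫ (O.shift m).ι l (O.free.obj A)

/-- The first map of the relations in the definition of the enveloping operad. -/
def relFst (O : Operad C) (A : C) (m : ℕ) {l : ℕ} (j : Fin l → ℕ) :
    (relShape O A m j).obj ⟶ O.obj ((∑ i, j i) + m) ⊗ tensorPow A (∑ i, j i) :=
  (O.obj (l + m) ◁ tensorFinUnshuffle j (fun i => O.obj (j i)) fun _ => A) ≫
    (α_ _ _ _).inv ≫ (O.compFirst m j ▷ _)

/-- The second map of the relations in the definition of the enveloping operad. -/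
def relSnd (A : OperadAlgebra O) (m : ℕ) {l : ℕ} (j : Fin l → ℕ) :
    (relShape O A.carrier m j).obj ⟶ O.obj (l + m) ⊗ tensorPow A.carrier l :=
  O.obj (l + m) ◁ tensorFinMap fun i => A.str.ξ (j i)

section

variable {l : ℕ} (j : Fin l → ℕ) (x : Elem g (O.obj (l + m))) (y : ∀ i, Elem g (O.obj (j i)))
  (w : ∀ i, Fin (j i) → Elem g A.carrier)

theorem relFst_app : relFst O A.carrier m j ∙ (relShape O A.carrier m j).ev
    (x, fun i => (y i, w i)) = (O.compFirst m j ∙ (x ⊠ tf y)) ⊠ tf (flat w) := by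
  change (_ ≫ _ ≫ _) ∙ (x ⊠ tf (f := fun i => O.obj (j i) ⊗ tensorPow A.carrier (j i))
    fun i => y i ⊠ tf (w i)) = _
  rw [comp_app, comp_app, whiskerLeft_app, tensorFinUnshuffle_pow_app, associator_inv_app,
    whiskerRight_app]

theorem relSnd_app : relSnd A m j ∙ (relShape O A.carrier m j).ev (x, fun i => (y i, w i)) =
    x ⊠ tf fun i => A.str.eval (.mk (y i) (w i)) := by
  change (_ ◁ _) ∙ (x ⊠ tf fun i => y i ⊠ tf (w i)) = _
  rw [whiskerLeft_app, tensorFinMap_app]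
  rfl

theorem relGen_app : relGen O A.carrier m j ∙ (relShape O A.carrier m j).ev
    (x, fun i => (y i, w i)) = O.shiftGen x fun i => O.inj (.mk (y i) (w i)) := by
  have : ((O.obj (l + m) ◁ tensorFinMap fun i => O.ι (j i) A.carrier) ≫
      (O.shift m).ι l (O.free.obj A.carrier)) ∙ (x ⊠ tf fun i => y i ⊠ tf (w i)) =
      O.shiftGen x fun i => O.inj (.mk (y i) (w i)) := by
    refine (comp_app _ _ _).trans ?_
    rw [whiskerLeft_app, tensorFinMap_app]
    rfl
  exact this

end

theorem relFst_comp {l : ℕ} (j : Fin l → ℕ) :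
    relFst O A.carrier m j ≫ (O.shift m).ι (∑ i, j i) A.carrier =
      relGen O A.carrier m j ≫ E.mult m := by
  refine Shape.hom_ext (relShape O A.carrier m j) fun g z => ?_
  obtain ⟨x, z⟩ := z
  refine (comp_app _ _ _).trans (Eq.trans ?_ (comp_app _ _ _).symm)
  refine (congrArg _ (relFst_app j x (fun i => (z i).1) fun i => (z i).2)).trans
    (Eq.trans ?_ (congrArg _ (relGen_app j x (fun i => (z i).1) fun i => (z i).2)).symm)
  exact (E.mult_app j x (fun i => (z i).1) fun i => (z i).2).symm

theorem relSnd_comp {l : ℕ} (j : Fin l → ℕ) :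
    relSnd A m j ≫ (O.shift m).ι l A.carrier =
      relGen O A.carrier m j ≫ (O.shift m).schur.map A.str.action := by
  refine Shape.hom_ext (relShape O A.carrier m j) fun g z => ?_
  obtain ⟨x, z⟩ := z
  refine (comp_app _ _ _).trans (Eq.trans ?_ (comp_app _ _ _).symm)
  refine (congrArg _ (relSnd_app j x (fun i => (z i).1) fun i => (z i).2)).trans
    (Eq.trans ?_ (congrArg _ (relGen_app j x (fun i => (z i).1) fun i => (z i).2)).symm)
  have h := O.shift_map_shiftGen A.str.action x
    fun i => O.inj (.mk (z i).1 (z i).2 : Term O g (Elem g A.carrier))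
  simp only [A.str.action_inj] at h
  exact h.symm

/-- The total number of inputs. -/
def relArity (j : Σ l : ℕ, Fin l → ℕ) : ℕ := ∑ i, j.2 i

/-- The presentation of the objects of the enveloping operad. -/
def pres (m : ℕ) : Pres (E.obj m) :=
  Pres.coequalizer (Cofork.ofπ (E.proj m) (E.condition m)) (Pres.schur (O.shift m) A.carrier)
    (Σ l : ℕ, Fin l → ℕ) (fun j => relShape O A.carrier m j.2) relArity (fun j => j.1)
    (fun j => relFst O A.carrier m j.2) (fun j => relSnd A m j.2)

/-- Obtained from the presentation of `∐_ℓ O(ℓ + m) ⊗_{Σ_ℓ} A^(ℓ)` by adding, for each choice of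
arities, the pair consisting of composition in `O` and evaluation in `A`. -/
theorem isValid_pres (m : ℕ) : (E.pres m).IsValid := by
  refine Pres.isValid_coequalizer (E.isColimit m) (Pres.isValid_schur _ _)
    (fun j => relGen O A.carrier m j.2) ?_ (fun j => E.relFst_comp j.2) (fun j => relSnd_comp j.2)
  -- The source of the two arrows is covered by the objects `O(ℓ + m) ⊗ (𝕆 A)^(ℓ)`, and each factor
  -- `𝕆 A` by its summands.
  intro W Z ψ ψ' h
  refine (O.shift m).whiskerLeft_ext _ W ψ ψ' fun l => ?_
  refine (Pres.IsValid.fin (n := l) fun _ => Pres.isValid_schur O.toSymmetricSequence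
    A.carrier).ext_right W (O.obj (l + m)) _ _ fun j => ?_
  exact (whiskerLeft_comp_assoc _ _ _ _).symm.trans
    ((h ⟨l, j⟩).trans (whiskerLeft_comp_assoc _ _ _ _))

/-- Relations from permutations leave the term unchanged; the other relations are literally a
flattening and an evaluation of the same term of terms. -/
theorem respects_pres (m : ℕ) : (E.pres m).Respects fun g (l : ℕ) (l' : ℕ)
      (x : Elem g (O.obj (l + m)) × (Fin l → Elem g A.carrier))
      (x' : Elem g (O.obj (l' + m)) × (Fin l' → Elem g A.carrier)) =>
    (Term.partialApp (l := l) x.1 x.2 : Term O g (Elem g A.carrier ⊕ Fin m)).EvalRel A.str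
      (Term.partialApp (l := l') x'.1 x'.2) where
  refl g l x := .refl _ _
  rel g (j : (Σ l : ℕ, Equiv.Perm (Fin l)) ⊕ Σ l : ℕ, Fin l → ℕ) z := by
    obtain ⟨l, σ⟩ | ⟨l, j⟩ := j
    · obtain ⟨(x : Elem g (O.obj (l + m))), (a : Fin l → Elem g A.carrier)⟩ := z
      refine ⟨((O.shift m).act σ⁻¹ ∙ x, a ∘ σ.symm), (x, a), (O.shift m).diagonalAct_app σ x a,
        id_app _, ?_⟩
      have h := Term.partialApp_act σ x a
      exact h ▸ .refl _ _
    · obtain ⟨(x : Elem g (O.obj (l + m))), z⟩ := z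
      refine ⟨(O.compFirst m j ∙ (x ⊠ tf fun i => (z i).1), flat fun i => (z i).2),
        (x, fun i => A.str.eval (.mk (z i).1 (z i).2)),
        relFst_app j x (fun i => (z i).1) fun i => (z i).2,
        relSnd_app j x (fun i => (z i).1) fun i => (z i).2, ?_⟩
      exact ⟨Term.partialApp x fun i => Term.mk (z i).1 (z i).2,
        (Term.join_split x (fun i => (z i).1) (fun i => (z i).2) fun i => i).symm,
        (Term.map_split_map x (fun i => Term.mk (z i).1 (z i).2) (fun i => i) A.str.eval id).symm⟩

theorem reach_pres {u : Elem g (E.obj m)} (h : (E.pres m).Reach u) : ∃ t, E.Represents t u := by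
  obtain ⟨(l : ℕ), (x : Elem g (O.obj (l + m)) × (Fin l → Elem g A.carrier)), rfl⟩ := h
  refine ⟨_, l, x.1, x.2, rfl, ?_⟩
  exact comp_app _ _ _

end EnvelopingObjects

end EnvelopingObjects

/-! ### The composition of the enveloping operad -/

section Substitution

variable {C : Type u} [Category.{v} C] [MonoidalCategory C] [SymmetricCategory C]

open Elem

variable {O : Operad C} {Λ : Type} {g : Λ → C} {V V' : Type*} {m : ℕ} {j : Fin m → ℕ}

/-- Substitution into the inputs of the second kind. -/
def Term.subst (t : Term O g (V ⊕ Fin m)) (s : ∀ i, Term O g (V ⊕ Fin (j i))) :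
    Term O g (V ⊕ Fin (∑ i, j i)) :=
  t.bind (Sum.elim (fun a => .pure (.inl a)) fun i =>
    (s i).map (Sum.map id fun k => finSigmaFinEquiv ⟨i, k⟩))

theorem Term.bind_congr {W : Type*} (t : Term O g V) {f f' : V → Term O g W}
    (h : ∀ a, f a = f' a) : t.bind f = t.bind f' :=
  congrArg _ (funext h)

theorem Term.map_id (t : Term O g V) : t.map id = t :=
  t.bind_pure

/-- With `map_subst` this shows that both ends of the evaluation relation are compatible with
substitution. -/
theorem Term.join_subst (T : Term O g (Term O g V ⊕ Fin m))
    (S : ∀ i, Term O g (Term O g V ⊕ Fin (j i))) :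
    (T.subst S).join = T.join.subst fun i => (S i).join := by
  rw [subst, subst, join, join, bind_assoc, bind_assoc]
  refine T.bind_congr fun z => ?_
  cases z with
  | inl t =>
    rw [Sum.elim_inl, Sum.elim_inl, pure_bind, map_bind]
    rfl
  | inr i =>
    rw [Sum.elim_inr, Sum.elim_inr, pure_bind, map_bind, Sum.elim_inr, join, bind_map]
    refine (S i).bind_congr fun z => ?_
    cases z with
    | inl t =>
      exact (map_map t (V' := V ⊕ Fin (j i)) .inl
        (Sum.map id fun k => finSigmaFinEquiv ⟨i, k⟩)).symm
    | inr k =>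
      exact (map_pure (O := O) (g := g) (Sum.map id fun k => finSigmaFinEquiv ⟨i, k⟩)
        (.inr k : V ⊕ Fin (j i))).symm

theorem Term.map_subst (f : V → V') (t : Term O g (V ⊕ Fin m))
    (s : ∀ i, Term O g (V ⊕ Fin (j i))) :
    (t.subst s).map (Sum.map f id) =
      (t.map (Sum.map f id)).subst fun i => (s i).map (Sum.map f id) := by
  rw [subst, subst, bind_map, map_bind]
  refine t.bind_congr fun z => ?_
  cases z with
  | inl a => exact map_pure _ _
  | inr i =>
    refine (map_map _ _ _).trans (Eq.trans ?_ (map_map _ _ _).symm)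
    refine congrArg (fun F => (s i).map F) (funext fun z => ?_)
    cases z <;> rfl

theorem collectEquiv_castAdd (l : ℕ) (a j : Fin m → ℕ) (k : Fin l) :
    collectEquiv l a j (Fin.castAdd _ k) = Fin.castAdd _ (Fin.castAdd _ k) := by
  simp [collectEquiv]

theorem collectEquiv_left (l : ℕ) (a j : Fin m → ℕ) (i : Fin m) (k : Fin (a i)) :
    collectEquiv l a j (Fin.natAdd l (finSigmaFinEquiv ⟨i, Fin.castAdd (j i) k⟩)) =
      Fin.castAdd _ (Fin.natAdd l (finSigmaFinEquiv ⟨i, k⟩)) := by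
  simp [collectEquiv, -finSigmaFinEquiv_apply]

theorem collectEquiv_right (l : ℕ) (a j : Fin m → ℕ) (i : Fin m) (k : Fin (j i)) :
    collectEquiv l a j (Fin.natAdd l (finSigmaFinEquiv ⟨i, Fin.natAdd (a i) k⟩)) =
      Fin.natAdd _ (finSigmaFinEquiv ⟨i, k⟩) := by
  simp [collectEquiv, -finSigmaFinEquiv_apply]

/-- The composition rule required of `U` is substitution into the inputs of the second kind.
`collectEquiv` accounts for the inputs from `A` that lie between the free inputs after composing in
`O`. -/
theorem Term.subst_partialApp {l : ℕ} {b : Fin m → ℕ} (x : Elem g (O.obj (l + m)))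
    (a : Fin l → V) (y : ∀ i, Elem g (O.obj (b i + j i))) (c : ∀ i, Fin (b i) → V) :
    (partialApp x a).subst (fun i => partialApp (y i) (c i)) =
      partialApp (O.actEquiv (collectEquiv l b j).symm ∙
        O.compLast l (fun i => b i + j i) ∙ (x ⊠ tf y)) (Fin.append a (flat c)) := by
  have h := Term.mk_compLast (fun i => b i + j i) x y (fun k => (.inl (a k) : V ⊕ Fin (∑ i, j i)))
    fun i => Fin.append (fun k => .inl (c i k)) fun k => .inr (finSigmaFinEquiv ⟨i, k⟩)
  have e : (partialApp x a).subst (fun i => partialApp (y i) (c i)) =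
      (mk x (Fin.append (fun k => pure (.inl (a k))) fun i => mk (y i)
        (Fin.append (fun k => .inl (c i k)) fun k => .inr (finSigmaFinEquiv ⟨i, k⟩)))).bind id := by
    rw [subst, partialApp, split, mk_bind, append_comp]
    simp only [Sum.elim_inl, Sum.elim_inr, partialApp, map_split]
    rfl
  rw [e, ← h, partialApp, split, mk_actEquiv]
  congr 1
  funext t
  rw [Equiv.symm_symm, Function.comp]
  induction t using Fin.addCases with
  | left k => simp only [collectEquiv_castAdd, Fin.append_left]
  | right t =>
    obtain ⟨⟨i, t⟩, rfl⟩ := finSigmaFinEquiv.surjective t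
    rw [Fin.append_right, flat_apply]
    induction t using Fin.addCases with
    | left k => rw [collectEquiv_left, Fin.append_left, Fin.append_left, Fin.append_right, flat_apply]
    | right k => rw [collectEquiv_right, Fin.append_right, Fin.append_right]

/-- The witnesses for the outer and inner terms are substituted into each other, so all relations
are realized at once. -/
theorem Term.EvalRel.subst {X : C} {a : AlgebraStructure O X} {t t' : Term O g (Elem g X ⊕ Fin m)}
    (h : t.EvalRel a t') {s s' : ∀ i, Term O g (Elem g X ⊕ Fin (j i))}
    (hs : ∀ i, (s i).EvalRel a (s' i)) : (t.subst s).EvalRel a (t'.subst s') := by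
  obtain ⟨T, rfl, rfl⟩ := h
  choose S h₁ h₂ using hs
  obtain rfl : s = _ := funext h₁
  obtain rfl : s' = _ := funext h₂
  exact ⟨T.subst S, (T.join_subst S).symm, (Term.map_subst _ _ _).symm⟩

theorem Term.join_map {W W' : Type*} (f : W → W') (T : Term O g (Term O g V ⊕ W)) :
    T.join.map (Sum.map id f) = (T.map (Sum.map id f)).join := by
  rw [join, join, bind_map, map_bind]
  refine T.bind_congr fun z => ?_
  cases z with
  | inl t => exact map_map _ _ _
  | inr i => exact map_pure _ _

theorem Term.EvalRel.map {X : C} {a : AlgebraStructure O X} {W W' : Type*}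
    {t t' : Term O g (Elem g X ⊕ W)} (h : t.EvalRel a t') (f : W → W') :
    (t.map (Sum.map id f)).EvalRel a (t'.map (Sum.map id f)) := by
  obtain ⟨T, rfl, rfl⟩ := h
  refine ⟨T.map (Sum.map id f), Term.join_map f T, ?_⟩
  rw [map_map, map_map]
  refine congrArg (fun F => T.map F) (funext fun z => ?_)
  cases z <;> rfl

end Substitution

/-! ### Composition and symmetric group actions on the objects `U(m)`. -/

section EnvelopingComposition

variable {C : Type u} [Category.{v} C] [MonoidalCategory C] [SymmetricCategory C]
  [HasCountableColimits C] [TensorPreservesCountableColimits C]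

open Elem

variable {O : Operad C} {A : OperadAlgebra O} {Λ : Type} {g : Λ → C} {m : ℕ}

namespace EnvelopingObjects

variable (E : EnvelopingObjects O A)

/-- A map that is given by the composition rule of the enveloping operad. -/
def IsComp {j : Fin m → ℕ} (c : E.obj m ⊗ tensorFin (fun i => E.obj (j i)) ⟶ E.obj (∑ i, j i)) :
    Prop :=
  ∀ {Λ : Type} {g : Λ → C} {l : ℕ} {b : Fin m → ℕ} (x : Elem g (O.obj (l + m)))
    (a : Fin l → Elem g A.carrier) (y : ∀ i, Elem g (O.obj (b i + j i)))
    (z : ∀ i, Fin (b i) → Elem g A.carrier),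
    c ∙ (E.pt x a ⊠ tf fun i => E.pt (y i) (z i)) =
      E.pt (O.actEquiv (collectEquiv l b j).symm ∙ O.compLast l (fun i => b i + j i) ∙ (x ⊠ tf y))
        (Fin.append a (flat z))

/-- A map that is given by the symmetric group actions of the enveloping operad. -/
def IsAct (σ : Equiv.Perm (Fin m)) (α : E.obj m ⟶ E.obj m) : Prop :=
  ∀ {Λ : Type} {g : Λ → C} {l : ℕ} (x : Elem g (O.obj (l + m))) (a : Fin l → Elem g A.carrier),
    α ∙ E.pt x a = E.pt (O.act (permAdd (1 : Equiv.Perm (Fin l)) σ) ∙ x) a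

/-- The composition rule of the enveloping operad on generators. -/
def compGen {j : Fin m → ℕ} (l : ℕ) (b : Fin m → ℕ) :
    (O.obj (l + m) ⊗ tensorPow A.carrier l) ⊗
      tensorFin (fun i => O.obj (b i + j i) ⊗ tensorPow A.carrier (b i)) ⟶ E.obj (∑ i, j i) :=
  (_ ◁ tensorFinUnshuffle b (fun i => O.obj (b i + j i)) fun _ => A.carrier) ≫
    tensorμ _ _ _ _ ≫
      ((O.compLast l (fun i => b i + j i) ≫ O.actEquiv (collectEquiv l b j).symm) ⊗ₘ
        tensorPowConcat A.carrier l (∑ i, b i)) ≫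
      (O.shift (∑ i, j i)).ι (l + ∑ i, b i) A.carrier ≫ E.proj (∑ i, j i)

theorem compGen_app {j : Fin m → ℕ} {l : ℕ} {b : Fin m → ℕ} (x : Elem g (O.obj (l + m)))
    (a : Fin l → Elem g A.carrier) (y : ∀ i, Elem g (O.obj (b i + j i)))
    (z : ∀ i, Fin (b i) → Elem g A.carrier) :
    E.compGen (j := j) l b ∙ ((x ⊠ tf a) ⊠
      tf (f := fun i => O.obj (b i + j i) ⊗ tensorPow A.carrier (b i)) fun i => y i ⊠ tf (z i)) =
      E.pt (O.actEquiv (collectEquiv l b j).symm ∙ O.compLast l (fun i => b i + j i) ∙ (x ⊠ tf y))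
        (Fin.append a (flat z)) := by
  rw [compGen, comp_app, comp_app, comp_app, whiskerLeft_app, tensorFinUnshuffle_pow_app,
    tensorμ_app, hom_app, tensorPowConcat_app, comp_app, comp_app]
  rfl

/-- The rule on generators descends to the quotients because evaluation is a congruence for
substitution. -/
theorem exists_isComp (j : Fin m → ℕ) :
    ∃ c : E.obj m ⊗ tensorFin (fun i => E.obj (j i)) ⟶ E.obj (∑ i, j i), E.IsComp c := by
  obtain ⟨c, hc⟩ := Pres.IsValid.exists_hom_tens_fin (E.isValid_pres m)
    (fun i => E.isValid_pres (j i)) (E.respects_pres m) (fun i => E.respects_pres (j i))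
    (fun (l : ℕ) (b : Fin m → ℕ) => E.compGen (j := j) l b) (by
      intro Λ g (l : ℕ) (l' : ℕ) (b : Fin m → ℕ) (b' : Fin m → ℕ)
        (x : Elem g (O.obj (l + m)) × (Fin l → Elem g A.carrier))
        (x' : Elem g (O.obj (l' + m)) × (Fin l' → Elem g A.carrier))
        (y : ∀ i, Elem g (O.obj (b i + j i)) × (Fin (b i) → Elem g A.carrier))
        (y' : ∀ i, Elem g (O.obj (b' i + j i)) × (Fin (b' i) → Elem g A.carrier)) hx hy
      refine (E.compGen_app x.1 x.2 (fun i => (y i).1) fun i => (y i).2).trans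
        (Eq.trans ?_ (E.compGen_app x'.1 x'.2 (fun i => (y' i).1) fun i => (y' i).2).symm)
      have h := Term.EvalRel.subst hx hy
      refine (E.represents_pt _ _).eq_of_evalRel (E.represents_pt _ _) ?_
      rw [← Term.subst_partialApp, ← Term.subst_partialApp]
      exact h)
  refine ⟨c, fun {Λ g l b} x a y z => ?_⟩
  rw [← E.compGen_app x a y z]
  refine Eq.trans ?_ (hc g l b (x, a) fun i => (y i, z i))
  have e : ∀ {m l : ℕ} (x : Elem g (O.obj (l + m))) (a : Fin l → Elem g A.carrier),
      E.pt x a = ((O.shift m).ι l A.carrier ≫ E.proj m) ∙ (x ⊠ tf a) :=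
    fun x a => (comp_app _ _ _).symm
  rw [e x a, funext fun i => e (y i) (z i)]
  rfl

theorem hom_ext {Z : C} {F G : E.obj m ⟶ Z}
    (h : ∀ {Λ : Type} (g : Λ → C) (t) (u : Elem g (E.obj m)), E.Represents t u → F ∙ u = G ∙ u) :
    F = G := by
  refine (E.isValid_pres m).hom_ext fun i Λ g x => ?_
  obtain ⟨t, ht⟩ := E.reach_pres ⟨i, x, rfl⟩
  exact h g t _ ht

theorem hom_ext_tens_fin {j : Fin m → ℕ} {Z : C}
    {F G : E.obj m ⊗ tensorFin (fun i => E.obj (j i)) ⟶ Z}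
    (h : ∀ {Λ : Type} (g : Λ → C) (t) (u : Elem g (E.obj m))
      (s : ∀ i, Term O g (Elem g A.carrier ⊕ Fin (j i))) (v : ∀ i, Elem g (E.obj (j i))),
      E.Represents t u → (∀ i, E.Represents (s i) (v i)) → F ∙ (u ⊠ tf v) = G ∙ (u ⊠ tf v)) :
    F = G := by
  refine (E.isValid_pres m).hom_ext_tens_fin (fun i => E.isValid_pres (j i))
    fun g u v hu hv => ?_
  obtain ⟨t, ht⟩ := E.reach_pres hu
  choose s hs using fun i => E.reach_pres (hv i)
  exact h g t u s v ht hs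

theorem _root_.OperadicAlgebra.Pres.IsValid.hom_ext_tens_fin_fin {Q₀ : C} {p₀ : Pres Q₀}
    (hp₀ : p₀.IsValid) {n : ℕ} {Q : Fin n → C} {p : ∀ i, Pres (Q i)} (hp : ∀ i, (p i).IsValid)
    {n' : ℕ} {Q' : Fin n' → C} {p' : ∀ i, Pres (Q' i)} (hp' : ∀ i, (p' i).IsValid) {Z : C}
    {F G : (Q₀ ⊗ tensorFin Q) ⊗ tensorFin Q' ⟶ Z}
    (h : ∀ {Λ : Type} (g : Λ → C) (x : Elem g Q₀) (v : ∀ i, Elem g (Q i)) (v' : ∀ i, Elem g (Q' i)),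
      p₀.Reach x → (∀ i, (p i).Reach (v i)) → (∀ i, (p' i).Reach (v' i)) →
        F ∙ ((x ⊠ tf v) ⊠ tf v') = G ∙ ((x ⊠ tf v) ⊠ tf v')) : F = G := by
  refine (hp₀.tens (Pres.IsValid.fin hp)).hom_ext_tens_fin hp' fun g z v' hz hv' => ?_
  obtain ⟨⟨i, α⟩, ⟨x, y⟩, rfl⟩ := hz
  have e : ((p₀.tens (Pres.fin p)).q (i, α)) ∙ (((p₀.tens (Pres.fin p)).P (i, α)).ev (x, y)) =
      (p₀.q i ∙ (p₀.P i).ev x) ⊠ tf fun t => (p t).q (α t) ∙ ((p t).P (α t)).ev (y t) := by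
    change (p₀.q i ⊗ₘ tensorFinMap fun i => (p i).q (α i)) ∙ ((p₀.P i).ev x ⊠
      tf fun i => ((p i).P (α i)).ev (y i)) = _
    rw [hom_app, tensorFinMap_app]
  rw [e]
  exact h g _ _ v' ⟨i, x, rfl⟩ (fun t => ⟨α t, y t, rfl⟩) hv'

theorem hom_ext_tens_fin_fin {j : Fin m → ℕ} {n : ℕ} {k : Fin n → ℕ} {Z : C}
    {F G : (E.obj m ⊗ tensorFin (fun i => E.obj (j i))) ⊗ tensorFin (fun i => E.obj (k i)) ⟶ Z}
    (h : ∀ {Λ : Type} (g : Λ → C) (t) (u : Elem g (E.obj m))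
      (s : ∀ i, Term O g (Elem g A.carrier ⊕ Fin (j i))) (v : ∀ i, Elem g (E.obj (j i)))
      (r : ∀ i, Term O g (Elem g A.carrier ⊕ Fin (k i))) (w : ∀ i, Elem g (E.obj (k i))),
      E.Represents t u → (∀ i, E.Represents (s i) (v i)) → (∀ i, E.Represents (r i) (w i)) →
        F ∙ ((u ⊠ tf v) ⊠ tf w) = G ∙ ((u ⊠ tf v) ⊠ tf w)) : F = G := by
  refine (E.isValid_pres m).hom_ext_tens_fin_fin (fun i => E.isValid_pres (j i))
    (fun i => E.isValid_pres (k i)) fun g u v w hu hv hw => ?_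
  obtain ⟨t, ht⟩ := E.reach_pres hu
  choose s hs using fun i => E.reach_pres (hv i)
  choose r hr using fun i => E.reach_pres (hw i)
  exact h g t u s v r w ht hs hr

/-- A right action by `σ` on operations is a relabelling of the free inputs by the inverse of `σ`.
-/
theorem map_partialApp_act {V : Type*} {l : ℕ} (σ : Equiv.Perm (Fin m)) (x : Elem g (O.obj (l + m)))
    (a : Fin l → V) : (Term.partialApp x a).map (Sum.map id σ.symm) =
      Term.partialApp (O.act (permAdd (1 : Equiv.Perm (Fin l)) σ) ∙ x) a := by
  rw [Term.partialApp, Term.map_split_map, Term.partialApp, Term.split_eq_split]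
  refine ⟨Equiv.refl _, σ.symm, ?_, rfl, rfl⟩
  rw [SymmetricSequence.actEquiv_perm, ← comp_app, ← O.act_mul]
  have : permAdd (1 : Equiv.Perm (Fin l)) σ * sumEquiv (Equiv.refl _) σ.symm = 1 := by
    ext t
    induction t using Fin.addCases with
    | left i => simp [permAdd, sumEquiv_castAdd]
    | right i => simp [permAdd, sumEquiv_natAdd]
  rw [this, O.act_one, id_app]

theorem pt_act_congr (σ : Equiv.Perm (Fin m)) {l l' : ℕ} {x : Elem g (O.obj (l + m))}
    {a : Fin l → Elem g A.carrier} {x' : Elem g (O.obj (l' + m))} {a' : Fin l' → Elem g A.carrier}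
    (r : (Term.partialApp x a).EvalRel A.str (Term.partialApp x' a')) :
    E.pt (O.act (permAdd (1 : Equiv.Perm (Fin l)) σ) ∙ x) a =
      E.pt (O.act (permAdd (1 : Equiv.Perm (Fin l')) σ) ∙ x') a' := by
  refine (E.represents_pt _ _).eq_of_evalRel (E.represents_pt _ _) ?_
  rw [← map_partialApp_act, ← map_partialApp_act]
  exact r.map _

theorem exists_isAct (σ : Equiv.Perm (Fin m)) : ∃ α : E.obj m ⟶ E.obj m, E.IsAct σ α := by
  have h : ∀ {Λ : Type} {g : Λ → C} {l : ℕ} (x : Elem g (O.obj (l + m)))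
      (a : Fin l → Elem g A.carrier),
      ((O.act (permAdd (1 : Equiv.Perm (Fin l)) σ) ▷ tensorPow A.carrier l) ≫
        (O.shift m).ι l A.carrier ≫ E.proj m) ∙ (x ⊠ tf a) =
      E.pt (O.act (permAdd (1 : Equiv.Perm (Fin l)) σ) ∙ x) a := by
    intro Λ g l x a
    rw [comp_app, whiskerRight_app, comp_app]
    rfl
  obtain ⟨α, hα⟩ := (E.isValid_pres m).exists_hom
    (fun (l : ℕ) => (O.act (permAdd (1 : Equiv.Perm (Fin l)) σ) ▷ tensorPow A.carrier l) ≫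
      (O.shift m).ι l A.carrier ≫ E.proj m) (by
      intro j Λ g z
      obtain ⟨x, x', e, e', r⟩ := (E.respects_pres m).rel g j z
      rw [e, e']
      exact (h x.1 x.2).trans ((E.pt_act_congr σ r).trans (h x'.1 x'.2).symm))
  refine ⟨α, fun {Λ g l} x a => ?_⟩
  rw [← h]
  refine Eq.trans ?_ (congrArg (fun f => f ∙ (x ⊠ tf a)) (hα l))
  refine Eq.trans ?_ (comp_app _ _ _).symm
  exact congrArg (fun z => α ∙ z) (comp_app _ _ _).symm

variable {E}

/-- Replaces composition in `U` by substitution of terms. As an element is determined by a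
representing term, the operad axioms for `U` become identities between terms. -/
theorem IsComp.represents {j : Fin m → ℕ}
    {c : E.obj m ⊗ tensorFin (fun i => E.obj (j i)) ⟶ E.obj (∑ i, j i)} (hc : E.IsComp c)
    {t : Term O g (Elem g A.carrier ⊕ Fin m)} {u : Elem g (E.obj m)} (h : E.Represents t u)
    {s : ∀ i, Term O g (Elem g A.carrier ⊕ Fin (j i))} {v : ∀ i, Elem g (E.obj (j i))}
    (hs : ∀ i, E.Represents (s i) (v i)) : E.Represents (t.subst s) (c ∙ (u ⊠ tf v)) := by
  obtain ⟨l, x, a, rfl, rfl⟩ := h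
  choose b y z h₁ h₂ using hs
  obtain rfl : s = _ := funext h₁
  obtain rfl : v = _ := funext h₂
  rw [hc, Term.subst_partialApp]
  exact E.represents_pt _ _

theorem IsAct.represents {σ : Equiv.Perm (Fin m)} {α : E.obj m ⟶ E.obj m} (hα : E.IsAct σ α)
    {t : Term O g (Elem g A.carrier ⊕ Fin m)} {u : Elem g (E.obj m)} (h : E.Represents t u) :
    E.Represents (t.map (Sum.map id σ.symm)) (α ∙ u) := by
  obtain ⟨l, x, a, rfl, rfl⟩ := h
  rw [hα, map_partialApp_act]
  exact E.represents_pt _ _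

theorem Represents.eqToHom {m' : ℕ} (e : m = m') (h : E.obj m = E.obj m')
    {t : Term O g (Elem g A.carrier ⊕ Fin m)} {u : Elem g (E.obj m)} (hu : E.Represents t u) :
    E.Represents (t.map (Sum.map id (Fin.cast e))) (CategoryTheory.eqToHom h ∙ u) := by
  subst e
  rw [eqToHom_refl, id_app]
  have : Sum.map id (Fin.cast rfl) = (id : Elem g A.carrier ⊕ Fin m → _) := by
    funext z
    cases z <;> rfl
  rw [this, Term.map_id]
  exact hu

variable (E)

/-- The map `O(m) ⟶ U(m)`. -/
def ofOp (m : ℕ) : O.obj m ⟶ E.obj m :=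
  CategoryTheory.eqToHom (congrArg O.obj (Nat.zero_add m).symm) ≫ (ρ_ (O.obj (0 + m))).inv ≫
    (O.obj (0 + m) ◁ (tensorPowZero A.carrier).inv) ≫ (O.shift m).ι 0 A.carrier ≫ E.proj m

theorem represents_ofOp (x : Elem g (O.obj m)) :
    E.Represents (.mk x fun i => .inr i) (E.ofOp m ∙ x) := by
  refine ⟨0, CategoryTheory.eqToHom (congrArg O.obj (Nat.zero_add m).symm) ∙ x, Fin.elim0, ?_, ?_⟩
  · rw [Term.partialApp, Term.split, Term.mk_eqToHom (Nat.zero_add m).symm]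
    congr 1
    funext i
    have : Fin.cast (Nat.zero_add m).symm i = Fin.natAdd 0 i := Fin.ext (by simp)
    rw [Function.comp, this, Fin.append_right]
  · rw [ofOp, comp_app, comp_app, rightUnitor_inv_app, comp_app, whiskerLeft_app,
      tensorPowZero_inv_app Fin.elim0, comp_app]
    rfl

/-- The map `A ⟶ U(0)`. -/
def ofAlg : A.carrier ⟶ E.obj 0 :=
  (λ_ A.carrier).inv ≫ ((O.one ≫ CategoryTheory.eqToHom (congrArg O.obj (Nat.add_zero 1).symm)) ⊗ₘ
    (tensorPowOne A.carrier).inv) ≫ (O.shift 0).ι 1 A.carrier ≫ E.proj 0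

theorem represents_ofAlg (a : Elem g A.carrier) :
    E.Represents (.pure (.inl a)) (E.ofAlg ∙ a) := by
  refine ⟨1, O.one ∙ Elem.one, fun _ => a, ?_, ?_⟩
  · rw [Term.partialApp, Term.split, Term.pure]
    congr 1
    funext i
    exact (Fin.append_left (fun _ : Fin 1 => (.inl a : Elem g A.carrier ⊕ Fin 0))
      (fun k => .inr k) i).symm
  · rw [ofAlg, comp_app, comp_app, leftUnitor_inv_app, hom_app, tensorPowOne_inv_app, comp_app,
      comp_app, eqToHom_refl, id_app]
    rfl

theorem represents_one : E.Represents (.pure (.inr 0)) ((O.one ≫ E.ofOp 1) ∙ (one : Elem g _)) := by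
  rw [comp_app]
  have := E.represents_ofOp (O.one ∙ (one : Elem g _))
  have e : (fun i : Fin 1 => (Sum.inr i : Elem g A.carrier ⊕ Fin 1)) = fun _ => .inr 0 :=
    funext fun i => by rw [Subsingleton.elim i 0]
  rwa [e] at this

end EnvelopingObjects

end EnvelopingComposition

/-! ### The enveloping operad -/

section SubstitutionLaws

variable {C : Type u} [Category.{v} C] [MonoidalCategory C] [SymmetricCategory C]

open Elem

variable {O : Operad C} {Λ : Type} {g : Λ → C} {V : Type*} {m : ℕ} {j : Fin m → ℕ}

theorem blockSum_symm_apply (σ : ∀ i, Equiv.Perm (Fin (j i))) (i : Fin m) (k : Fin (j i)) :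
    (blockSum σ).symm (finSigmaFinEquiv ⟨i, k⟩) = finSigmaFinEquiv ⟨i, (σ i).symm k⟩ := by
  rw [Equiv.symm_apply_eq]
  simp [blockSum]

theorem blockPerm_symm_apply (σ : Equiv.Perm (Fin m)) (j : Fin m → ℕ) (i : Fin m)
    (k : Fin (j (σ i))) :
    (blockPerm σ j).symm (finSigmaFinEquiv ⟨σ i, k⟩) = finSigmaFinEquiv ⟨i, k⟩ := by
  rw [Equiv.symm_apply_eq]
  simp [blockPerm]

namespace Term

theorem map_inr_map {W W' W'' : Type*} (t : Term O g (V ⊕ W)) (f : W → W') (h : W' → W'') :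
    (t.map (Sum.map id f)).map (Sum.map id h) = t.map (Sum.map id fun i => h (f i)) := by
  rw [map_map]
  refine congrArg (fun F => t.map F) (funext fun z => ?_)
  cases z <;> rfl

theorem map_inr_id {W : Type*} (t : Term O g (V ⊕ W)) {f : W → W} (h : ∀ i, f i = i) :
    t.map (Sum.map id f) = t := by
  refine Eq.trans (congrArg (fun F => t.map F) (funext fun z => ?_)) t.map_id
  cases z with
  | inl a => rfl
  | inr i => exact congrArg Sum.inr (h i)

theorem subst_map {W : Type*} (t : Term O g (V ⊕ Fin m)) (s : ∀ i, Term O g (V ⊕ Fin (j i)))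
    (f : Fin (∑ i, j i) → W) : (t.subst s).map (Sum.map id f) =
      t.bind (Sum.elim (fun a => pure (.inl a)) fun i =>
        (s i).map (Sum.map id fun k => f (finSigmaFinEquiv ⟨i, k⟩))) := by
  rw [subst, bind_map]
  refine t.bind_congr fun z => ?_
  cases z with
  | inl a => exact map_pure _ _
  | inr i => exact map_inr_map _ _ _

/-- Associativity of `bind`, up to the renumbering of the free inputs compared in
`finSigmaFinEquiv_assoc`. -/
theorem subst_subst (t : Term O g (V ⊕ Fin m)) (s : ∀ i, Term O g (V ⊕ Fin (j i)))
    {k : Fin (∑ i, j i) → ℕ} (r : ∀ i, Term O g (V ⊕ Fin (k i))) :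
    (t.subst s).subst r = (t.subst fun i => (s i).subst fun l => r (finSigmaFinEquiv ⟨i, l⟩)).map
      (Sum.map id (Fin.cast (sum_blocks j k))) := by
  rw [subst_map, subst, subst, bind_assoc]
  refine t.bind_congr fun z => ?_
  cases z with
  | inl a => exact pure_bind _ _
  | inr i =>
    change ((s i).map _).bind _ = ((s i).subst _).map _
    rw [subst_map, map_bind]
    refine (s i).bind_congr fun z => ?_
    cases z with
    | inl a => rfl
    | inr l =>
      change (r (finSigmaFinEquiv ⟨i, l⟩)).map _ = (r (finSigmaFinEquiv ⟨i, l⟩)).map _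
      refine congrArg (fun F => (r (finSigmaFinEquiv ⟨i, l⟩)).map (Sum.map id F))
        (funext fun p => Fin.ext ?_)
      exact (finSigmaFinEquiv_assoc j k i l p).symm

theorem pure_subst {n : ℕ} (t : Term O g (V ⊕ Fin n)) (h : ∑ _i : Fin 1, n = n) :
    ((pure (.inr 0) : Term O g (V ⊕ Fin 1)).subst fun _ => t).map (Sum.map id (Fin.cast h)) = t := by
  rw [subst_map, pure_bind]
  exact map_inr_id t fun i => Fin.ext (by simp [finSigmaFinEquiv_apply])

theorem subst_pure (t : Term O g (V ⊕ Fin m)) (h : ∑ _i : Fin m, 1 = m) :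
    (t.subst fun _ => (pure (.inr 0) : Term O g (V ⊕ Fin 1))).map
      (Sum.map id (Fin.cast h)) = t := by
  rw [subst_map]
  refine Eq.trans (t.bind_congr fun z => ?_) t.bind_pure
  cases z with
  | inl a => rfl
  | inr i =>
    refine (map_pure _ _).trans 
      (congrArg (fun i : Fin m => (pure (.inr i) : Term O g (V ⊕ Fin m))) (Fin.ext ?_))
    simp [finSigmaFinEquiv_apply]

theorem subst_blockSum (t : Term O g (V ⊕ Fin m)) (s : ∀ i, Term O g (V ⊕ Fin (j i)))
    (σ : ∀ i, Equiv.Perm (Fin (j i))) :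
    (t.subst fun i => (s i).map (Sum.map id (σ i).symm)) =
      (t.subst s).map (Sum.map id (blockSum σ).symm) := by
  rw [subst_map]
  refine t.bind_congr fun z => ?_
  cases z with
  | inl a => rfl
  | inr i =>
    refine (map_inr_map _ _ _).trans ?_
    exact congrArg (fun F => (s i).map (Sum.map id F))
      (funext fun k => (blockSum_symm_apply σ i k).symm)

theorem subst_blockPerm (t : Term O g (V ⊕ Fin m)) (s : ∀ i, Term O g (V ⊕ Fin (j i)))
    (σ : Equiv.Perm (Fin m)) :
    ((t.map (Sum.map id σ.symm)).subst fun i => s (σ i)) =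
      (t.subst s).map (Sum.map id (blockPerm σ j).symm) := by
  rw [subst_map, subst, map_bind]
  refine t.bind_congr fun z => ?_
  cases z with
  | inl a => rfl
  | inr i =>
    obtain ⟨i, rfl⟩ := σ.surjective i
    change (s (σ (σ.symm (σ i)))).map _ = (s (σ i)).map _
    rw [σ.symm_apply_apply]
    exact congrArg (fun F => (s (σ i)).map (Sum.map id F))
      (funext fun k => (blockPerm_symm_apply σ j i k).symm)

end Term

end SubstitutionLaws

/-! ### The operad structure on the objects `U(m)`. -/

section EnvelopingOperad

variable {C : Type u} [Category.{v} C] [MonoidalCategory C] [SymmetricCategory C]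
  [HasCountableColimits C] [TensorPreservesCountableColimits C]

open Elem

variable {O : Operad C} {A : OperadAlgebra O} {Λ : Type} {g : Λ → C} {m : ℕ}

namespace EnvelopingObjects

variable (E : EnvelopingObjects O A)

theorem isAct_act (σ : Equiv.Perm (Fin m)) : E.IsAct σ (E.exists_isAct σ).choose :=
  (E.exists_isAct σ).choose_spec

/-- The symmetric sequence underlying the enveloping operad. -/
def seq : SymmetricSequence C where
  obj := E.obj
  act σ := (E.exists_isAct σ).choose
  act_one m := E.hom_ext fun g t u h => by
    rw [id_app]
    have := IsAct.represents (E.isAct_act 1) h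
    rw [Term.map_inr_id t (f := (Equiv.symm (1 : Equiv.Perm (Fin m)))) fun i => rfl] at this
    exact this.unique h
  act_mul σ τ := E.hom_ext fun g t u h => by
    rw [comp_app]
    have h₁ := IsAct.represents (E.isAct_act (σ * τ)) h
    have h₂ := IsAct.represents (E.isAct_act τ) (IsAct.represents (E.isAct_act σ) h)
    rw [Term.map_inr_map] at h₂
    exact h₁.unique h₂

theorem seq_act_represents (σ : Equiv.Perm (Fin m)) {t : Term O g (Elem g A.carrier ⊕ Fin m)}
    {u : Elem g (E.obj m)} (h : E.Represents t u) :
    E.Represents (t.map (Sum.map id σ.symm)) (E.seq.act σ ∙ u) :=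
  IsAct.represents (E.isAct_act σ) h

theorem seq_actEquiv_represents {n : ℕ} (e : Fin n ≃ Fin m)
    {t : Term O g (Elem g A.carrier ⊕ Fin m)} {u : Elem g (E.obj m)} (h : E.Represents t u) :
    E.Represents (t.map (Sum.map id e.symm)) (E.seq.actEquiv e ∙ u) := by
  obtain rfl := Fin.equiv_iff_eq.1 ⟨e⟩
  rw [E.seq.actEquiv_perm]
  exact E.seq_act_represents e h

/-- The composition rule of the enveloping operad. -/
def comp (j : Fin m → ℕ) : E.obj m ⊗ tensorFin (fun i => E.obj (j i)) ⟶ E.obj (∑ i, j i) :=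
  (E.exists_isComp j).choose

theorem isComp_comp (j : Fin m → ℕ) : E.IsComp (E.comp j) :=
  (E.exists_isComp j).choose_spec

theorem comp_represents {j : Fin m → ℕ}
    {t : Term O g (Elem g A.carrier ⊕ Fin m)} {u : Elem g (E.obj m)} (h : E.Represents t u)
    {s : ∀ i, Term O g (Elem g A.carrier ⊕ Fin (j i))} {v : ∀ i, Elem g (E.obj (j i))}
    (hs : ∀ i, E.Represents (s i) (v i)) : E.Represents (t.subst s) (E.comp j ∙ (u ⊠ tf v)) :=
  IsComp.represents (E.isComp_comp j) h hs

/-- Brings a family given along `σ` into the form to which `Elem.tensorFinPerm_app` applies. -/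
theorem exists_eq_comp_perm {α : Fin m → Type*} (σ : Equiv.Perm (Fin m)) (v : ∀ i, α (σ i)) :
    ∃ v' : ∀ i, α i, v = fun i => v' (σ i) :=
  ⟨Equiv.piCongrLeft α σ v, funext fun i => (Equiv.piCongrLeft_apply_apply α σ v i).symm⟩

/-- Both sides are represented by the same iterated substitution, so they agree by
`Represents.unique`. The remaining axioms follow the same pattern. -/
theorem comp_assoc (j : Fin m → ℕ) (k : Fin (∑ i, j i) → ℕ) :
    (E.comp j ▷ tensorFin fun t => E.obj (k t)) ≫ E.comp k =
      (α_ (E.obj m) (tensorFin fun i => E.obj (j i)) (tensorFin fun t => E.obj (k t))).hom ≫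
        (E.obj m ◁ (tensorFinShuffle j (fun i => E.obj (j i)) (fun t => E.obj (k t)) ≫
          tensorFinMap fun i => E.comp fun l : Fin (j i) => k (finSigmaFinEquiv ⟨i, l⟩))) ≫
        E.comp (fun i => ∑ l : Fin (j i), k (finSigmaFinEquiv ⟨i, l⟩)) ≫
        eqToHom (congrArg E.obj (sum_blocks j k)) :=
  E.hom_ext_tens_fin_fin fun g t u s v r w hu hv hw => by
    have h₁ := E.comp_represents (E.comp_represents hu hv) hw
    have h₂ := (E.comp_represents hu fun i => E.comp_represents (hv i) fun l =>
      hw (finSigmaFinEquiv ⟨i, l⟩)).eqToHom (sum_blocks j k) (congrArg E.obj (sum_blocks j k))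
    rw [Term.subst_subst] at h₁
    rw [comp_app, whiskerRight_app, comp_app, associator_app, comp_app, whiskerLeft_app, comp_app,
      comp_app, tensorFinShuffle_app, tensorFinMap_app]
    exact h₁.unique h₂

theorem one_comp (h : ∑ _i : Fin 1, m = m) :
    ((O.one ≫ E.ofOp 1) ⊗ₘ (tensorPowOne (E.obj m)).inv) ≫ E.comp (fun _ : Fin 1 => m) ≫
      eqToHom (congrArg E.obj h) = (λ_ (E.obj m)).hom := by
  rw [← cancel_epi (λ_ (E.obj m)).inv]
  refine E.hom_ext fun g t u hu => ?_
  rw [comp_app, leftUnitor_inv_app, comp_app, hom_app, tensorPowOne_inv_app, comp_app,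
    Iso.inv_hom_id, id_app]
  have h₁ := (E.comp_represents (j := fun _ : Fin 1 => m) E.represents_one fun _ => hu).eqToHom
    h (congrArg E.obj h)
  rw [Term.pure_subst] at h₁
  exact h₁.unique hu

theorem comp_one (h : ∑ _i : Fin m, 1 = m) :
    (E.obj m ◁ tensorListUnits (fun _ => O.one ≫ E.ofOp 1) (List.finRange m)) ≫
      E.comp (fun _ : Fin m => 1) ≫ eqToHom (congrArg E.obj h) = (ρ_ (E.obj m)).hom := by
  rw [← cancel_epi (ρ_ (E.obj m)).inv]
  refine E.hom_ext fun g t u hu => ?_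
  rw [comp_app, rightUnitor_inv_app, comp_app, whiskerLeft_app, tensorListUnits_app, comp_app,
    Iso.inv_hom_id, id_app]
  have h₁ := (E.comp_represents (j := fun _ : Fin m => 1) hu fun _ => E.represents_one).eqToHom
    h (congrArg E.obj h)
  rw [Term.subst_pure] at h₁
  exact h₁.unique hu

theorem comp_blockSum (j : Fin m → ℕ) (σ : ∀ i, Equiv.Perm (Fin (j i))) :
    (E.obj m ◁ tensorFinMap fun i => E.seq.act (σ i)) ≫ E.comp j =
      E.comp j ≫ E.seq.act (blockSum σ) :=
  E.hom_ext_tens_fin fun g t u s v hu hv => by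
    have h₁ := E.comp_represents hu fun i => E.seq_act_represents (σ i) (hv i)
    have h₂ := E.seq_act_represents (blockSum σ) (E.comp_represents hu hv)
    rw [Term.subst_blockSum] at h₁
    refine (comp_app _ _ _).trans (Eq.trans ?_ (comp_app _ _ _).symm)
    refine Eq.trans (congrArg _ (whiskerLeft_app _ _ _)) ?_
    exact (congrArg (fun z => E.comp j ∙ (u ⊠ z)) (tensorFinMap_app _ _)).trans (h₁.unique h₂)

theorem comp_blockPerm (σ : Equiv.Perm (Fin m)) (j : Fin m → ℕ) :
    (E.seq.act σ ▷ tensorFin fun i => E.obj (j (σ i))) ≫ E.comp (fun i => j (σ i)) =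
      (E.obj m ◁ tensorFinPerm σ fun i => E.obj (j i)) ≫ E.comp j ≫
        E.seq.actEquiv (blockPerm σ j) :=
  E.hom_ext_tens_fin (j := fun i => j (σ i)) fun g t u s v hu hv => by
    obtain ⟨v, rfl⟩ := exists_eq_comp_perm (α := fun i => Elem g (E.obj (j i))) σ v
    obtain ⟨s, rfl⟩ := 
      exists_eq_comp_perm (α := fun i => Term O g (Elem g A.carrier ⊕ Fin (j i))) σ s
    have hv' : ∀ i, E.Represents (s i) (v i) := fun i => by
      obtain ⟨i, rfl⟩ := σ.surjective i
      exact hv i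
    have h₁ := E.comp_represents (j := fun i => j (σ i)) (E.seq_act_represents σ hu) hv
    have h₂ := E.seq_actEquiv_represents (blockPerm σ j) (E.comp_represents hu hv')
    rw [Term.subst_blockPerm] at h₁
    refine (comp_app _ _ _).trans (Eq.trans ?_ (comp_app _ _ _).symm)
    refine Eq.trans (congrArg _ (whiskerRight_app _ _ _)) ?_
    refine (h₁.unique h₂).trans ?_
    refine Eq.trans ?_ (comp_app _ _ _).symm
    refine congrArg (fun z => E.seq.actEquiv (blockPerm σ j) ∙ E.comp j ∙ z) ?_
    exact ((whiskerLeft_app _ _ _).trans (congrArg _ (tensorFinPerm_app σ v))).symm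

/-- The enveloping operad. -/
def operad : Operad C where
  toSymmetricSequence := E.seq
  one := O.one ≫ E.ofOp 1
  comp j := E.comp j
  comp_assoc j k := E.comp_assoc j k
  one_comp _ := E.one_comp (by simp)
  comp_one _ := E.comp_one (by simp)
  comp_blockSum j σ := E.comp_blockSum j σ
  comp_blockPerm σ j := E.comp_blockPerm σ j

theorem IsAct.ι_proj {E : EnvelopingObjects O A} {σ : Equiv.Perm (Fin m)} {α : E.obj m ⟶ E.obj m}
    (hα : E.IsAct σ α) (l : ℕ) : (O.shift m).ι l A.carrier ≫ E.proj m ≫ α =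
      (O.act (permAdd (1 : Equiv.Perm (Fin l)) σ) ▷ tensorPow A.carrier l) ≫
        (O.shift m).ι l A.carrier ≫ E.proj m := by
  refine Shape.hom_ext (.tens (.leaf (O.obj (l + m))) (.fin l fun _ => .leaf A.carrier))
    fun g z => ?_
  obtain ⟨x, a⟩ := z
  change (_ ≫ _) ∙ (x ⊠ tf a) = (_ ≫ _) ∙ (x ⊠ tf a)
  rw [comp_app, comp_app, comp_app, whiskerRight_app, comp_app]
  exact hα x a

theorem IsComp.ι_proj {E : EnvelopingObjects O A} {j : Fin m → ℕ}
    {c : E.obj m ⊗ tensorFin (fun i => E.obj (j i)) ⟶ E.obj (∑ i, j i)} (hc : E.IsComp c)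
    (l : ℕ) (a : Fin m → ℕ) :
    tensorμ (O.obj (l + m)) (tensorFin fun i => O.obj (a i + j i))
          (tensorPow A.carrier l) (tensorPow A.carrier (∑ i, a i)) ≫
        (((O.shift m).ι l A.carrier ≫ E.proj m) ⊗ₘ
          (tensorFinShuffle a (fun i => O.obj (a i + j i)) (fun _ => A.carrier) ≫
            tensorFinMap fun i => (O.shift (j i)).ι (a i) A.carrier ≫ E.proj (j i))) ≫ c =
      ((O.compLast l (fun i => a i + j i) ≫ O.actEquiv (collectEquiv l a j).symm) ⊗ₘ
          tensorPowConcat A.carrier l (∑ i, a i)) ≫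
        (O.shift (∑ i, j i)).ι (l + ∑ i, a i) A.carrier ≫ E.proj (∑ i, j i) := by
  refine Shape.hom_ext (.tens (.tens (.leaf (O.obj (l + m)))
    (.fin m fun i => .leaf (O.obj (a i + j i)))) (.tens (.fin l fun _ => .leaf A.carrier)
      (.fin _ fun _ => .leaf A.carrier))) fun g z => ?_
  obtain ⟨⟨x, y⟩, b, w⟩ := z
  change (_ ≫ _) ∙ ((x ⊠ tf y) ⊠ (tf b ⊠ tf w)) = (_ ≫ _) ∙ ((x ⊠ tf y) ⊠ (tf b ⊠ tf w))
  have h := hc x b y fun i k => w (finSigmaFinEquiv ⟨i, k⟩)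
  rw [flat_eq] at h
  rw [comp_app, tensorμ_app, comp_app, hom_app, comp_app, comp_app, tensorFinShuffle_pow_app,
    tensorFinMap_app, comp_app, hom_app, comp_app, tensorPowConcat_app, comp_app]
  refine Eq.trans ?_ h
  refine congrArg (fun z => c ∙ (E.pt x b ⊠ tf z)) (funext fun i => ?_)
  exact comp_app _ _ _

/-- The enveloping operad with its structure maps. -/
def envelopingOperad : EnvelopingOperad O A where
  operad := E.operad
  mult := E.mult
  mult_spec m l j := by
    refine Shape.hom_ext (.tens (.tens (.leaf (O.obj (l + m))) (.fin l fun i => .leaf (O.obj (j i))))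
      (.fin _ fun _ => .leaf A.carrier)) fun g z => ?_
    obtain ⟨⟨x, y⟩, w⟩ := z
    change (_ ≫ _) ∙ ((x ⊠ tf y) ⊠ tf w) = (_ ≫ _) ∙ ((x ⊠ tf y) ⊠ tf w)
    rw [comp_app, associator_app, comp_app, whiskerLeft_app, comp_app, comp_app, comp_app,
      whiskerRight_app, tensorFinShuffle_pow_app, tensorFinMap_app]
    have h := E.mult_app j x y fun i k => w (finSigmaFinEquiv ⟨i, k⟩)
    rw [flat_eq] at h
    exact h
  proj := E.proj
  condition := E.condition
  isCoequalizer m := ⟨E.isColimit m⟩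
  act_spec _ l σ := IsAct.ι_proj (E.isAct_act σ) l
  one_spec := rfl
  comp_spec l a j := IsComp.ι_proj (E.isComp_comp j) l a

end EnvelopingObjects

theorem nonempty_envelopingOperad (A : OperadAlgebra O) : Nonempty (EnvelopingOperad O A) :=
  (exists_envelopingObjects A).map fun E => E.envelopingOperad

end EnvelopingOperad

/-! ### Formal operations of the enveloping operad -/

section EnvelopingTerms

variable {C : Type u} [Category.{v} C] [MonoidalCategory C] [SymmetricCategory C]
  [HasCountableColimits C] [TensorPreservesCountableColimits C]

open Elem

variable {O : Operad C} {A : OperadAlgebra O} {Λ : Type} {g : Λ → C} {m : ℕ}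

namespace EnvelopingOperad

variable (U : EnvelopingOperad O A)

/-- The objects of an enveloping operad. -/
abbrev objects : EnvelopingObjects O A where
  obj m := U.operad.obj m
  mult := U.mult
  mult_app {m Λ g l} j x y w := by
    have h := congrArg (fun f => f ∙ ((x ⊠ tf y) ⊠ tf (flat w))) (U.mult_spec m j)
    simp only [comp_app, associator_app, whiskerLeft_app, whiskerRight_app,
      tensorFinShuffle_pow_app, tensorFinMap_app, flat_apply] at h
    exact h
  proj := U.proj
  condition := U.condition
  isColimit m := (U.isCoequalizer m).some

theorem isAct (σ : Equiv.Perm (Fin m)) : U.objects.IsAct σ (U.operad.act σ) := by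
  intro Λ g l x a
  have h := congrArg (fun f => f ∙ (x ⊠ tf a)) (U.act_spec m l σ)
  simp only [comp_app, whiskerRight_app] at h
  exact h

theorem isComp (j : Fin m → ℕ) : U.objects.IsComp (U.operad.comp j) := by
  intro Λ g l b x a y z
  have h := congrArg (fun f => f ∙ ((x ⊠ tf y) ⊠ (tf a ⊠ tf (flat z)))) (U.comp_spec l b j)
  simp only [comp_app, tensorμ_app, hom_app, tensorFinShuffle_pow_app, tensorFinMap_app,
    tensorPowConcat_app, flat_apply] at h
  exact h

theorem represents_one : U.objects.Represents (.pure (.inr 0))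
    (U.operad.one ∙ (one : Elem g _)) := by
  have := U.objects.represents_one (g := g)
  have e : U.operad.one = O.one ≫ U.objects.ofOp 1 := U.one_spec
  rwa [e]

/-- The element of the enveloping operad given by an operation and its first inputs. -/
def pt {l : ℕ} (x : Elem g (O.obj (l + m))) (a : Fin l → Elem g A.carrier) :
    Elem g (U.operad.obj m) :=
  U.objects.pt x a

variable {V V' : Type*}

/-- The formal operation `τ` of the enveloping operad is represented by the formal operation `t`
of `O`. -/
def Rep (τ : Term U.operad g V) (t : Term O g (Elem g A.carrier ⊕ V)) : Prop :=
  ∃ (m l : ℕ) (x : Elem g (O.obj (l + m))) (a : Fin l → Elem g A.carrier) (z : Fin m → V),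
    τ = .mk (U.pt x a) z ∧ t = Term.split x a z

variable {U}

theorem rep_mk {t : Term O g (Elem g A.carrier ⊕ Fin m)} {u : Elem g (U.operad.obj m)}
    (h : U.objects.Represents t u) (z : Fin m → V) : U.Rep (.mk u z) (t.map (Sum.map id z)) := by
  obtain ⟨l, x, a, rfl, rfl⟩ := h
  exact ⟨m, l, x, a, z, rfl, Term.map_split_map x a (fun i => i) id z⟩

/-- A bijection that identifies the two terms splits in two: its part on the inputs from `A` is
already divided out in `U(m)`, and its part on the other inputs acts through the symmetric group
action of `U`. -/
theorem mk_pt_congr {l l' m' : ℕ} {x : Elem g (O.obj (l + m))} {a : Fin l → Elem g A.carrier}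
    {z : Fin m → V} {x' : Elem g (O.obj (l' + m'))} {a' : Fin l' → Elem g A.carrier}
    {z' : Fin m' → V} (h : Term.split x a z = Term.split x' a' z') :
    (Term.mk (U.pt x a) z : Term U.operad g V) = .mk (U.pt x' a') z' := by
  obtain ⟨e₁, e₂, rfl, rfl, rfl⟩ := Term.split_eq_split.1 h
  obtain rfl := Fin.equiv_iff_eq.1 ⟨e₂⟩
  have h₁ := EnvelopingObjects.IsAct.represents (U.isAct e₂) (U.objects.represents_pt x' a')
  have h₂ : Term.partialApp (O.actEquiv (sumEquiv e₁ e₂) ∙ x') (a' ∘ e₁) =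
      (Term.partialApp x' a').map (Sum.map id e₂.symm) := by
    rw [Term.partialApp, Term.partialApp, Term.map_split_map, Term.split_eq_split]
    exact ⟨e₁, e₂, rfl, rfl, funext fun i => (e₂.symm_apply_apply i).symm⟩
  rw [← h₂] at h₁
  have h₃ : U.pt (O.actEquiv (sumEquiv e₁ e₂) ∙ x') (a' ∘ e₁) = U.operad.act e₂ ∙ U.pt x' a' :=
    (U.objects.represents_pt _ _).unique h₁
  rw [h₃, Term.mk_act]
  congr 1
  funext i
  exact congrArg z' (e₂.apply_symm_apply i)

/-- A formal operation of `U` depends only on a representing formal operation of `O`, modulo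
evaluation in `A`; this is the analogue of `Represents.eq_of_evalRel` with arbitrary inputs in place
of `Fin m`. -/
theorem Rep.eq_of_evalRel {τ τ' : Term U.operad g V} {t t' : Term O g (Elem g A.carrier ⊕ V)}
    (h : U.Rep τ t) (h' : U.Rep τ' t') (r : t.EvalRel A.str t') : τ = τ' := by
  obtain ⟨m, l, x, a, z, rfl, rfl⟩ := h
  obtain ⟨m', l', x', a', z', rfl, rfl⟩ := h'
  obtain ⟨T, h₁, h₂⟩ := r
  obtain ⟨j, y, w, h₃, rfl⟩ := Term.exists_join_of_map_eval h₂.symm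
  rw [mk_pt_congr (h₁.trans h₃)]
  exact congrArg (fun u => Term.mk u z') (U.objects.pt_eval j x' y w)

theorem Rep.unique {τ τ' : Term U.operad g V} {t : Term O g (Elem g A.carrier ⊕ V)}
    (h : U.Rep τ t) (h' : U.Rep τ' t) : τ = τ' :=
  h.eq_of_evalRel h' (.refl _ _)

/-- Substitution for `U` is substitution for `O` that leaves the inputs from `A` alone. Identities
in the monad of `U` can thus be proved in the monad of `O`. -/
theorem Rep.bind {τ : Term U.operad g V} {t : Term O g (Elem g A.carrier ⊕ V)} (h : U.Rep τ t)
    {f : V → Term U.operad g V'} {f' : V → Term O g (Elem g A.carrier ⊕ V')}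
    (hf : ∀ b, U.Rep (f b) (f' b)) :
    U.Rep (τ.bind f) (t.bind (Sum.elim (fun a => .pure (.inl a)) f')) := by
  obtain ⟨m, l, x, a, z, rfl, rfl⟩ := h
  choose j b y c w h₁ h₂ using fun i => hf (z i)
  rw [Term.bind_mk _ z f (fun i => U.pt (y i) (c i)) w h₁, Term.comp]
  have h := rep_mk (EnvelopingObjects.IsComp.represents (U.isComp j) (U.objects.represents_pt x a)
    fun i => U.objects.represents_pt (y i) (c i)) (flat w)
  rw [Term.subst_map] at h
  refine (congrArg (U.Rep _) ?_).mp h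
  symm
  have e : Term.split x a z = (Term.partialApp x a).map (Sum.map id z) :=
    (Term.map_split_map x a (fun i => i) id z).symm
  rw [e, Term.map_bind]
  refine Term.bind_congr _ fun k => ?_
  cases k with
  | inl a => rfl
  | inr i =>
    refine (h₂ i).trans (Eq.trans ?_ (Term.map_split_map (y i) (c i) (fun i => i) id _).symm)
    exact congrArg (Term.split (y i) (c i)) (funext fun k => (flat_apply w i k).symm)

variable (U) in
theorem rep_pure (b : V) : U.Rep (g := g) (.pure b) (.pure (.inr b)) := by
  have h := rep_mk (U.represents_one (g := g)) fun _ => b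
  rw [Term.map_pure] at h
  exact h

theorem rep_embed_mk {n : ℕ} (x : Elem g (O.obj n)) (v : Fin n → V) :
    U.Rep (.mk (U.ofOperad n ∙ x) v) ((Term.mk x v : Term O g V).map .inr) := by
  have h := rep_mk (U := U) (U.objects.represents_ofOp x) v
  rw [Term.map_mk] at h
  rw [Term.map_mk]
  exact h

variable (U)

/-- The formal operation of the enveloping operad given by a formal operation of `O`. -/
def embed (t : Term O g V) : Term U.operad g V :=
  Quotient.lift (fun s : PreTerm O g V => Term.mk (U.ofOperad s.arity ∙ s.op) s.args) (by
    rintro ⟨n, x, v⟩ ⟨n', x', v'⟩ h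
    have e : (Term.mk x v : Term O g V) = Term.mk x' v' := Term.mk_eq_mk.2 h
    exact (rep_embed_mk x v).unique (e ▸ rep_embed_mk x' v')) t

theorem embed_mk {n : ℕ} (x : Elem g (O.obj n)) (v : Fin n → V) :
    U.embed (.mk x v) = .mk (U.ofOperad n ∙ x) v := rfl

theorem rep_embed (t : Term O g V) : U.Rep (U.embed t) (t.map .inr) := by
  obtain ⟨n, x, v, rfl⟩ := t.exists_rep
  exact rep_embed_mk x v

theorem embed_pure (b : V) : U.embed (.pure b : Term O g V) = .pure b := by
  have h := U.rep_embed (.pure b : Term O g V)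
  rw [Term.map_pure] at h
  exact h.unique (U.rep_pure b)

theorem embed_bind (t : Term O g V) (f : V → Term O g V') :
    U.embed (t.bind f) = (U.embed t).bind fun b => U.embed (f b) := by
  have h := (U.rep_embed t).bind fun b => U.rep_embed (f b)
  rw [Term.map_bind] at h
  have h' := U.rep_embed (t.bind f)
  rw [Term.bind_map] at h'
  exact h'.unique h

theorem embed_map (t : Term O g V) (f : V → V') : U.embed (t.map f) = (U.embed t).map f := by
  obtain ⟨n, x, v, rfl⟩ := t.exists_rep
  rw [Term.map_mk, embed_mk, embed_mk, Term.map_mk]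

/-- The formal operation of the enveloping operad given by an element of `A`. -/
def const (a : Elem g A.carrier) : Term U.operad g V :=
  .mk (U.ofAlgebra ∙ a) Fin.elim0

theorem const_map (a : Elem g A.carrier) (f : V → V') :
    (U.const a : Term U.operad g V).map f = U.const a := by
  rw [const, Term.map_mk, const]
  congr 1
  funext i
  exact i.elim0

theorem rep_const (a : Elem g A.carrier) : U.Rep (U.const a : Term U.operad g V) (.pure (.inl a)) := by
  have h := rep_mk (U := U) (U.objects.represents_ofAlg a) (Fin.elim0 : Fin 0 → V)
  rw [Term.map_pure] at h
  exact h

/-- A formal operation of the enveloping operad in terms of its representative. -/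
theorem Rep.eq_bind {U : EnvelopingOperad O A} {τ : Term U.operad g V}
    {t : Term O g (Elem g A.carrier ⊕ V)} (h : U.Rep τ t) :
    τ = (U.embed t).bind (Sum.elim (fun a => U.const a) .pure) := by
  refine h.unique ?_
  have h' := (U.rep_embed t).bind (f := Sum.elim (fun a => U.const a) .pure)
    (f' := Sum.elim (fun a => .pure (.inl a)) fun b => .pure (.inr b)) (by
      rintro (a | b)
      exacts [U.rep_const a, U.rep_pure b])
  rw [Term.map_bind] at h'
  convert h' using 1
  refine t.bind_pure.symm.trans (t.bind_congr fun z => ?_)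
  cases z <;> rfl

theorem const_eval (t : Term O g (Elem g A.carrier)) :
    (U.const (A.str.eval t) : Term U.operad g V) = (U.embed t).bind fun a => U.const a := by
  have h := (U.rep_embed t).bind (f := fun a => (U.const a : Term U.operad g V)) fun a => U.rep_const a
  rw [Term.map_bind] at h
  -- For the single input `t` of the first kind, flattening returns `t` and evaluation returns the
  -- value of `t` in `A`.
  refine (h.eq_of_evalRel (U.rep_const _) ⟨.pure (.inl t), ?_, ?_⟩).symm
  · rw [Term.join, Term.pure_bind]
    rfl
  · rw [Term.map_pure]
    rfl

end EnvelopingOperad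

end EnvelopingTerms

/-! ### Algebras over the enveloping operad -/

section EnvelopingAlgebras

variable {C : Type u} [Category.{v} C] [MonoidalCategory C] [SymmetricCategory C]

open Elem

variable {O : Operad C} {A : OperadAlgebra O} {X Y : C} {Λ : Type} {g : Λ → C} {m : ℕ}

theorem Shape.hom_ext_leaf {F G : X ⟶ Y}
    (h : ∀ {Λ : Type} (g : Λ → C) (x : Elem g X), F ∙ x = G ∙ x) : F = G :=
  Shape.hom_ext (.leaf X) h

namespace UnderStructure

theorem ext_elem {u u' : UnderStructure A X}
    (h : ∀ {Λ : Type} (g : Λ → C) (t : Term O g (Elem g X)), u.str.eval t = u'.str.eval t)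
    (h' : u.map.hom = u'.map.hom) : u = u' := by
  obtain ⟨s, f⟩ := u
  obtain ⟨s', f'⟩ := u'
  obtain rfl : s = s' := AlgebraStructure.ext_elem (isAlgebraHom_iff.2 fun g t => by
    simp only [id_app]
    exact (h g t).trans (congrArg _ t.map_id.symm))
  obtain rfl : f = f' := OperadAlgebra.hom_ext _ _ h'
  rfl

variable (u : UnderStructure A X)

/-- The evaluation of formal operations with inputs in `A` and in an `O`-algebra under `A`. -/
def eval (t : Term O g (Elem g A.carrier ⊕ Elem g X)) : Elem g X :=
  u.str.eval (t.map (Sum.elim (fun a => u.map.hom ∙ a) id))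

theorem map_eval (t : Term O g (Elem g A.carrier)) :
    u.map.hom ∙ A.str.eval t = u.str.eval (t.map fun a => u.map.hom ∙ a) :=
  isAlgebraHom_iff.1 u.map.isAlgebraHom g t

theorem eval_bind {V : Type*} (t : Term O g (Elem g A.carrier ⊕ V))
    (f : V → Term O g (Elem g A.carrier ⊕ Elem g X)) :
    u.eval (t.bind (Sum.elim (fun a => .pure (.inl a)) f)) =
      u.eval (t.map (Sum.map id fun b => u.eval (f b))) := by
  rw [eval, Term.bind_map, u.str.eval_bind, eval, Term.map_map]
  refine congrArg (fun F => u.str.eval (t.map F)) (funext fun z => ?_)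
  cases z with
  | inl a =>
    change u.str.eval (Term.map _ (Term.pure _)) = _
    rw [Term.map_pure, u.str.eval_pure]
    rfl
  | inr b => rfl

theorem eval_map_inr (t : Term O g (Elem g X)) : u.eval (t.map .inr) = u.str.eval t := by
  rw [eval, Term.map_map]
  exact congrArg _ t.map_id

theorem eval_pure_inl (a : Elem g A.carrier) : u.eval (.pure (.inl a)) = u.map.hom ∙ a := by
  rw [eval, Term.map_pure, u.str.eval_pure]
  rfl

theorem eval_pure_inr (x : Elem g X) : u.eval (.pure (.inr x)) = x := by
  rw [eval, Term.map_pure, u.str.eval_pure]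
  rfl

/-- Since `A ⟶ X` is a map of algebras, evaluating a suboperation in `A` and then mapping agrees
with mapping its inputs and evaluating in `X`. -/
theorem eval_eq_of_evalRel {t t' : Term O g (Elem g A.carrier ⊕ Elem g X)}
    (h : t.EvalRel A.str t') : u.eval t = u.eval t' := by
  obtain ⟨T, rfl, rfl⟩ := h
  rw [eval, Term.join, Term.bind_map, u.str.eval_bind, eval, Term.map_map]
  refine congrArg (fun F => u.str.eval (T.map F)) (funext fun z => ?_)
  cases z with
  | inl t =>
    refine Eq.trans ?_ (u.map_eval t).symm
    exact congrArg u.str.eval (Term.map_map t Sum.inl (Sum.elim (fun a => u.map.hom ∙ a) id))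
  | inr b => exact u.eval_pure_inr b

end UnderStructure

variable [HasCountableColimits C] [TensorPreservesCountableColimits C]

namespace EnvelopingOperad

variable (U : EnvelopingOperad O A)

/-- An algebra over the enveloping operad and an `O`-algebra under `A` in which formal operations
have the same values. -/
def Corresponds (s : AlgebraStructure U.operad X) (u : UnderStructure A X) : Prop :=
  ∀ {Λ : Type} {g : Λ → C} {τ : Term U.operad g (Elem g X)}
    {t : Term O g (Elem g A.carrier ⊕ Elem g X)}, U.Rep τ t → s.eval τ = u.eval t

section Restriction

variable (s : AlgebraStructure U.operad X)

/-- The restriction of an algebra structure along `O ⟶ U`. -/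
def restrict : AlgebraStructure O X :=
  have key : ∀ {Λ : Type} {g : Λ → C} {m : ℕ} (x : Elem g (O.obj m)) (v : Fin m → Elem g X),
      ((U.ofOperad m ▷ tensorPow X m) ≫ s.ξ m) ∙ (x ⊠ tf v) = s.eval (U.embed (.mk x v)) := by
    intro Λ g m x v
    rw [comp_app, whiskerRight_app, embed_mk, s.eval_mk]
  -- With `X` as its own only generator, every element comes from a generator and the axioms are
  -- checked on arbitrary inputs.
  AlgebraStructure.ofElem (Pres.isValid_ofShape (.leaf X))
    (fun m => (U.ofOperad m ▷ tensorPow X m) ≫ s.ξ m)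
    (by
      intro Λ g m σ x v _
      rw [key, key, Term.mk_act]
      congr 3
      funext i
      exact congrArg v (σ.symm_apply_apply i))
    (by
      intro Λ g m j x y v _
      have e : Term.mk (O.comp j ∙ (x ⊠ tf y)) (flat v) =
          (Term.mk x fun i => i).bind fun i => Term.mk (y i) (v i) :=
        (Term.bind_mk x (fun i => i) _ y v fun _ => rfl).symm
      simp only [key]
      rw [e, embed_bind, s.eval_bind, ← embed_map, Term.map_mk]
      rfl)
    (by
      intro Λ g v _
      have := key (O.one ∙ (one : Elem g _)) fun _ => v
      rw [this]
      exact (congrArg _ (U.embed_pure v)).trans (s.eval_pure v))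

theorem restrict_eval (t : Term O g (Elem g X)) : (U.restrict s).eval t = s.eval (U.embed t) := by
  obtain ⟨n, x, v, rfl⟩ := t.exists_rep
  rw [AlgebraStructure.eval_mk, embed_mk, AlgebraStructure.eval_mk]
  change ((U.ofOperad n ▷ tensorPow X n) ≫ s.ξ n) ∙ (x ⊠ tf v) = _
  rw [comp_app, whiskerRight_app]

/-- The composite `A ⟶ U(0) ⟶ X`. -/
def restrictMap : A.carrier ⟶ X :=
  U.ofAlgebra ≫ (ρ_ (U.operad.obj 0)).inv ≫
    (U.operad.obj 0 ◁ (tensorPowZero X).inv) ≫ s.ξ 0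

theorem restrictMap_app (a : Elem g A.carrier) : U.restrictMap s ∙ a = s.eval (U.const a) := by
  rw [restrictMap, comp_app, comp_app, rightUnitor_inv_app, comp_app, whiskerLeft_app,
    tensorPowZero_inv_app Fin.elim0]
  rfl

/-- The `O`-algebra under `A` given by an algebra over the enveloping operad. -/
def toUnder : UnderStructure A X where
  str := U.restrict s
  map := ⟨U.restrictMap s, isAlgebraHom_iff.2 fun g t => by
    rw [restrictMap_app, const_eval, s.eval_bind, restrict_eval, embed_map]
    simp only [restrictMap_app]⟩

/-- A formal operation of `U` is one of `O` with constants from `A` inserted (`Rep.eq_bind`), and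
constants are evaluated by the map `A ⟶ U(0) ⟶ X`. -/
theorem corresponds_toUnder : U.Corresponds s (U.toUnder s) := by
  intro Λ g τ t h
  rw [h.eq_bind, UnderStructure.eval]
  change _ = (U.restrict s).eval _
  rw [restrict_eval, embed_map, s.eval_bind]
  refine congrArg (fun F => s.eval ((U.embed t).map F)) (funext fun z => ?_)
  cases z with
  | inl a => exact (U.restrictMap_app s a).symm
  | inr x => exact s.eval_pure x

end Restriction

variable {U}

theorem Corresponds.toUnder_eq {s : AlgebraStructure U.operad X} {u : UnderStructure A X}
    (h : U.Corresponds s u) : U.toUnder s = u := by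
  refine UnderStructure.ext_elem (fun g t => ?_) (Shape.hom_ext_leaf fun g a => ?_)
  · rw [← u.eval_map_inr]
    exact (U.restrict_eval s t).trans (h (U.rep_embed t))
  · rw [← u.eval_pure_inl]
    exact (U.restrictMap_app s a).trans (h (U.rep_const a))

theorem Corresponds.ξ_app {s : AlgebraStructure U.operad X} {u : UnderStructure A X}
    (h : U.Corresponds s u) {t : Term O g (Elem g A.carrier ⊕ Fin m)}
    {w : Elem g (U.operad.obj m)} (ht : U.objects.Represents t w) (z : Fin m → Elem g X) :
    s.ξ m ∙ (w ⊠ tf z) = u.eval (t.map (Sum.map id z)) :=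
  h (rep_mk ht z)

theorem hom_ext_tens_pow {Z : C} {F G : U.operad.obj m ⊗ tensorPow X m ⟶ Z}
    (h : ∀ {Λ : Type} (g : Λ → C) (t) (w : Elem g (U.operad.obj m)) (z : Fin m → Elem g X),
      U.objects.Represents t w → F ∙ (w ⊠ tf z) = G ∙ (w ⊠ tf z)) : F = G := by
  refine (U.objects.isValid_pres m).hom_ext_tens_fin
    (fun _ => Pres.isValid_ofShape (.leaf X)) fun g w z hw _ => ?_
  obtain ⟨t, ht⟩ := U.objects.reach_pres hw
  exact h g t w z ht

theorem Corresponds.unique {s s' : AlgebraStructure U.operad X} {u : UnderStructure A X}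
    (h : U.Corresponds s u) (h' : U.Corresponds s' u) : s = s' := by
  ext m
  refine hom_ext_tens_pow fun g t w z ht => ?_
  rw [h.ξ_app ht, h'.ξ_app ht]

/-- In one direction the compatibility is tested on operations of `O` and on constants from `A`. In
the other, both actions of `U` are computed on representing terms, whose inputs from `A` are fixed
by a map under `A`. -/
theorem Corresponds.isAlgebraHom_iff {s : AlgebraStructure U.operad X} {u : UnderStructure A X}
    (h : U.Corresponds s u) {s' : AlgebraStructure U.operad Y} {u' : UnderStructure A Y}
    (h' : U.Corresponds s' u') {f : X ⟶ Y} : IsAlgebraHom s s' f ↔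
      IsAlgebraHom u.str u'.str f ∧ u.map.hom ≫ f = u'.map.hom := by
  constructor
  · intro hf
    rw [OperadicAlgebra.isAlgebraHom_iff] at hf
    refine ⟨OperadicAlgebra.isAlgebraHom_iff.2 fun g t => ?_, Shape.hom_ext_leaf fun g a => ?_⟩
    · rw [← u.eval_map_inr, ← h (U.rep_embed t), hf, ← u'.eval_map_inr,
        ← h' (U.rep_embed _), embed_map]
    · rw [comp_app, ← u.eval_pure_inl, ← h (U.rep_const a), hf, ← u'.eval_pure_inl,
        ← h' (U.rep_const a), const_map]
  · rintro ⟨hf, e⟩ m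
    refine hom_ext_tens_pow fun g t w z ht => ?_
    rw [comp_app, comp_app, whiskerLeft_app, tensorPowMap_app, h.ξ_app ht, h'.ξ_app ht,
      UnderStructure.eval, OperadicAlgebra.isAlgebraHom_iff.1 hf, UnderStructure.eval,
      Term.map_map, Term.map_map, Term.map_map]
    refine congrArg (fun F => u'.str.eval (t.map F)) (funext fun k => ?_)
    cases k with
    | inl a =>
      change f ∙ u.map.hom ∙ a = u'.map.hom ∙ a
      rw [← e, comp_app]
    | inr i => rfl

variable (U)

/-- The action of the enveloping operad on an `O`-algebra under `A`, on generators. -/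
def actionGen (u : UnderStructure A X) (l m : ℕ) :
    (O.obj (l + m) ⊗ tensorPow A.carrier l) ⊗ tensorPow X m ⟶ X :=
  (α_ (O.obj (l + m)) (tensorPow A.carrier l) (tensorPow X m)).hom ≫
    (O.obj (l + m) ◁ ((tensorPowMap u.map.hom l ▷ tensorPow X m) ≫ tensorPowConcat X l m)) ≫
      u.str.ξ (l + m)

theorem actionGen_app (u : UnderStructure A X) {l m : ℕ} (x : Elem g (O.obj (l + m)))
    (a : Fin l → Elem g A.carrier) (z : Fin m → Elem g X) :
    actionGen u l m ∙ ((x ⊠ tf a) ⊠ tf z) = u.eval (Term.split x a z) := by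
  rw [actionGen, comp_app, associator_app, comp_app, whiskerLeft_app, comp_app, whiskerRight_app,
    tensorPowMap_app, tensorPowConcat_app, UnderStructure.eval, Term.map_split]
  rfl

theorem exists_action (u : UnderStructure A X) (m : ℕ) :
    ∃ ξ : U.operad.obj m ⊗ tensorPow X m ⟶ X, ∀ {Λ : Type} {g : Λ → C} {t}
      {w : Elem g (U.operad.obj m)} (z : Fin m → Elem g X), U.objects.Represents t w →
        ξ ∙ (w ⊠ tf z) = u.eval (t.map (Sum.map id z)) := by
  obtain ⟨ξ, hξ⟩ := Pres.IsValid.exists_hom_tens_fin (U.objects.isValid_pres m)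
    (p := fun _ : Fin m => Pres.ofShape (.leaf X)) (fun _ => Pres.isValid_ofShape _)
    (U.objects.respects_pres m) (fun _ => Pres.respects_ofShape _)
    (fun (l : ℕ) _ => actionGen u l m) (by
      intro Λ g (l : ℕ) (l' : ℕ) _ _
        (x : Elem g (O.obj (l + m)) × (Fin l → Elem g A.carrier))
        (x' : Elem g (O.obj (l' + m)) × (Fin l' → Elem g A.carrier))
        (z : Fin m → Elem g X) (z' : Fin m → Elem g X) hx hz
      obtain rfl : z = z' := funext hz
      refine (actionGen_app u x.1 x.2 z).trans (Eq.trans ?_ (actionGen_app u x'.1 x'.2 z).symm)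
      have h := Term.EvalRel.map hx z
      rw [Term.partialApp, Term.partialApp, Term.map_split_map, Term.map_split_map] at h
      exact u.eval_eq_of_evalRel h)
  refine ⟨ξ, fun {Λ g t w} z ht => ?_⟩
  obtain ⟨l, x, a, rfl, rfl⟩ := ht
  rw [Term.partialApp, Term.map_split_map]
  refine Eq.trans ?_ (actionGen_app u x a z)
  refine Eq.trans ?_ (hξ g l (fun _ => ()) (x, a) z)
  refine congrArg (fun F => ξ ∙ F) (congrArg₂ _ (comp_app _ _ _).symm ?_)
  exact congrArg _ (funext fun i => (id_app (z i)).symm)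

/-- Evaluation of representing terms respects the evaluation relation, so it defines action maps.
Their associativity is `UnderStructure.eval_bind`, and the unit law is the evaluation of a single
input. -/
theorem exists_corresponds (u : UnderStructure A X) :
    ∃ s : AlgebraStructure U.operad X, U.Corresponds s u := by
  choose ξ hξ using U.exists_action u
  refine ⟨{ ξ := ξ, equivariant := fun m σ => ?_, assoc := fun {m} j => ?_, unit := ?_ }, ?_⟩
  · refine hom_ext_tens_pow fun g t w z ht => ?_
    rw [comp_app]
    refine (congrArg _ (U.operad.diagonalAct_app σ w z)).trans ?_
    rw [hξ m _ (EnvelopingObjects.IsAct.represents (U.isAct σ⁻¹) ht), hξ m z ht, Term.map_inr_map]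
    refine congrArg (fun F => u.eval (t.map (Sum.map id F))) (funext fun i => ?_)
    exact congrArg z (σ.symm_apply_apply i)
  · refine (U.objects.isValid_pres m).hom_ext_tens_fin_fin (fun i => U.objects.isValid_pres (j i))
      (fun _ => Pres.isValid_ofShape (.leaf X)) fun g w v z hw hv _ => ?_
    obtain ⟨t, ht⟩ := U.objects.reach_pres hw
    choose s hs using fun i => U.objects.reach_pres (hv i)
    rw [comp_app, whiskerRight_app, comp_app, associator_app, comp_app, whiskerLeft_app, comp_app,
      tensorFinShuffle_pow_app, tensorFinMap_app,
      hξ _ _ (EnvelopingObjects.IsComp.represents (U.isComp j) ht hs), hξ m _ ht, Term.subst_map,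
      u.eval_bind t]
    exact congrArg (fun F => u.eval (t.map (Sum.map id F))) (funext fun i => (hξ (j i) _ (hs i)).symm)
  · refine Shape.hom_ext (.tens .unit (.leaf X)) fun g z => ?_
    obtain ⟨-, x⟩ := z
    change (_ ≫ _) ∙ (one ⊠ x) = (λ_ X).hom ∙ (one ⊠ x)
    rw [comp_app, hom_app, tensorPowOne_inv_app, leftUnitor_app, hξ 1 _ U.represents_one,
      Term.map_pure]
    exact u.eval_pure_inr x
  · intro Λ g τ t h
    obtain ⟨m, l, x, a, z, rfl, rfl⟩ := h
    have := hξ m z (U.objects.represents_pt x a)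
    rw [Term.partialApp, Term.map_split_map] at this
    exact this

/-- Algebras over the enveloping operad are the same as `O`-algebras under `A`. -/
def algebraEquiv (X : C) : AlgebraStructure U.operad X ≃ UnderStructure A X :=
  -- Corresponding structures determine each other: action maps are known on represented elements,
  -- and conversely `O` and `A` embed into the terms of `U`.
  Equiv.ofBijective U.toUnder ⟨fun s s' h =>
    Corresponds.unique (U.corresponds_toUnder s) (h ▸ U.corresponds_toUnder s'), fun u => by
    obtain ⟨s, hs⟩ := U.exists_corresponds u
    exact ⟨s, hs.toUnder_eq⟩⟩

theorem corresponds_algebraEquiv (s : AlgebraStructure U.operad X) :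
    U.Corresponds s (U.algebraEquiv X s) :=
  U.corresponds_toUnder s

theorem ι_proj_ξ {s : AlgebraStructure U.operad X} {u : UnderStructure A X}
    (h : U.Corresponds s u) (l m : ℕ) :
    (((O.shift m).ι l A.carrier ≫ U.proj m) ▷ tensorPow X m) ≫ s.ξ m = actionGen u l m := by
  refine Shape.hom_ext (.tens (.tens (.leaf (O.obj (l + m))) (.fin l fun _ => .leaf A.carrier))
    (.fin m fun _ => .leaf X)) fun g z => ?_
  obtain ⟨⟨x, a⟩, z⟩ := z
  change (_ ≫ _) ∙ ((x ⊠ tf a) ⊠ tf z) = _ ∙ ((x ⊠ tf a) ⊠ tf z)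
  rw [actionGen_app, comp_app, whiskerRight_app, comp_app]
  exact h ⟨m, l, x, a, z, rfl, rfl⟩

end EnvelopingOperad

end EnvelopingAlgebras

/-! ### Coproducts with free algebras -/

/-! ### Universal property of the free algebra over the enveloping operad. -/

section CoproductsWithFreeAlgebras

variable {C : Type u} [Category.{v} C] [MonoidalCategory C] [SymmetricCategory C]
  [HasCountableColimits C] [TensorPreservesCountableColimits C]

open Elem

variable {O : Operad C} {A : OperadAlgebra O} (U : EnvelopingOperad O A) {X : C}

namespace EnvelopingOperad

/-- The map of `O`-algebras from the free `O`-algebra to the free algebra over the enveloping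
operad. -/
def freeMap {u : UnderStructure A (U.operad.free.obj X)} : O.free.obj X ⟶ U.operad.free.obj X :=
  O.free.map (U.operad.unit.app X) ≫ u.str.action

variable {s : AlgebraStructure U.operad (U.operad.free.obj X)}
  {u : UnderStructure A (U.operad.free.obj X)} {a : AlgebraStructure O (O.free.obj X)}

theorem freeMap_inj (hs : IsFreeStructure U.operad X s) (h : U.Corresponds s u)
    {Λ : Type} {g : Λ → C} (t : Term O g (Elem g X)) :
    U.freeMap (u := u) ∙ O.inj t = U.operad.inj (U.embed t) := by
  rw [freeMap, comp_app, O.free_map_inj, u.str.action_inj, ← u.eval_map_inr, ← h (U.rep_embed _),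
    embed_map]
  have := isFreeStructure_iff.1 hs g ((U.embed t).map .pure)
  rw [Term.map_map, Term.map_bind] at this
  simp only [U.operad.unit_app]
  exact this.trans (congrArg _ (U.embed t).bind_pure)

theorem isAlgebraHom_freeMap (ha : IsFreeStructure O X a) :
    IsAlgebraHom a u.str (U.freeMap (u := u)) := by
  obtain ⟨b, hb⟩ := exists_freeStructure O (U.operad.free.obj X)
  exact (ha.isAlgebraHom_map hb _).comp (hb.isAlgebraHom_action u.str)

theorem ι_freeMap (hs : IsFreeStructure U.operad X s) (h : U.Corresponds s u) (m : ℕ) :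
    O.ι m X ≫ U.freeMap (u := u) = (U.ofOperad m ▷ tensorPow X m) ≫ U.operad.ι m X := by
  refine Shape.hom_ext (.tens (.leaf (O.obj m)) (.fin m fun _ => .leaf X)) fun g z => ?_
  obtain ⟨x, v⟩ := z
  change (_ ≫ _) ∙ (x ⊠ tf v) = (_ ≫ _) ∙ (x ⊠ tf v)
  have := U.freeMap_inj hs h (.mk x v)
  rw [embed_mk, O.inj_mk, U.operad.inj_mk] at this
  rw [comp_app, comp_app, whiskerRight_app]
  exact this

theorem unit_freeMap : O.unit.app X ≫ U.freeMap (u := u) = U.operad.unit.app X :=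
  O.unit_map_action u.str _

/-- The free algebra over the enveloping operad is the coproduct with the free `O`-algebra. -/
theorem isColimit_binaryCofan (hs : IsFreeStructure U.operad X s) (h : U.Corresponds s u)
    (ha : IsFreeStructure O X a) :
    Nonempty (IsColimit (BinaryCofan.mk u.map
      (⟨U.freeMap, U.isAlgebraHom_freeMap ha⟩ :
        (⟨O.free.obj X, a⟩ : OperadAlgebra O) ⟶ ⟨U.operad.free.obj X, u.str⟩))) := by
  have key : ∀ (T : OperadAlgebra O) (f₁ : A ⟶ T) (f₂ : (⟨O.free.obj X, a⟩ : OperadAlgebra O) ⟶ T),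
      ∃! d : (⟨U.operad.free.obj X, u.str⟩ : OperadAlgebra O) ⟶ T,
        u.map ≫ d = f₁ ∧ U.freeMap (u := u) ≫ d.hom = f₂.hom := by
    intro T f₁ f₂
    -- The map `f₁` turns `T` into an algebra over `U`; then `d` is the extension of the generator
    -- map underlying `f₂`.
    obtain ⟨sT, hT⟩ := U.exists_corresponds (⟨T.str, f₁⟩ : UnderStructure A T.carrier)
    let d := U.operad.free.map (O.unit.app X ≫ f₂.hom) ≫ sT.action
    have hd : IsAlgebraHom s sT d := by
      obtain ⟨b, hb⟩ := exists_freeStructure U.operad T.carrier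
      exact (hs.isAlgebraHom_map hb _).comp (hb.isAlgebraHom_action sT)
    have hd' := (h.isAlgebraHom_iff hT).1 hd
    have e : U.operad.unit.app X ≫ d = O.unit.app X ≫ f₂.hom := U.operad.unit_map_action sT _
    refine ⟨⟨d, hd'.1⟩, ⟨OperadAlgebra.hom_ext _ _ hd'.2, ?_⟩, ?_⟩
    · refine ha.hom_ext ((U.isAlgebraHom_freeMap ha).comp hd'.1) f₂.isAlgebraHom ?_
      rw [← Category.assoc, unit_freeMap, e]
    -- A competitor is a map under `A`, hence a map of `U`-algebras, and is determined by its
    -- restriction to `X`.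
    · rintro d' ⟨h₁, h₂⟩
      refine OperadAlgebra.hom_ext _ _ (hs.hom_ext ((h.isAlgebraHom_iff hT).2
        ⟨d'.isAlgebraHom, congrArg OperadAlgebra.Hom.hom h₁⟩) hd ?_)
      rw [e, ← h₂, ← Category.assoc, unit_freeMap]
  choose desc hdesc huniq using key
  exact ⟨BinaryCofan.IsColimit.mk _ (fun {T} f₁ f₂ => desc T f₁ f₂) (fun f₁ f₂ => (hdesc _ f₁ f₂).1)
    (fun f₁ f₂ => OperadAlgebra.hom_ext _ _ (hdesc _ f₁ f₂).2)
    fun f₁ f₂ d h₁ h₂ => huniq _ f₁ f₂ d ⟨h₁, congrArg OperadAlgebra.Hom.hom h₂⟩⟩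

end EnvelopingOperad

end CoproductsWithFreeAlgebras

end OperadicAlgebra

end

/-! ### Assembly of the four statements. -/

theorem mainTheorem12 {C : Type u} [Category.{v} C] [MonoidalCategory C] [SymmetricCategory C]
    (O : Operad C) :
    -- limits
    (∀ {J : Type w} [Category.{w'} J] (D : J ⥤ OperadAlgebra O) (c : Cone (D ⋙ OperadAlgebra.forget O)),
      Nonempty (IsLimit c) →
        ∃ (a : AlgebraStructure O c.pt)
          (h : ∀ d, IsAlgebraHom a (D.obj d).str (c.π.app d)),
          (∀ a' : AlgebraStructure O c.pt,
            (∀ d, IsAlgebraHom a' (D.obj d).str (c.π.app d)) → a' = a) ∧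
          Nonempty (IsLimit (OperadAlgebra.coneOf D c a h))) ∧
    (∀ [HasCountableColimits C] [TensorPreservesCountableColimits C],
      -- the canonical algebra structure on `𝕆 X`
      (∀ X : C, ∃! a : AlgebraStructure O (O.free.obj X), IsFreeStructure O X a) ∧
      -- colimits
      (∀ {J : Type w} [Category.{w'} J] (D : J ⥤ OperadAlgebra O)
        (cD : Cocone (D ⋙ OperadAlgebra.forget O)) (hD : IsColimit cD)
        (cO : Cocone ((D ⋙ OperadAlgebra.forget O) ⋙ O.free)) (hO : IsColimit cO)
        (a : AlgebraStructure O (O.free.obj cD.pt)) (_ : IsFreeStructure O cD.pt a)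
        (a' : AlgebraStructure O (O.free.obj cO.pt)) (_ : IsFreeStructure O cO.pt a'),
        colimReflexion D cO hD ≫ colimFst D hO cD = 𝟙 _ ∧
        colimReflexion D cO hD ≫ colimSnd D hO cD a = 𝟙 _ ∧
        HasCoequalizer (colimFst D hO cD) (colimSnd D hO cD a) ∧
        ∀ k : Cofork (colimFst D hO cD) (colimSnd D hO cD a), Nonempty (IsColimit k) →
          ∃ b : AlgebraStructure O k.pt,
            IsAlgebraHom a b k.π ∧
            (∀ b' : AlgebraStructure O k.pt, IsAlgebraHom a b' k.π → b' = b) ∧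
            (∃ (p q : (⟨O.free.obj cO.pt, a'⟩ : OperadAlgebra O) ⟶ ⟨O.free.obj cD.pt, a⟩)
              (r : (⟨O.free.obj cD.pt, a⟩ : OperadAlgebra O) ⟶ ⟨k.pt, b⟩) (hr : p ≫ r = q ≫ r),
              p.hom = colimFst D hO cD ∧ q.hom = colimSnd D hO cD a ∧ r.hom = k.π ∧
              Nonempty (IsColimit (Cofork.ofπ r hr))) ∧
            ∃ h : ∀ d, IsAlgebraHom (D.obj d).str b
                ((cD.extend (O.unit.app cD.pt ≫ k.π)).ι.app d),
              Nonempty (IsColimit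
                (OperadAlgebra.coconeOf D (cD.extend (O.unit.app cD.pt ≫ k.π)) b h))) ∧
      -- the enveloping operad
      (∀ A : OperadAlgebra O, Nonempty (EnvelopingOperad O A) ∧
        ∀ U : EnvelopingOperad O A,
          ∃ Φ : ∀ X : C, AlgebraStructure U.operad X ≃ UnderStructure A X,
            (∀ (X : C) (s : AlgebraStructure U.operad X),
              (∀ m, ((Φ X s).str).ξ m = (U.ofOperad m ▷ tensorPow X m) ≫ s.ξ m) ∧
              (Φ X s).map.hom = U.ofAlgebra ≫ (ρ_ (U.operad.obj 0)).inv ≫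
                (U.operad.obj 0 ◁ (tensorPowZero X).inv) ≫ s.ξ 0 ∧
              ∀ l m, (((O.shift m).ι l A.carrier ≫ U.proj m) ▷ tensorPow X m) ≫ s.ξ m =
                (α_ (O.obj (l + m)) (tensorPow A.carrier l) (tensorPow X m)).hom ≫
                  (O.obj (l + m) ◁
                    ((tensorPowMap (Φ X s).map.hom l ▷ tensorPow X m) ≫
                      tensorPowConcat X l m)) ≫ (Φ X s).str.ξ (l + m)) ∧
            (∀ (X Y : C) (s : AlgebraStructure U.operad X) (t : AlgebraStructure U.operad Y)
              (f : X ⟶ Y), IsAlgebraHom s t f ↔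
                IsAlgebraHom (Φ X s).str (Φ Y t).str f ∧
                  (Φ X s).map.hom ≫ f = (Φ Y t).map.hom) ∧
            -- the coproduct of `A` and `𝕆 X`
            (∀ (X : C) (a : AlgebraStructure O (O.free.obj X)) (_ : IsFreeStructure O X a),
              ∃ s : AlgebraStructure U.operad (U.operad.free.obj X),
                IsFreeStructure U.operad X s ∧
                ∃ g : (⟨O.free.obj X, a⟩ : OperadAlgebra O) ⟶
                    ⟨U.operad.free.obj X, (Φ (U.operad.free.obj X) s).str⟩,
                  (∀ m, O.ι m X ≫ g.hom = (U.ofOperad m ▷ tensorPow X m) ≫ U.operad.ι m X) ∧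
                  Nonempty (IsColimit (BinaryCofan.mk (Φ (U.operad.free.obj X) s).map g))))) := by
  refine ⟨fun D c hc => exists_limit_structure D c hc.some, fun {_ _} => ⟨fun X => ?_, ?_, fun A => ?_⟩⟩
  · obtain ⟨a, ha⟩ := exists_freeStructure O X
    exact ⟨a, ha, fun a' ha' => ha'.unique ha⟩
  · intro J _ D cD hD cO hO a ha a' ha'
    exact ⟨colimReflexion_fst D hD hO, colimReflexion_snd D hD hO ha, inferInstance,
      fun k hk => exists_colimit_structure D hO hD ha ha' k hk.some⟩
  · refine ⟨nonempty_envelopingOperad A, fun U => ⟨U.algebraEquiv, ?_, ?_, ?_⟩⟩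
    · intro X s
      -- The restriction formulas hold by construction of `toUnder`; only the formula on generators
      -- needs the correspondence of values.
      exact ⟨fun m => rfl, rfl, fun l m => U.ι_proj_ξ (U.corresponds_algebraEquiv s) l m⟩
    · intro X Y s t f
      exact EnvelopingOperad.Corresponds.isAlgebraHom_iff (U.corresponds_algebraEquiv s)
        (U.corresponds_algebraEquiv t)
    · intro X a ha
      obtain ⟨s, hs⟩ := exists_freeStructure U.operad X
      have h : U.Corresponds s (U.algebraEquiv _ s) := U.corresponds_algebraEquiv s
      exact ⟨s, hs, ⟨U.freeMap, U.isAlgebraHom_freeMap ha⟩, U.ι_freeMap hs h,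
        U.isColimit_binaryCofan hs h ha⟩
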